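/- **Setting.** Let $\mathcal A,\mathcal E$ be finite sets of actions and percepts, $\Sigma=\mathcal A\sqcup\mathcal E$. A probabilistic oracle machine $T$ computes deterministically between interactions, may request fair random bits, may query an oracle $O$, and may halt with an output. An oracle answers a query $(T,x,p)$ about a symbol $s$ (with $x\in\Sigma^*$, $p\in\mathbb Q$, $s\in\Sigma$) with $1$ with probability $O_s(T,x,p)\in[0,1]$, independently at each call. Let $\lambda_T^O(s\mid x)$ be the probability that $T$ with oracle $O$ outputs $s$ on input $x$. $O$ is a (typed) *reflective oracle* if for all $T,x$ there are $(q_s)_{s\in\Sigma}$ with $\sum_{a\in\mathcal A}q_a=1=\sum_{e\in\mathcal E}q_e$, with $\lambda^O_T(s\mid x)\le q_s\le 1-\sum_{s'}\lambda_T^O(s'\mid x)$ (sum over the symbols $s'\ne s$ of the same type as $s$), and with $O_s(T,x,p)=1$ for $p<q_s$ and $O_s(T,x,p)=0$ for $p>q_s$; these $q_s$ are unique, and $\bar\lambda^O_T(s\mid x):=q_s$. Fix a reflective oracle $O$. A policy $\pi$ assigns to each history $h=a_0e_0\dots a_{t-1}e_{t-1}$ a probability distribution $\pi(\cdot\mid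 h)$ on $\mathcal A$. $\mathcal P^O_{\rm refl}$ is the class of *reflective-oracle computable* policies, those with $\pi(a\mid h)=\lambda^O_T(a\mid h)$ for some machine $T$ and all $h,a$. $\mathcal M^O_{\rm refl}$ is the class of environments $\nu_T(e\mid ha)=\bar\lambda^O_T(e\mid ha)$, $T$ a machine. A real function $f$ is *estimable* if some computable rational-valued $\varphi$ satisfies $|f(x)-\varphi(x,k)|<1/k$ for all $x$ and $k\ge1$; it is *$O$-estimable* if some machine with oracle $O$ on input $(x,k)$ halts with probability $1$ with a rational within $1/k$ of $f(x)$. (Estimable functions are $O$-estimable.) Rewards are given by an estimable $r:\mathcal E\to[0,1]$. The discount $\gamma_t\ge0$ is summable, $\Gamma_t=\sum_{k\ge t}\gamma_k$, and the value is $$V^\pi_\nu(h)=\frac1{\Gamma_t}\lim_{m\to\infty}\sum_{a_te_t\dots a_{t+m-1}e_{t+m-1}}\Big(\sum_{i=t}^{t+m-1}\gamma_i r(e_i)\Big)\prod_{j=t}^{t+m-1}\pi(a_j\mid h_{<j})\,\nu(e_j\mid h_{<j}a_j)\qquad(t=|h|),$$ where $h_{<j}:=h\,a_te_t\dots a_{j-1}e_{j-1}$.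 A policy $\pi^*_\nu$ is optimal for $\nu$ if it maximizes $V^\pi_\nu(h)$ over all policies $\pi$ at every $h$. Let $w$ be a prior over $\mathcal M^O_{\rm refl}$ that is normalized, $\sum_\rho w(\rho)=1$, and $O$-estimable in the sense that $w(\rho)=\sum_{T:\nu_T=\rho}v(T)$ for some $O$-estimable $v\ge0$ on machines; every estimable $v\ge 0$ is allowed. Put $\rho(h)=\prod_{j<|h|}\rho(e_j\mid h_{<j}a_j)$, where now $h_{<j}=a_0e_0\dots a_{j-1}e_{j-1}$, $\xi(h)=\sum_\rho w(\rho)\rho(h)$ and $w(\rho\mid h)=w(\rho)\rho(h)/\xi(h)$. **Thompson sampling.** For $\varepsilon_t>0$ let $H_t(\varepsilon_t)=\min\{k:\Gamma_{t+k}/\Gamma_t\le\varepsilon_t\}$, with resampling times $t_0=0$, $t_{i+1}=t_i+H_{t_i}(\varepsilon_{t_i})$ (a horizon that is $0$, because $\varepsilon_t\ge1$, or undefined, because $\Gamma_t=0$, is replaced by $1$). A policy $\pi$ is a *Thompson sampling policy* $\pi_{TS}$ for $\varepsilon$ if, for some choice of an optimal policy $\pi^*_\rho$ for each $\rho\in\mathcal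 M^O_{\rm refl}$, for all histories $h$ of length $t$ and actions $a$, with $t'$ the last resampling time $\le t$, $$\pi(a\mid h)=\sum_{\rho\in\mathcal M^O_{\rm refl}}w(\rho\mid h_{<t'})\,\frac{\pi^*_\rho(h_{t':t}\mid h_{<t'})}{\pi(h_{t':t}\mid h_{<t'})}\,\pi^*_\rho(a\mid h)$$ whenever $\xi(h_{<t'})>0$ and $\pi(h_{t':t}\mid h_{<t'})>0$. Here $h_{t':t}$ is the part of $h$ at steps $t',\dots,t-1$, and $\pi(h_{t':t}\mid h_{<t'})$ is the product of the action probabilities along it. **Theorem.** Assume that $t\mapsto\Gamma_t$ is estimable and that $w$ is a normalized ($O$-)estimable prior over $\mathcal M^O_{\rm refl}$. 1. For every positive sequence $\varepsilon$ for which $t\mapsto H_t(\varepsilon_t)$ is computable (with $H_t:=0$ if $\Gamma_t=0$), there is a Thompson sampling policy for $\varepsilon$ in $\mathcal P^O_{\rm refl}$. 2. For every positive estimable sequence $\varepsilon$ there is a sequence $\varepsilon'$ with $\varepsilon_t/2\le\varepsilon'_t\le\varepsilon_t$ for all $t$ such that $t\mapsto H_t(\varepsilon'_t)$ is computable and there is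 a Thompson sampling policy for $\varepsilon'$ in $\mathcal P^O_{\rm refl}$. 3. If moreover $w(\rho)>0$ for all $\rho\in\mathcal M^O_{\rm refl}$, then for every $\varepsilon$ as in 1 the Thompson sampling version of the strong grain of truth property holds for $\mathcal P^O_{\rm refl}$ and the class of $O$-estimable games: all prior weights are positive; for every $n$, every $n$-player game $\sigma:(\mathcal A^n\times\mathcal E^n)^*\times\mathcal A^n\to\Delta(\mathcal E^n)$ with $O$-estimable conditionals, every player $i$ and all policies $\pi_j\in\mathcal P^O_{\rm refl}$ $(j\ne i)$ of the other players, the subjective environment of player $i$ is in $\mathcal M^O_{\rm refl}$, that is, some $\rho\in\mathcal M^O_{\rm refl}$ satisfies $\rho(e\mid ha)=\sigma^\pi_i(hae)/\sigma^\pi_i(ha)$ whenever $\sigma^\pi_i(ha)>0$, for every policy $\pi_i$ of player $i$, where $\sigma^\pi_i$ is the distribution of player $i$'s history when all players follow $\pi=(\pi_1,\dots,\pi_n)$ in $\sigma$; and some Thompson sampling policy for $\varepsilon$ is in $\mathcal P^O_{\rm refl}$. -/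

import Mathlib

open Filter Topology
open scoped BigOperators

namespace ReflOracle

/-! ### Estimable functions -/

/-- A triple of naturals read as a rational number (every rational has such a code). -/
def ratOf (c : ℕ × ℕ × ℕ) : ℚ := ((c.1 : ℚ) - (c.2.1 : ℚ)) / ((c.2.2 : ℚ) + 1)

/-- `f` is estimable: a computable rational-valued `φ` satisfies `|f x - φ (x, k)| < 1 / k`
for all `k ≥ 1`. -/
def IsEstimable {α : Type*} [Primcodable α] (f : α → ℝ) : Prop :=
  ∃ φ : α × ℕ → ℕ × ℕ × ℕ, Computable φ ∧
    ∀ (x : α) (k : ℕ), 0 < k → |f x - (ratOf (φ (x, k)) : ℝ)| < 1 / (k : ℝ)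

/-! ### Probabilistic oracle machines

A machine is a program that interacts with a source of fair coin flips and with an oracle. Between
two interactions it performs an ordinary deterministic computation, so that what it does next is
a partial recursive function of its input and of the list of bits (coin flips and oracle answers)
it has received so far. It can halt with an output, ask for a coin flip, query the oracle, or run
forever. -/

/-- Descriptions of machines: programs for partial recursive functions. -/
abbrev Machine := Nat.Partrec.Code

/-- What a machine does at an interaction: `Sum.inl m` halts with output (coded by) `m`;
`Sum.inr none` requests a random bit; `Sum.inr (some (T, x, (u, v), s))` queries the oracle about
machine `T`, input string `x`, rational `u / (v + 1)` and symbol `s`. -/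
abbrev Instr (S : Type*) := ℕ ⊕ Option (Machine × List S × (ℕ × ℕ) × S)

/-- An oracle on the alphabet `S`: the probability of answering `1` to the query `(T, x, p)` about
the symbol `s`. -/
abbrev Oracle (S : Type*) := Machine → List S → ℚ → S → unitInterval

section Machines

variable {S : Type*} [Primcodable S]

open Classical in
/-- The next instruction of machine `T` on input `n`, after it has received the bits `b`. It is
`none` if the program diverges or does not produce a valid instruction. -/
noncomputable def nextInstr (T : Machine) (n : ℕ) (b : List Bool) : Option (Instr S) :=
  (T.eval (Encodable.encode (n, b))).toOption.bind Encodable.decode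

open Classical in
/-- The probability that `T` with oracle `O` on input `n`, having received the bits `b`, halts
with an output in `Y` within fewer than the given number of further interactions. -/
noncomputable def runProb (O : Oracle S) (T : Machine) (n : ℕ) (Y : Set ℕ) :
    ℕ → List Bool → ℝ
  | 0, _ => 0
  | k + 1, b =>
    match (nextInstr T n b : Option (Instr S)) with
    | none => 0
    | some (Sum.inl m) => if m ∈ Y then 1 else 0
    | some (Sum.inr none) =>
        1 / 2 * runProb O T n Y k (b ++ [true]) + 1 / 2 * runProb O T n Y k (b ++ [false])
    | some (Sum.inr (some (T', x, c, s))) =>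
        (O T' x ((c.1 : ℚ) / ((c.2 : ℚ) + 1)) s : ℝ) * runProb O T n Y k (b ++ [true]) +
        (1 - (O T' x ((c.1 : ℚ) / ((c.2 : ℚ) + 1)) s : ℝ)) * runProb O T n Y k (b ++ [false])

/-- The probability that `T` with oracle `O` halts on input `n` with an output in `Y`: the
limit (supremum) of a nondecreasing sequence in `[0, 1]`. -/
noncomputable def outProb (O : Oracle S) (T : Machine) (n : ℕ) (Y : Set ℕ) : ℝ :=
  ⨆ k : ℕ, runProb O T n Y k []

/-- `λ_T^O(s | x)`: the probability that `T` with oracle `O` outputs the symbol `s` on the input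
string `x`. -/
noncomputable def lam (O : Oracle S) (T : Machine) (x : List S) (s : S) : ℝ :=
  outProb O T (Encodable.encode x) {Encodable.encode s}

/-- `f` is `O`-estimable: some machine with oracle `O`, on input `(x, k)` with `k ≥ 1`, halts with
probability one with a rational number within `1 / k` of `f x`. -/
def IsOEstimable {α : Type*} [Primcodable α] (O : Oracle S) (f : α → ℝ) : Prop :=
  ∃ T : Machine, ∀ (x : α) (k : ℕ), 0 < k →
    outProb O T (Encodable.encode (x, k))
      {m | ∃ c : ℕ × ℕ × ℕ, Encodable.decode m = some c ∧
        |f x - (ratOf c : ℝ)| < 1 / (k : ℝ)} = 1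

/-- Estimable functions are `O`-estimable. -/
theorem IsEstimable.isOEstimable {α : Type*} [Primcodable α] {f : α → ℝ} (O : Oracle S)
    (hf : IsEstimable f) : IsOEstimable O f := by
  obtain ⟨φ, hφ, h⟩ := hf
  have hc : Computable (fun z : (α × ℕ) =>
      (Sum.inl (Encodable.encode (φ z)) : Instr S)) :=
    Computable.sumInl.comp (Computable.encode.comp hφ)
  let g : ℕ →. ℕ := fun n =>
    Part.bind (Part.ofOption (Encodable.decode (α := ℕ × List Bool) n)) fun z =>
      Part.bind (Part.ofOption (Encodable.decode (α := α × ℕ) z.1)) fun y =>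
        Part.some (Encodable.encode (Sum.inl (Encodable.encode (φ y)) : Instr S))
  have hg : Nat.Partrec g := by
    have : Partrec g := by
      refine Partrec.bind (Computable.ofOption Computable.decode) ?_
      refine Partrec.bind (Computable.ofOption (Computable.decode.comp
        (Computable.fst.comp Computable.snd))) ?_
      exact (Computable.encode.comp (hc.comp Computable.snd))
    exact Partrec.nat_iff.1 this
  obtain ⟨T, hT⟩ := Nat.Partrec.Code.exists_code.1 hg
  refine ⟨T, fun x k hk => ?_⟩
  have hstep : (nextInstr T (Encodable.encode (x, k)) [] : Option (Instr S)) =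
      some (Sum.inl (Encodable.encode (φ (x, k)))) := by
    have : T.eval (Encodable.encode (Encodable.encode (x, k), ([] : List Bool))) =
        Part.some (Encodable.encode (Sum.inl (Encodable.encode (φ (x, k))) : Instr S)) := by
      rw [hT]
      simp only [g, Encodable.encodek, Part.ofOption, Part.bind_some]
    unfold nextInstr
    rw [this]
    simp only [Part.toOption]
    simp only [Part.some_dom, dif_pos, Part.get_some, Option.bind_some, Encodable.encodek]
  have hrun : ∀ j : ℕ, runProb O T (Encodable.encode (x, k))
      {m | ∃ c : ℕ × ℕ × ℕ, Encodable.decode m = some c ∧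
        |f x - (ratOf c : ℝ)| < 1 / (k : ℝ)} (j + 1) [] = 1 := by
    intro j
    rw [runProb, hstep]
    exact if_pos ⟨φ (x, k), Encodable.encodek _, h x k hk⟩
  refine le_antisymm (ciSup_le ?_) ?_
  · rintro (_ | j)
    · rw [runProb]
      exact zero_le_one
    · exact (hrun j).le
  · refine le_trans (hrun 0).ge (le_ciSup (f := fun j => runProb O T (Encodable.encode (x, k))
      {m | ∃ c : ℕ × ℕ × ℕ, Encodable.decode m = some c ∧
        |f x - (ratOf c : ℝ)| < 1 / (k : ℝ)} j []) ?_ 1)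
    refine ⟨1, ?_⟩
    rintro _ ⟨_ | j, rfl⟩
    · simp only [runProb]
      exact zero_le_one
    · exact (hrun j).le

end Machines

/-! ### Typed reflective oracles and completions

The alphabet is the disjoint union `A ⊕ E` of actions and percepts. -/

section Agents

variable {A E : Type*} [Fintype A] [Fintype E] [Primcodable A] [Primcodable E]

open Classical in
/-- `q` completes `λ_T^O(· | x)` separately on each of the two types of symbols, and the oracle
answers queries about `(T, x)` according to `q`. Probability of an output of the other type is
treated like probability of not halting. -/
structure IsCompletion (O : Oracle (A ⊕ E)) (T : Machine) (x : List (A ⊕ E))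
    (q : A ⊕ E → ℝ) : Prop where
  sum_actions : ∑ a : A, q (Sum.inl a) = 1
  sum_percepts : ∑ e : E, q (Sum.inr e) = 1
  lower : ∀ s, lam O T x s ≤ q s
  upper_action : ∀ a : A,
    q (Sum.inl a) ≤ 1 - ∑ b ∈ Finset.univ.erase a, lam O T x (Sum.inl b)
  upper_percept : ∀ e : E,
    q (Sum.inr e) ≤ 1 - ∑ b ∈ Finset.univ.erase e, lam O T x (Sum.inr b)
  answer_one : ∀ (s : A ⊕ E) (p : ℚ), (p : ℝ) < q s → (O T x p s : ℝ) = 1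
  answer_zero : ∀ (s : A ⊕ E) (p : ℚ), q s < (p : ℝ) → (O T x p s : ℝ) = 0

/-- Typed reflective oracles. -/
def IsReflective (O : Oracle (A ⊕ E)) : Prop :=
  ∀ (T : Machine) (x : List (A ⊕ E)), ∃ q : A ⊕ E → ℝ, IsCompletion O T x q

/-- The completion is unique. -/
theorem IsCompletion.unique {O : Oracle (A ⊕ E)} {T : Machine} {x : List (A ⊕ E)}
    {q q' : A ⊕ E → ℝ} (h : IsCompletion O T x q) (h' : IsCompletion O T x q') : q = q' := by
  funext s
  by_contra hne
  rcases lt_or_gt_of_ne hne with hlt | hlt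
  · obtain ⟨p, hp1, hp2⟩ := exists_rat_btwn hlt
    have h1 := h.answer_zero s p hp1
    have h2 := h'.answer_one s p hp2
    linarith
  · obtain ⟨p, hp1, hp2⟩ := exists_rat_btwn hlt
    have h1 := h'.answer_zero s p hp1
    have h2 := h.answer_one s p hp2
    linarith

/-- `λ̄_T^O(s | x)`: the completed conditional probabilities. -/
noncomputable def compl {O : Oracle (A ⊕ E)} (hO : IsReflective O) (T : Machine)
    (x : List (A ⊕ E)) : A ⊕ E → ℝ :=
  Classical.choose (hO T x)

/-! ### Histories, policies, environments

Time steps are `0, 1, 2, …`; a history of length `t` lists the action-percept pairs of the steps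
before `t`. -/

/-- The string `a₁e₁a₂e₂…` representing a history. -/
def histStr (h : List (A × E)) : List (A ⊕ E) :=
  h.flatMap fun z => [Sum.inl z.1, Sum.inr z.2]

/-- `π h a` is the conditional probability `π(a | h)`. -/
abbrev Policy (A E : Type*) := List (A × E) → A → ℝ

/-- `ρ h a e` is the conditional probability `ρ(e | h a)`. -/
abbrev Env (A E : Type*) := List (A × E) → A → E → ℝ

def IsPolicy (π : Policy A E) : Prop :=
  ∀ h, (∀ a, 0 ≤ π h a) ∧ ∑ a, π h a = 1

/-- `P_refl^O`: the reflective-oracle computable policies. -/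
def PRefl (O : Oracle (A ⊕ E)) : Set (Policy A E) :=
  {π | IsPolicy π ∧ ∃ T : Machine, ∀ h a, π h a = lam O T (histStr h) (Sum.inl a)}

/-- The environment `ν_T = λ̄_T^O`. -/
noncomputable def envOf {O : Oracle (A ⊕ E)} (hO : IsReflective O) (T : Machine) : Env A E :=
  fun h a e => compl hO T (histStr h ++ [Sum.inl a]) (Sum.inr e)

/-- `M_refl^O`: the reflective-oracle computable environments, effectively enumerated (with
repetitions) by `T ↦ ν_T`. -/
def MRefl {O : Oracle (A ⊕ E)} (hO : IsReflective O) : Set (Env A E) :=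
  Set.range (envOf hO)

/-- The product of the action probabilities along `s`, continuing the history `h`. -/
def polProb (π : Policy A E) : List (A × E) → List (A × E) → ℝ
  | _, [] => 1
  | h, (a, e) :: s => π h a * polProb π (h ++ [(a, e)]) s

/-- The product of the percept probabilities along `s`, continuing the history `h`. -/
def envProb (ρ : Env A E) : List (A × E) → List (A × E) → ℝ
  | _, [] => 1
  | h, (a, e) :: s => ρ h a e * envProb ρ (h ++ [(a, e)]) s

/-! ### Values and optimal policies -/

/-- The discount normalization factor `Γ_t = ∑_{k ≥ t} γ_k`. -/
noncomputable def discNorm (γ : ℕ → ℝ) (t : ℕ) : ℝ := ∑' k : ℕ, γ (t + k)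

/-- The discounted reward sum along `s`, whose first step happens at time `t`. -/
def discReward (r : E → ℝ) (γ : ℕ → ℝ) : ℕ → List (A × E) → ℝ
  | _, [] => 0
  | t, (_, e) :: s => γ t * r e + discReward r γ (t + 1) s

/-- The value `V^π_ρ(h)` of policy `π` in environment `ρ` after history `h`. -/
noncomputable def value (r : E → ℝ) (γ : ℕ → ℝ) (ρ : Env A E) (π : Policy A E)
    (h : List (A × E)) : ℝ :=
  1 / discNorm γ h.length *
    limUnder atTop (fun m : ℕ => ∑ s : Fin m → A × E,
      discReward r γ h.length (List.ofFn s) *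
        (polProb π h (List.ofFn s) * envProb ρ h (List.ofFn s)))

/-- `π` is an optimal policy for `ρ`: it maximizes the value after every history. -/
def IsOptimal (r : E → ℝ) (γ : ℕ → ℝ) (ρ : Env A E) (π : Policy A E) : Prop :=
  IsPolicy π ∧ ∀ π' : Policy A E, IsPolicy π' → ∀ h, value r γ ρ π' h ≤ value r γ ρ π h

/-! ### Priors over `M_refl^O` -/

/-- A prior over `M_refl^O` is `O`-estimable if it is given by `O`-estimable weights on the
effective enumeration `T ↦ ν_T` of `M_refl^O`: the weight of an environment is the sum of the
weights of its indices. -/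
def IsOEstimablePrior {O : Oracle (A ⊕ E)} (hO : IsReflective O) (w : MRefl hO → ℝ) : Prop :=
  ∃ v : Machine → ℝ, (∀ T, 0 ≤ v T) ∧ IsOEstimable O v ∧
    ∀ ρ : MRefl hO, HasSum (fun T : {T : Machine // envOf hO T = ρ.1} => v T.1) (w ρ)

/-- The mixture `ξ(h) = ∑_ρ w(ρ) ρ(h)`. -/
noncomputable def mixture {O : Oracle (A ⊕ E)} (hO : IsReflective O) (w : MRefl hO → ℝ)
    (h : List (A × E)) : ℝ :=
  ∑' ρ : MRefl hO, w ρ * envProb ρ.1 [] h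

/-- The posterior `w(ρ | h) = w(ρ) ρ(h) / ξ(h)`. -/
noncomputable def posterior {O : Oracle (A ⊕ E)} (hO : IsReflective O) (w : MRefl hO → ℝ)
    (ρ : MRefl hO) (h : List (A × E)) : ℝ :=
  w ρ * envProb ρ.1 [] h / mixture hO w h

/-! ### Thompson sampling -/

/-- The effective horizon `H_t(δ) = min {k | Γ_{t+k} / Γ_t ≤ δ}`. -/
noncomputable def horizon (γ : ℕ → ℝ) (t : ℕ) (δ : ℝ) : ℕ :=
  sInf {k : ℕ | discNorm γ (t + k) / discNorm γ t ≤ δ}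

/-- The resampling times `t_0 = 0`, `t_{i+1} = t_i + H_{t_i}(ε_{t_i})`. If `Γ_t > 0` and `ε_t < 1`
the horizon is at least `1`; in the remaining cases it is replaced by `1`, so that the algorithm
makes progress. -/
noncomputable def resampleTime (γ ε : ℕ → ℝ) : ℕ → ℕ
  | 0 => 0
  | i + 1 => resampleTime γ ε i +
      max 1 (horizon γ (resampleTime γ ε i) (ε (resampleTime γ ε i)))

/-- The last resampling time that is at most `t`. -/
noncomputable def lastResample (γ ε : ℕ → ℝ) (t : ℕ) : ℕ :=
  sSup {s : ℕ | s ≤ t ∧ ∃ i, resampleTime γ ε i = s}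

/-- `π` is a Thompson sampling policy over `M_refl^O` with prior `w` and schedule `ε`, for some
choice `opt` of an optimal policy for each environment. With `t' = lastResample γ ε t`, where `t`
is the length of `h`,
`π(a | h) = ∑_ρ w(ρ | h_{<t'}) · (π*_ρ(h_{t':t} | h_{<t'}) / π(h_{t':t} | h_{<t'})) · π*_ρ(a | h)`
at all histories at which this is defined, that is, unless `ξ` or `π` gives probability zero to
what is conditioned on. -/
def IsThompson {O : Oracle (A ⊕ E)} (hO : IsReflective O) (r : E → ℝ) (γ ε : ℕ → ℝ)
    (w : MRefl hO → ℝ) (π : Policy A E) : Prop :=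
  IsPolicy π ∧ ∃ opt : MRefl hO → Policy A E,
    (∀ ρ : MRefl hO, IsOptimal r γ ρ.1 (opt ρ)) ∧
    ∀ (h : List (A × E)) (a : A) (past block : List (A × E)),
      past = h.take (lastResample γ ε h.length) →
      block = h.drop (lastResample γ ε h.length) →
      0 < mixture hO w past → 0 < polProb π past block →
      π h a = ∑' ρ : MRefl hO, posterior hO w ρ past *
        (polProb (opt ρ) past block / polProb π past block) * opt ρ h a

/-! ### Multi-player games and subjective environments -/

/-- Joint histories of `n` players. -/
abbrev JHist (n : ℕ) (A E : Type*) := List ((Fin n → A) × (Fin n → E))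

/-- `σ H a e` is the conditional probability `σ(e | H a)`. -/
abbrev Game (n : ℕ) (A E : Type*) := JHist n A E → (Fin n → A) → (Fin n → E) → ℝ

def IsGame {n : ℕ} (σ : Game n A E) : Prop :=
  ∀ H a, (∀ e, 0 ≤ σ H a e) ∧ ∑ e, σ H a e = 1

/-- The conditionals of the game are `O`-estimable. -/
def IsOEstimableGame {n : ℕ} (O : Oracle (A ⊕ E)) (σ : Game n A E) : Prop :=
  IsOEstimable O fun z : JHist n A E × (Fin n → A) × (Fin n → E) => σ z.1 z.2.1 z.2.2

/-- The history seen by player `i`. -/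
def proj {n : ℕ} (i : Fin n) (H : JHist n A E) : List (A × E) :=
  H.map fun z => (z.1 i, z.2 i)

/-- The probability of the continuation `s` of the joint history `H` when the players follow
the policies `π` in the game `σ`; `σ^π(H)` is `playProb σ π [] H`. -/
def playProb {n : ℕ} (σ : Game n A E) (π : Fin n → Policy A E) :
    JHist n A E → JHist n A E → ℝ
  | _, [] => 1
  | H, (a, e) :: s =>
      (∏ j, π j (proj j H) (a j)) * σ H a e * playProb σ π (H ++ [(a, e)]) s

open Classical in
/-- `σ_i^π(h)`: the marginal probability that player `i` sees the history `h`. -/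
noncomputable def margHist {n : ℕ} (σ : Game n A E) (π : Fin n → Policy A E) (i : Fin n)
    (h : List (A × E)) : ℝ :=
  ∑ H : Fin h.length → (Fin n → A) × (Fin n → E),
    if proj i (List.ofFn H) = h then playProb σ π [] (List.ofFn H) else 0

open Classical in
/-- `σ_i^π(h a)`: the marginal probability that player `i` sees the history `h` and then takes
the action `a`. -/
noncomputable def margHistAct {n : ℕ} (σ : Game n A E) (π : Fin n → Policy A E) (i : Fin n)
    (h : List (A × E)) (a : A) : ℝ :=
  ∑ H : Fin h.length → (Fin n → A) × (Fin n → E), ∑ b : Fin n → A,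
    if proj i (List.ofFn H) = h ∧ b i = a then
      playProb σ π [] (List.ofFn H) * ∏ j, π j (proj j (List.ofFn H)) (b j)
    else 0

/-- `ρ` is the subjective environment of player `i`, facing the other players' policies `π j`,
`j ≠ i`, in the game `σ`: whatever policy `π'` player `i` follows,
`ρ(e | h a) = σ_i^π(h a e) / σ_i^π(h a)` whenever the denominator is positive. -/
def IsSubjectiveEnv {n : ℕ} (σ : Game n A E) (π : Fin n → Policy A E) (i : Fin n)
    (ρ : Env A E) : Prop :=
  ∀ π' : Policy A E, IsPolicy π' → ∀ h a,
    0 < margHistAct σ (Function.update π i π') i h a →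
    ∀ e, ρ h a e = margHist σ (Function.update π i π') i (h ++ [(a, e)]) /
      margHistAct σ (Function.update π i π') i h a

/-- The Thompson sampling version of the strong grain of truth property, for the policy class
`P_refl^O`, the class of `O`-estimable games with any number of players, and a player with rewards
`r`, discount `γ`, schedule `ε` and prior `w` over `M_refl^O`. -/
structure StrongGrainOfTruthTS {O : Oracle (A ⊕ E)} (hO : IsReflective O) (r : E → ℝ)
    (γ ε : ℕ → ℝ) (w : MRefl hO → ℝ) : Prop where
  weight_pos : ∀ ρ, 0 < w ρ
  subjective_mem : ∀ (n : ℕ) (σ : Game n A E), IsGame σ → IsOEstimableGame O σ →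
    ∀ (i : Fin n) (π : Fin n → Policy A E), (∀ j, j ≠ i → π j ∈ PRefl O) →
      ∃ ρ ∈ MRefl hO, IsSubjectiveEnv σ π i ρ
  thompson_mem : ∃ π ∈ PRefl O, IsThompson hO r γ ε w π

end Agents

end ReflOracle

open ReflOracle

set_option linter.unusedSectionVars false

attribute [fun_prop] Computable
attribute [fun_prop] Computable.id Computable.const Computable.comp

namespace ReflOracle

/-! ### Computability -/

section Computability

variable {α β δ ι : Type*} [Primcodable α] [Primcodable β] [Primcodable δ]

/-! A query compares a completed probability with a rational, and a reflective oracle answers at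
random only in case of equality, where either answer is harmless. `Allowed hO` records which answers
agree with the completed probabilities, and `Approx (Allowed hO) f` says that `f` can be bracketed
to any accuracy from every long enough list of allowed answers. Answers of positive probability are
allowed, so such a computation never errs on a run of positive probability. Completed probabilities
(`approx_compl`) and bounded `O`-estimable functions (`approx_of_isOEstimable`) are of this kind.
Such functions are closed under arithmetic, recursion along finite trees (`Approx.treeRec`), limits
with an approximable error (`Approx.of_squeeze`) and infinite sums dominated by normalized weights
(`Approx.tsum`).

Conversely, `exists_sampler` turns nonnegative approximable weights of positive sum into a machine
that outputs each symbol with exactly its normalized weight. Coin flips select a shrinking dyadic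
interval, and the machine halts once oracle answers certify that the interval belongs to one symbol.
Where the weights sum to zero the machine need not halt, but its completion is still a distribution
that the oracle reveals. This makes optimal actions accessible although an arg max is discontinuous:
weighting two actions by the positive parts of their value difference gives a completion that is
deterministic if the values differ and arbitrary at a tie. `scan` combines these comparisons into
greedy policies, approximable uniformly in the machine `T` (`exists_greedy_policy`).

Within a block between resampling times, Thompson sampling is the Bayes mixture of these policies.
Its action weights form an infinite sum dominated by the prior weights `v T`, hence approximable,
hence sampled. Machines with the same environment may break ties differently. The optimal policy
attached to an environment is therefore itself a mixture of the greedy policies of all its machines,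
which is optimal because it still takes only maximizing actions (`isThompson_of_mixAct`). Sampling
the completion once more yields a machine that halts almost surely, so the policy lies in `PRefl O`
(`exists_thompson`).

For games, the probability of a player's history factors into the player's own action probabilities
and a sum over joint histories that does not involve them. The first factor cancels in the
conditional, and the second is approximable and can be sampled (`exists_subjectiveEnv`). For the
second claim of the theorem, the room between `ε t / 2` and `ε t` allows a rational threshold at
which every inequality defining the horizon is strict; strict inequalities have finite certificates,
which a search finds (`exists_computable_horizon`). -/

@[fun_prop] theorem computable_fst {f : α → β × δ} (hf : Computable f) :
    Computable fun x => (f x).1 := Computable.fst.comp hf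

@[fun_prop] theorem computable_snd {f : α → β × δ} (hf : Computable f) :
    Computable fun x => (f x).2 := Computable.snd.comp hf

@[fun_prop] theorem computable_pair {f : α → β} {g : α → δ} (hf : Computable f)
    (hg : Computable g) : Computable fun x => (f x, g x) := Computable.pair hf hg

@[fun_prop] theorem computable_add {f g : α → ℕ} (hf : Computable f) (hg : Computable g) :
    Computable fun x => f x + g x := Primrec.nat_add.to_comp.comp hf hg

@[fun_prop] theorem computable_sub {f g : α → ℕ} (hf : Computable f) (hg : Computable g) :
    Computable fun x => f x - g x := Primrec.nat_sub.to_comp.comp hf hg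

@[fun_prop] theorem computable_mul {f g : α → ℕ} (hf : Computable f) (hg : Computable g) :
    Computable fun x => f x * g x := Primrec.nat_mul.to_comp.comp hf hg

@[fun_prop] theorem computable_div {f g : α → ℕ} (hf : Computable f) (hg : Computable g) :
    Computable fun x => f x / g x := Primrec.nat_div.to_comp.comp hf hg

@[fun_prop] theorem computable_max {f g : α → ℕ} (hf : Computable f) (hg : Computable g) :
    Computable fun x => max (f x) (g x) := Primrec.nat_max.to_comp.comp hf hg

@[fun_prop] theorem computable_min {f g : α → ℕ} (hf : Computable f) (hg : Computable g) :
    Computable fun x => min (f x) (g x) := Primrec.nat_min.to_comp.comp hf hg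

@[fun_prop] theorem computable_pow {f g : α → ℕ} (hf : Computable f) (hg : Computable g) :
    Computable fun x => f x ^ g x :=
  (Primrec₂.unpaired'.1 Nat.Primrec.pow).to_comp.comp hf hg

@[fun_prop] theorem computable_ite {p : α → Prop} [∀ x, Decidable (p x)] {f g : α → β}
    (hp : Computable fun x => decide (p x)) (hf : Computable f) (hg : Computable g) :
    Computable fun x => if p x then f x else g x :=
  (Computable.cond hp hf hg).of_eq fun x => by by_cases h : p x <;> simp [h]

@[fun_prop] theorem computable_le {f g : α → ℕ} [∀ x, Decidable (f x ≤ g x)]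
    (hf : Computable f) (hg : Computable g) : Computable fun x => decide (f x ≤ g x) :=
  (Primrec.nat_le.decide.to_comp.comp hf hg).of_eq fun x => by simp

@[fun_prop] theorem computable_lt {f g : α → ℕ} [∀ x, Decidable (f x < g x)]
    (hf : Computable f) (hg : Computable g) : Computable fun x => decide (f x < g x) :=
  (Primrec.nat_lt.decide.to_comp.comp hf hg).of_eq fun x => by simp

@[fun_prop] theorem computable_eq {f g : α → β} [∀ x, Decidable (f x = g x)]
    (hf : Computable f) (hg : Computable g) : Computable fun x => decide (f x = g x) := by
  classical
  exact ((Primrec.eq (α := β)).decide.to_comp.comp hf hg).of_eq fun x => by simp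

@[fun_prop] theorem computable_and {p q : α → Prop} [∀ x, Decidable (p x)]
    [∀ x, Decidable (q x)] [∀ x, Decidable (p x ∧ q x)] (hp : Computable fun x => decide (p x))
    (hq : Computable fun x => decide (q x)) : Computable fun x => decide (p x ∧ q x) :=
  (Primrec.and.to_comp.comp hp hq).of_eq fun x => by simp

@[fun_prop] theorem computable_length {f : α → List β} (hf : Computable f) :
    Computable fun x => (f x).length := Computable.list_length.comp hf

@[fun_prop] theorem computable_append {f g : α → List β} (hf : Computable f)
    (hg : Computable g) : Computable fun x => f x ++ g x := Computable.list_append.comp hf hg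

@[fun_prop] theorem computable_cons {f : α → β} {g : α → List β} (hf : Computable f)
    (hg : Computable g) : Computable fun x => f x :: g x := Computable.list_cons.comp hf hg

@[fun_prop] theorem computable_tail {f : α → List β} (hf : Computable f) :
    Computable fun x => (f x).tail := Primrec.list_tail.to_comp.comp hf

@[fun_prop] theorem computable_head? {f : α → List β} (hf : Computable f) :
    Computable fun x => (f x).head? := Primrec.list_head?.to_comp.comp hf

@[fun_prop] theorem computable_getElem? {f : α → List β} {g : α → ℕ} (hf : Computable f)
    (hg : Computable g) : Computable fun x => (f x)[g x]? :=
  Computable.list_getElem?.comp hf hg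

@[fun_prop] theorem computable_getD {f : α → List ℕ} {g : α → ℕ} (hf : Computable f)
    (hg : Computable g) : Computable fun x => (f x).getD (g x) 0 :=
  (Primrec.list_getD 0).to_comp.comp hf hg

@[fun_prop] theorem computable_take {f : α → List β} {g : α → ℕ} (hf : Computable f)
    (hg : Computable g) : Computable fun x => (f x).take (g x) :=
  Primrec.list_take.to_comp.comp hg hf

@[fun_prop] theorem computable_drop {f : α → List β} {g : α → ℕ} (hf : Computable f)
    (hg : Computable g) : Computable fun x => (f x).drop (g x) :=
  Primrec.list_drop.to_comp.comp hg hf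

@[fun_prop] theorem computable_encode {f : α → β} (hf : Computable f) :
    Computable fun x => Encodable.encode (f x) := Computable.encode.comp hf

@[fun_prop] theorem computable_unpair {f : α → ℕ} (hf : Computable f) :
    Computable fun x => Nat.unpair (f x) := Computable.unpair.comp hf

@[fun_prop] theorem computable_curry {f : α → Nat.Partrec.Code} {g : α → ℕ} (hf : Computable f)
    (hg : Computable g) : Computable fun x => Nat.Partrec.Code.curry (f x) (g x) :=
  Nat.Partrec.Code.primrec₂_curry.to_comp.comp hf hg

theorem computable_of_finite [Finite α] (f : α → β) : Computable f := (Primrec.dom_finite f).to_comp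

@[fun_prop] theorem computable_finset_sum {f : ι → α → ℕ} {s : Finset ι}
    (hf : ∀ i, Computable (f i)) : Computable fun x => ∑ i ∈ s, f i x := by
  classical
  induction s using Finset.induction_on with
  | empty => simpa using Computable.const 0
  | insert i s hi ih => simp only [Finset.sum_insert hi]; fun_prop

@[fun_prop] theorem computable_fold_max {f : ι → α → ℕ} {s : Finset ι}
    (hf : ∀ i, Computable (f i)) : Computable fun x => s.fold max 0 fun i => f i x := by
  classical
  induction s using Finset.induction_on with
  | empty => simpa using Computable.const 0
  | insert i s hi ih => simp only [Finset.fold_insert hi]; fun_prop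

theorem computable_find? [Primcodable ι] {l : List ι} {p : α → ι → Bool}
    (hp : ∀ i, Computable fun x => p x i) : Computable fun x => l.find? (p x) := by
  induction l with
  | nil => simpa using Computable.const none
  | cons i l ih =>
    refine (Computable.cond (hp i) (Computable.const (some i)) ih).of_eq fun x => ?_
    cases h : p x i <;> simp [h]

@[fun_prop] theorem computable_nat_rec {f : α → ℕ} {g : α → β} {h : α → ℕ → β → β}
    (hf : Computable f) (hg : Computable g)
    (hh : Computable fun p : α × ℕ × β => h p.1 p.2.1 p.2.2) :
    Computable fun x => Nat.rec (motive := fun _ => β) (g x) (fun n y => h x n y) (f x) :=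
  Computable.nat_rec hf hg (h := fun x p => h x p.1 p.2) hh

/-- The maximum of `g 0, …, g (n - 1)`. -/
def maxBelow (g : ℕ → ℕ) (n : ℕ) : ℕ := Nat.rec 0 (fun i y => max y (g i)) n

theorem le_maxBelow {g : ℕ → ℕ} {n i : ℕ} (h : i < n) : g i ≤ maxBelow g n := by
  induction n with
  | zero => omega
  | succ n ih =>
    show g i ≤ max (maxBelow g n) (g n)
    rcases Nat.lt_succ_iff_lt_or_eq.1 h with h | rfl
    · exact (ih h).trans (le_max_left _ _)
    · exact le_max_right _ _

theorem maxBelow_le {g : ℕ → ℕ} {n : ℕ} {c : ℝ} (h0 : 0 ≤ c) (h : ∀ i < n, (g i : ℝ) ≤ c) :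
    (maxBelow g n : ℝ) ≤ c := by
  induction n with
  | zero => simpa [maxBelow] using h0
  | succ n ih =>
    show ((max (maxBelow g n) (g n) : ℕ) : ℝ) ≤ c
    rw [Nat.cast_max]
    exact max_le (ih fun i hi => h i (by omega)) (h n (by omega))

@[fun_prop] theorem computable_maxBelow {f : α → ℕ} {g : α → ℕ → ℕ} (hf : Computable f)
    (hg : Computable fun p : α × ℕ => g p.1 p.2) : Computable fun x => maxBelow (g x) (f x) := by
  unfold maxBelow
  exact computable_nat_rec (h := fun x i y => max y (g x i)) hf (Computable.const 0) (by fun_prop)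

/-- The minimum of `c, g 0, …, g (n - 1)`. -/
def minBelow (c : ℕ) (g : ℕ → ℕ) (n : ℕ) : ℕ := Nat.rec c (fun i y => min y (g i)) n

theorem minBelow_le {c : ℕ} {g : ℕ → ℕ} {n i : ℕ} (h : i < n) : minBelow c g n ≤ g i := by
  induction n with
  | zero => omega
  | succ n ih =>
    show min (minBelow c g n) (g n) ≤ g i
    rcases Nat.lt_succ_iff_lt_or_eq.1 h with h | rfl
    · exact (min_le_left _ _).trans (ih h)
    · exact min_le_right _ _

theorem le_minBelow {c : ℕ} {g : ℕ → ℕ} {n : ℕ} {y : ℝ} (h0 : y ≤ c)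
    (h : ∀ i < n, y ≤ (g i : ℝ)) : y ≤ (minBelow c g n : ℝ) := by
  induction n with
  | zero => simpa [minBelow] using h0
  | succ n ih =>
    show y ≤ ((min (minBelow c g n) (g n) : ℕ) : ℝ)
    rw [Nat.cast_min]
    exact le_min (ih fun i hi => h i (by omega)) (h n (by omega))

@[fun_prop] theorem computable_minBelow {c f : α → ℕ} {g : α → ℕ → ℕ} (hc : Computable c)
    (hf : Computable f) (hg : Computable fun p : α × ℕ => g p.1 p.2) :
    Computable fun x => minBelow (c x) (g x) (f x) := by
  unfold minBelow
  exact computable_nat_rec (h := fun x i y => min y (g x i)) hf hc (by fun_prop)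

/-- Evaluate a partial function at finitely many points. -/
def evalAll (φ : ι → Part ℕ) : List ι → Part (List ℕ)
  | [] => Part.some []
  | i :: l => (φ i).bind fun v => (evalAll φ l).map fun vs => v :: vs

theorem evalAll_some (φ : ι → ℕ) (l : List ι) :
    evalAll (fun i => Part.some (φ i)) l = Part.some (l.map φ) := by
  induction l with
  | nil => rfl
  | cons i l ih => simp [evalAll, ih]

theorem partrec_evalAll {φ : α → ι → Part ℕ} (hφ : ∀ i, Partrec fun x => φ x i) (l : List ι) :
    Partrec fun x => evalAll (φ x) l := by
  induction l with
  | nil => exact Computable.const []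
  | cons i l ih =>
    refine Partrec.bind (hφ i) (g := fun x v => (evalAll (φ x) l).map fun vs => v :: vs) ?_
    refine Partrec.map (f := fun p : α × ℕ => evalAll (φ p.1) l)
      (g := fun p vs => p.2 :: vs) (ih.comp Computable.fst) ?_
    show Computable fun p : (α × ℕ) × List ℕ => p.1.2 :: p.2
    fun_prop

/-- Recursion along a finitely branching tree is computable. -/
theorem computable_treeRec {F : ℕ → α → ℕ} {F₀ : α → ℕ} {child : α → ι → α}
    {G : α → List ℕ → ℕ} (l : List ι) (hF₀ : Computable F₀)
    (hchild : ∀ i, Computable fun x => child x i)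
    (hG : Computable fun p : α × List ℕ => G p.1 p.2) (h0 : ∀ x, F 0 x = F₀ x)
    (hs : ∀ n x, F (n + 1) x = G x (l.map fun i => F n (child x i))) :
    Computable fun p : ℕ × α => F p.1 p.2 := by
  -- The argument `x` changes from call to call, so this is not primitive recursion on `n`. Instead
  -- `f c` performs one level and delegates the recursive calls to the program `c`; the second
  -- recursion theorem supplies a `c` that computes its own `f c`.
  let f : Nat.Partrec.Code → ℕ →. ℕ := fun c k =>
    Part.bind (Part.ofOption (Encodable.decode (α := ℕ × α) k)) fun p =>
      Nat.casesOn (motive := fun _ => Part ℕ) p.1 (Part.some (F₀ p.2)) fun m =>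
        (evalAll (fun i => c.eval (Encodable.encode (m, child p.2 i))) l).map (G p.2)
  have hf : Partrec₂ f := by
    refine Partrec.bind (Computable.ofOption (Computable.decode.comp Computable.snd))
      (g := fun (q : Nat.Partrec.Code × ℕ) (p : ℕ × α) => Nat.casesOn (motive := fun _ => Part ℕ) p.1 (Part.some (F₀ p.2)) fun m =>
        (evalAll (fun i => q.1.eval (Encodable.encode (m, child p.2 i))) l).map (G p.2)) ?_
    refine Partrec.nat_casesOn_right (α := (Nat.Partrec.Code × ℕ) × (ℕ × α))
      (f := fun z => z.2.1) (g := fun z => F₀ z.2.2)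
      (h := fun z m => (evalAll (fun i =>
        z.1.1.eval (Encodable.encode (m, child z.2.2 i))) l).map (G z.2.2))
      (by fun_prop) (by fun_prop) ?_
    refine Partrec.map (f := fun z : ((Nat.Partrec.Code × ℕ) × (ℕ × α)) × ℕ =>
        evalAll (fun i => z.1.1.1.eval (Encodable.encode (z.2, child z.1.2.2 i))) l)
      (g := fun z vs => G z.1.2.2 vs) (partrec_evalAll (fun i => ?_) l) ?_
    · have h1 : Computable fun z : ((Nat.Partrec.Code × ℕ) × (ℕ × α)) × ℕ => z.1.1.1 := by fun_prop
      have hi := hchild i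
      have h2 : Computable fun z : ((Nat.Partrec.Code × ℕ) × (ℕ × α)) × ℕ =>
          Encodable.encode (z.2, child z.1.2.2 i) := by fun_prop
      exact Nat.Partrec.Code.eval_part.comp h1 h2
    · show Computable fun z : (((Nat.Partrec.Code × ℕ) × (ℕ × α)) × ℕ) × List ℕ => G z.1.1.2.2 z.2
      fun_prop
  obtain ⟨c, hc⟩ := Nat.Partrec.Code.fixed_point₂ hf
  have key : ∀ n x, c.eval (Encodable.encode (n, x)) = Part.some (F n x) := by
    intro n
    induction n with
    | zero =>
      intro x
      rw [hc]
      simp [f, h0]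
    | succ n ih =>
      intro x
      rw [hc]
      simp only [f, Encodable.encodek, Part.ofOption, Part.bind_some]
      simp only [ih, evalAll_some, hs, Part.map_some]
  have h3 : Partrec fun p : ℕ × α => c.eval (Encodable.encode p) :=
    Nat.Partrec.Code.eval_part.comp (Computable.const c) Computable.encode
  exact h3.of_eq_tot fun p => by rw [key]; exact Part.mem_some _

end Computability

/-! ### Real functions approximated from oracle answers -/

section Approximation

variable {α β κ ι : Type*} [Primcodable α] [Primcodable β]

/-- All answers in the list are allowed by `V`. -/
def Consistent (V : ℕ → Bool → Prop) (b : List Bool) : Prop := ∀ j a, b[j]? = some a → V j a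

/-- Longer and longer consistent lists of answers. -/
def ansFilter (V : ℕ → Bool → Prop) : Filter (List Bool) :=
  comap List.length atTop ⊓ 𝓟 {b | Consistent V b}

variable {V : ℕ → Bool → Prop}

theorem consistent_nil : Consistent V [] := fun j a h => by simp at h

theorem Consistent.concat {b : List Bool} (hb : Consistent V b) {a : Bool}
    (ha : V b.length a) : Consistent V (b ++ [a]) := by
  intro j a' h
  rcases lt_trichotomy j b.length with hj | rfl | hj
  · rw [List.getElem?_append_left hj] at h
    exact hb j a' h
  · simp at h
    exact h ▸ ha
  · rw [List.getElem?_eq_none (by simp; omega)] at h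
    simp at h

theorem eventually_ansFilter {P : List Bool → Prop} :
    (∀ᶠ b in ansFilter V, P b) ↔ ∃ n, ∀ b : List Bool, n ≤ b.length → Consistent V b → P b := by
  rw [ansFilter, eventually_inf_principal, eventually_comap, eventually_atTop]
  constructor
  · rintro ⟨n, h⟩
    exact ⟨n, fun b hb hc => h _ hb b rfl hc⟩
  · rintro ⟨n, h⟩
    refine ⟨n, fun m hm b hb hc => h b (hb ▸ hm) hc⟩

theorem eventually_consistent : ∀ᶠ b in ansFilter V, Consistent V b :=
  eventually_ansFilter.2 ⟨0, fun _ _ h => h⟩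

theorem eventually_length (n : ℕ) : ∀ᶠ b in ansFilter V, n ≤ b.length :=
  eventually_ansFilter.2 ⟨n, fun _ h _ => h⟩

theorem tendsto_length_ansFilter : Tendsto List.length (ansFilter V) atTop :=
  tendsto_atTop.2 eventually_length

theorem tendsto_const_div_two_pow (c : ℝ) :
    Tendsto (fun b : List Bool => c / 2 ^ b.length) (ansFilter V) (𝓝 0) := by
  have h : Tendsto (fun n : ℕ => c * (1 / 2 : ℝ) ^ n) atTop (𝓝 (c * 0)) :=
    (tendsto_pow_atTop_nhds_zero_of_lt_one (by norm_num) (by norm_num)).const_mul c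
  rw [mul_zero] at h
  refine (h.comp (tendsto_length_ansFilter (V := V))).congr fun b => ?_
  simp [div_eq_mul_inv]

/-- `lo` and `hi` bracket `y` at the scale given by the number of answers, and converge to `y`. -/
structure Brackets (V : ℕ → Bool → Prop) (y : ℝ) (lo hi : List Bool → ℕ) : Prop where
  lower : ∀ b, Consistent V b → (lo b : ℝ) ≤ y * 2 ^ b.length
  upper : ∀ b, Consistent V b → y * 2 ^ b.length ≤ hi b
  tendsto_lower : Tendsto (fun b => (lo b : ℝ) / 2 ^ b.length) (ansFilter V) (𝓝 y)
  tendsto_upper : Tendsto (fun b => (hi b : ℝ) / 2 ^ b.length) (ansFilter V) (𝓝 y)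

/-- `f` can be computed to any accuracy from consistent oracle answers. -/
def Approx (V : ℕ → Bool → Prop) (f : α → ℝ) : Prop :=
  ∃ lo hi : α × List Bool → ℕ, Computable lo ∧ Computable hi ∧
    ∀ x, Brackets V (f x) (fun b => lo (x, b)) (fun b => hi (x, b))

namespace Brackets

variable {y z : ℝ} {lo hi lo' hi' : List Bool → ℕ}

theorem nonneg (h : Brackets V y lo hi) : 0 ≤ y := by
  have := h.lower [] consistent_nil
  simp at this
  exact le_trans (Nat.cast_nonneg _) this

theorem of_eps (h1 : ∀ b, Consistent V b → (lo b : ℝ) ≤ y * 2 ^ b.length)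
    (h2 : ∀ b, Consistent V b → y * 2 ^ b.length ≤ hi b)
    (h3 : ∀ ε > 0, ∀ᶠ b in ansFilter V,
      (y - ε) * 2 ^ b.length ≤ lo b ∧ (hi b : ℝ) ≤ (y + ε) * 2 ^ b.length) :
    Brackets V y lo hi := by
  refine ⟨h1, h2, ?_, ?_⟩
  · rw [Metric.tendsto_nhds]
    intro ε hε
    filter_upwards [h3 (ε / 2) (by positivity), eventually_consistent] with b hb hc
    have hp : (0 : ℝ) < 2 ^ b.length := by positivity
    have e1 : (lo b : ℝ) / 2 ^ b.length ≤ y := (div_le_iff₀ hp).2 (h1 b hc)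
    have e2 : y - ε / 2 ≤ (lo b : ℝ) / 2 ^ b.length := (le_div_iff₀ hp).2 hb.1
    rw [Real.dist_eq, abs_lt]
    constructor <;> linarith
  · rw [Metric.tendsto_nhds]
    intro ε hε
    filter_upwards [h3 (ε / 2) (by positivity), eventually_consistent] with b hb hc
    have hp : (0 : ℝ) < 2 ^ b.length := by positivity
    have e1 : y ≤ (hi b : ℝ) / 2 ^ b.length := (le_div_iff₀ hp).2 (h2 b hc)
    have e2 : (hi b : ℝ) / 2 ^ b.length ≤ y + ε / 2 := (div_le_iff₀ hp).2 hb.2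
    rw [Real.dist_eq, abs_lt]
    constructor <;> linarith

theorem eventually_eps (h : Brackets V y lo hi) {ε : ℝ} (hε : 0 < ε) :
    ∀ᶠ b in ansFilter V, (y - ε) * 2 ^ b.length ≤ lo b ∧ (hi b : ℝ) ≤ (y + ε) * 2 ^ b.length := by
  filter_upwards [(tendsto_order.1 h.tendsto_lower).1 (y - ε) (by linarith),
    (tendsto_order.1 h.tendsto_upper).2 (y + ε) (by linarith)] with b h1 h2
  have hp : (0 : ℝ) < 2 ^ b.length := by positivity
  exact ⟨((lt_div_iff₀ hp).1 h1).le, ((div_lt_iff₀ hp).1 h2).le⟩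

/-- Bounds are scaled by `2 ^ b.length`, so a bounded absolute error becomes `C / 2 ^ b.length` and
disappears in the limit. -/
theorem of_const (C : ℝ) (h1 : ∀ b, Consistent V b → (lo b : ℝ) ≤ y * 2 ^ b.length)
    (h2 : ∀ b, Consistent V b → y * 2 ^ b.length ≤ hi b)
    (h3 : ∀ b, Consistent V b → y * 2 ^ b.length - C ≤ lo b ∧ (hi b : ℝ) ≤ y * 2 ^ b.length + C) :
    Brackets V y lo hi := by
  refine of_eps h1 h2 fun ε hε => ?_
  filter_upwards [(tendsto_order.1 (tendsto_const_div_two_pow (V := V) C)).2 ε hε,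
    eventually_consistent] with b hb hc
  have hp : (0 : ℝ) < 2 ^ b.length := by positivity
  have := (div_lt_iff₀ hp).1 hb
  constructor <;> linarith [h3 b hc]

theorem natCast (k : ℕ) :
    Brackets V k (fun b => k * 2 ^ b.length) (fun b => k * 2 ^ b.length) :=
  of_const 0 (fun b _ => by simp) (fun b _ => by simp) (fun b _ => by simp)

theorem add (h : Brackets V y lo hi) (h' : Brackets V z lo' hi') :
    Brackets V (y + z) (fun b => lo b + lo' b) (fun b => hi b + hi' b) where
  lower b hb := by push_cast; linarith [h.lower b hb, h'.lower b hb]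
  upper b hb := by push_cast; linarith [h.upper b hb, h'.upper b hb]
  tendsto_lower := (h.tendsto_lower.add h'.tendsto_lower).congr fun b => by push_cast; ring
  tendsto_upper := (h.tendsto_upper.add h'.tendsto_upper).congr fun b => by push_cast; ring

theorem sum {s : Finset ι} {f : ι → ℝ} {l u : ι → List Bool → ℕ}
    (h : ∀ i, Brackets V (f i) (l i) (u i)) :
    Brackets V (∑ i ∈ s, f i) (fun b => ∑ i ∈ s, l i b) (fun b => ∑ i ∈ s, u i b) := by
  classical
  induction s using Finset.induction_on with
  | empty => simpa using natCast (V := V) 0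
  | insert i s hi ih => simpa only [Finset.sum_insert hi] using (h i).add ih

theorem max (h : Brackets V y lo hi) (h' : Brackets V z lo' hi') :
    Brackets V (max y z) (fun b => max (lo b) (lo' b)) (fun b => max (hi b) (hi' b)) where
  lower b hb := by
    rw [Nat.cast_max, max_mul_of_nonneg _ _ (by positivity)]
    exact max_le_max (h.lower b hb) (h'.lower b hb)
  upper b hb := by
    rw [Nat.cast_max, max_mul_of_nonneg _ _ (by positivity)]
    exact max_le_max (h.upper b hb) (h'.upper b hb)
  tendsto_lower := (h.tendsto_lower.max h'.tendsto_lower).congr fun b => by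
    rw [Nat.cast_max, max_div_div_right (by positivity)]
  tendsto_upper := (h.tendsto_upper.max h'.tendsto_upper).congr fun b => by
    rw [Nat.cast_max, max_div_div_right (by positivity)]

theorem foldMax {s : Finset ι} {f : ι → ℝ} {l u : ι → List Bool → ℕ}
    (h : ∀ i, Brackets V (f i) (l i) (u i)) :
    Brackets V (s.fold Max.max 0 f) (fun b => s.fold Max.max 0 fun i => l i b)
      (fun b => s.fold Max.max 0 fun i => u i b) := by
  classical
  induction s using Finset.induction_on with
  | empty => simpa using natCast (V := V) 0
  | insert i s hi ih => simpa only [Finset.fold_insert hi] using (h i).max ih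

/-- Subtraction of natural numbers stops at zero, which is why the positive part of the difference
appears. The bounds of the subtrahend change roles. -/
theorem tsub (h : Brackets V y lo hi) (h' : Brackets V z lo' hi') :
    Brackets V (Max.max (y - z) 0) (fun b => lo b - hi' b) (fun b => hi b - lo' b) := by
  have cast_tsub : ∀ a b : ℕ, ((a - b : ℕ) : ℝ) = Max.max ((a : ℝ) - b) 0 := fun a b => by
    rcases le_total b a with hab | hab
    · have : (b : ℝ) ≤ a := by exact_mod_cast hab
      rw [Nat.cast_sub hab, max_eq_left (by linarith)]
    · have : (a : ℝ) ≤ b := by exact_mod_cast hab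
      rw [Nat.sub_eq_zero_of_le hab, max_eq_right (by linarith)]
      simp
  have hdiv : ∀ (a b : ℕ) (n : ℕ), ((a - b : ℕ) : ℝ) / 2 ^ n =
      Max.max ((a : ℝ) / 2 ^ n - b / 2 ^ n) 0 := fun a b n => by
    have h0 : (0 : ℝ) = 0 / 2 ^ n := by simp
    rw [cast_tsub, ← sub_div]
    conv_rhs => rw [h0]
    rw [max_div_div_right (by positivity)]
  refine ⟨fun b hb => ?_, fun b hb => ?_, ?_, ?_⟩
  · rw [cast_tsub, max_mul_of_nonneg _ _ (by positivity), zero_mul]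
    exact max_le_max (by linarith [h.lower b hb, h'.upper b hb]) le_rfl
  · rw [cast_tsub, max_mul_of_nonneg _ _ (by positivity), zero_mul]
    exact max_le_max (by linarith [h.upper b hb, h'.lower b hb]) le_rfl
  · exact ((h.tendsto_lower.sub h'.tendsto_upper).max tendsto_const_nhds).congr fun b =>
      (hdiv _ _ _).symm
  · exact ((h.tendsto_upper.sub h'.tendsto_lower).max tendsto_const_nhds).congr fun b =>
      (hdiv _ _ _).symm

theorem natDiv_bounds (p m : ℕ) (hm : 0 < m) :
    ((p / m : ℕ) : ℝ) ≤ (p : ℝ) / m ∧ (p : ℝ) / m ≤ ((p / m : ℕ) : ℝ) + 1 := by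
  refine ⟨Nat.cast_div_le, ?_⟩
  have h := Nat.lt_succ_iff.1 (Nat.lt_succ_of_lt (Nat.lt_mul_div_succ p hm))
  have hm' : (0 : ℝ) < m := by exact_mod_cast hm
  rw [div_le_iff₀ hm']
  have : (p : ℝ) ≤ ((m * (p / m + 1) : ℕ) : ℝ) := by exact_mod_cast h
  push_cast at this
  linarith

theorem tendsto_mul_div {p q : List Bool → ℕ} (c : ℕ)
    (hp : Tendsto (fun b => (p b : ℝ) / 2 ^ b.length) (ansFilter V) (𝓝 y))
    (hq : Tendsto (fun b => (q b : ℝ) / 2 ^ b.length) (ansFilter V) (𝓝 z)) :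
    Tendsto (fun b => ((p b * q b / 2 ^ b.length + c : ℕ) : ℝ) / 2 ^ b.length)
      (ansFilter V) (𝓝 (y * z)) := by
  have h1 := hp.mul hq
  have h2 := (h1.sub (tendsto_const_div_two_pow (V := V) 1)).add (tendsto_const_div_two_pow (V := V) c)
  have h3 := h1.add (tendsto_const_div_two_pow (V := V) c)
  simp only [sub_zero, add_zero] at h2 h3
  have key : ∀ b : List Bool, (p b : ℝ) / 2 ^ b.length * (q b / 2 ^ b.length) =
      ((p b * q b : ℕ) : ℝ) / ((2 ^ b.length : ℕ) : ℝ) / 2 ^ b.length := fun b => by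
    push_cast
    field_simp
  refine tendsto_of_tendsto_of_tendsto_of_le_of_le h2 h3 (fun b => ?_) (fun b => ?_)
  · have h := (natDiv_bounds (p b * q b) (2 ^ b.length) (by positivity)).2
    show (p b : ℝ) / 2 ^ b.length * (q b / 2 ^ b.length) - 1 / 2 ^ b.length + c / 2 ^ b.length ≤ _
    rw [key, ← sub_div, ← add_div]
    push_cast at h ⊢
    gcongr
    linarith
  · have h := (natDiv_bounds (p b * q b) (2 ^ b.length) (by positivity)).1
    show _ ≤ (p b : ℝ) / 2 ^ b.length * (q b / 2 ^ b.length) + c / 2 ^ b.length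
    rw [key, ← add_div]
    push_cast at h ⊢
    gcongr

theorem mul (h : Brackets V y lo hi) (h' : Brackets V z lo' hi') :
    Brackets V (y * z) (fun b => lo b * lo' b / 2 ^ b.length + 0)
      (fun b => hi b * hi' b / 2 ^ b.length + 1) := by
  -- Dividing by `2 ^ b.length` restores the scale of a product. Integer division rounds down, which
  -- is safe for the lower bound; the upper bound needs the added `1`.
  refine ⟨fun b hb => ?_, fun b hb => ?_, tendsto_mul_div 0 h.tendsto_lower h'.tendsto_lower,
    tendsto_mul_div 1 h.tendsto_upper h'.tendsto_upper⟩
  · have h1 := (natDiv_bounds (lo b * lo' b) (2 ^ b.length) (by positivity)).1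
    refine le_trans (by simpa using h1) ?_
    rw [div_le_iff₀ (by positivity)]
    calc (lo b : ℝ) * lo' b ≤ (y * 2 ^ b.length) * (z * 2 ^ b.length) :=
          mul_le_mul (h.lower b hb) (h'.lower b hb) (by positivity)
            (mul_nonneg h.nonneg (by positivity))
      _ = _ := by ring
  · have h1 := (natDiv_bounds (hi b * hi' b) (2 ^ b.length) (by positivity)).2
    refine le_trans ?_ (h1.trans (by simp))
    push_cast
    rw [le_div_iff₀ (by positivity)]
    calc y * z * 2 ^ b.length * 2 ^ b.length = (y * 2 ^ b.length) * (z * 2 ^ b.length) := by ring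
      _ ≤ (hi b : ℝ) * hi' b :=
          mul_le_mul (h.upper b hb) (h'.upper b hb) (mul_nonneg h'.nonneg (by positivity))
            (by positivity)

end Brackets

namespace Approx

variable {f g : α → ℝ}

theorem nonneg (hf : Approx V f) (x : α) : 0 ≤ f x := by
  obtain ⟨lo, hi, -, -, h⟩ := hf
  exact (h x).nonneg

theorem comp {f : β → ℝ} (hf : Approx V f) {k : α → β} (hk : Computable k) :
    Approx V fun x => f (k x) := by
  obtain ⟨lo, hi, hlo, hhi, h⟩ := hf
  exact ⟨fun p => lo (k p.1, p.2), fun p => hi (k p.1, p.2), by fun_prop, by fun_prop,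
    fun x => h (k x)⟩

theorem natCast {k : α → ℕ} (hk : Computable k) : Approx V fun x => (k x : ℝ) :=
  ⟨fun p => k p.1 * 2 ^ p.2.length, fun p => k p.1 * 2 ^ p.2.length, by fun_prop, by fun_prop,
    fun x => Brackets.natCast (k x)⟩

theorem zero : Approx V fun _ : α => (0 : ℝ) := by
  simpa using natCast (V := V) (Computable.const (α := α) 0)

theorem one : Approx V fun _ : α => (1 : ℝ) := by
  simpa using natCast (V := V) (Computable.const (α := α) 1)

theorem add (hf : Approx V f) (hg : Approx V g) : Approx V fun x => f x + g x := by
  obtain ⟨lo, hi, hlo, hhi, h⟩ := hf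
  obtain ⟨lo', hi', hlo', hhi', h'⟩ := hg
  exact ⟨fun p => lo p + lo' p, fun p => hi p + hi' p, by fun_prop, by fun_prop,
    fun x => (h x).add (h' x)⟩

theorem mul (hf : Approx V f) (hg : Approx V g) : Approx V fun x => f x * g x := by
  obtain ⟨lo, hi, hlo, hhi, h⟩ := hf
  obtain ⟨lo', hi', hlo', hhi', h'⟩ := hg
  exact ⟨fun p => lo p * lo' p / 2 ^ p.2.length + 0, fun p => hi p * hi' p / 2 ^ p.2.length + 1,
    by fun_prop, by fun_prop, fun x => (h x).mul (h' x)⟩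

theorem tsub (hf : Approx V f) (hg : Approx V g) : Approx V fun x => max (f x - g x) 0 := by
  obtain ⟨lo, hi, hlo, hhi, h⟩ := hf
  obtain ⟨lo', hi', hlo', hhi', h'⟩ := hg
  exact ⟨fun p => lo p - hi' p, fun p => hi p - lo' p, by fun_prop, by fun_prop,
    fun x => (h x).tsub (h' x)⟩

theorem sub (hf : Approx V f) (hg : Approx V g) (hfg : ∀ x, g x ≤ f x) :
    Approx V fun x => f x - g x := by
  have h := hf.tsub hg
  have e : (fun x => max (f x - g x) 0) = fun x => f x - g x := by
    funext x
    exact max_eq_left (by linarith [hfg x])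
  rwa [e] at h

theorem ite {p : α → Prop} [∀ x, Decidable (p x)] (hp : Computable fun x => decide (p x))
    (hf : Approx V f) (hg : Approx V g) : Approx V fun x => if p x then f x else g x := by
  obtain ⟨lo, hi, hlo, hhi, h⟩ := hf
  obtain ⟨lo', hi', hlo', hhi', h'⟩ := hg
  have hp' : Computable fun q : α × List Bool => decide (p q.1) := hp.comp Computable.fst
  refine ⟨fun q => if p q.1 then lo q else lo' q, fun q => if p q.1 then hi q else hi' q,
    computable_ite hp' hlo hlo', computable_ite hp' hhi hhi', fun x => ?_⟩
  by_cases hx : p x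
  · simpa only [hx, if_true] using h x
  · simpa only [hx, if_false] using h' x

theorem sum {f : ι → α → ℝ} {s : Finset ι} (hf : ∀ i, Approx V (f i)) :
    Approx V fun x => ∑ i ∈ s, f i x := by
  classical
  induction s using Finset.induction_on with
  | empty => simpa using zero
  | insert i s hi ih => simpa only [Finset.sum_insert hi] using (hf i).add ih

theorem prod {f : ι → α → ℝ} {s : Finset ι} (hf : ∀ i ∈ s, Approx V (f i)) :
    Approx V fun x => ∏ i ∈ s, f i x := by
  classical
  induction s using Finset.induction_on with
  | empty => simpa using one
  | insert i s hi ih =>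
    simpa only [Finset.prod_insert hi] using (hf i (by simp)).mul (ih fun j hj => hf j (by simp [hj]))

theorem of_isEstimable (hf : IsEstimable f) (h0 : ∀ x, 0 ≤ f x) : Approx V f := by
  obtain ⟨φ, hφ, h⟩ := hf
  -- No answer is consulted; the list of answers only sets the accuracy through its length.
  let c : α × List Bool → ℕ × ℕ × ℕ := fun p => φ (p.1, 2 ^ p.2.length)
  have hc : Computable c := by fun_prop
  let d : α × List Bool → ℕ := fun p =>
    2 ^ p.2.length * ((c p).1 - (c p).2.1) / ((c p).2.2 + 1)
  have hd : Computable d := by fun_prop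
  have key : ∀ x b, f x * 2 ^ b.length - 2 ≤ d (x, b) ∧
      (d (x, b) : ℝ) ≤ f x * 2 ^ b.length + 1 := by
    intro x b
    have hp : (0 : ℝ) < 2 ^ b.length := by positivity
    have e := h x (2 ^ b.length) (by positivity)
    rw [abs_lt] at e
    have e1 : (ratOf (c (x, b)) : ℝ) =
        (((c (x, b)).1 : ℝ) - (c (x, b)).2.1) / ((c (x, b)).2.2 + 1) := by
      simp [ratOf]
    change _ < f x - (ratOf (c (x, b)) : ℝ) ∧ f x - (ratOf (c (x, b)) : ℝ) < _ at e
    push_cast at e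
    rw [e1] at e
    have e2 := Brackets.natDiv_bounds (2 ^ b.length * ((c (x, b)).1 - (c (x, b)).2.1))
      ((c (x, b)).2.2 + 1) (by positivity)
    set a₁ := (c (x, b)).1
    set a₂ := (c (x, b)).2.1
    set a₃ := (c (x, b)).2.2
    have hd : d (x, b) = 2 ^ b.length * (a₁ - a₂) / (a₃ + 1) := rfl
    rw [← hd] at e2
    have ha : (0 : ℝ) < (a₃ : ℝ) + 1 := by positivity
    set q : ℝ := ((a₁ : ℝ) - a₂) / (a₃ + 1) with hq
    have e3 : (f x - q) * 2 ^ b.length < 1 := by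
      have := mul_lt_mul_of_pos_right e.2 hp
      rwa [one_div_mul_cancel hp.ne'] at this
    have e4 : -1 < (f x - q) * 2 ^ b.length := by
      have := mul_lt_mul_of_pos_right e.1 hp
      rwa [neg_mul, one_div_mul_cancel hp.ne'] at this
    rcases le_total a₂ a₁ with hle | hle
    · push_cast [Nat.cast_sub hle] at e2
      have e5 : (2 : ℝ) ^ b.length * (a₁ - a₂) / (a₃ + 1) = q * 2 ^ b.length := by
        rw [hq]; ring
      rw [e5] at e2
      constructor <;> linarith
    · have hq0 : q ≤ 0 := div_nonpos_of_nonpos_of_nonneg (by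
        have : (a₁ : ℝ) ≤ a₂ := by exact_mod_cast hle
        linarith) ha.le
      have : d (x, b) = 0 := by rw [hd, Nat.sub_eq_zero_of_le hle]; simp
      rw [this]
      have := mul_nonneg (h0 x) hp.le
      have := mul_nonneg (neg_nonneg.2 hq0) hp.le
      constructor <;> push_cast <;> nlinarith
  -- The offsets absorb the bounds in `key`: `d` exceeds the scaled value by at most `1` and falls
  -- short of it by at most `2`. If `d` is zero the truncated `d - 1` is still a lower bound because
  -- `f` is nonnegative.
  refine ⟨fun p => d p - 1, fun p => d p + 2, by fun_prop, by fun_prop, fun x => ?_⟩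
  refine Brackets.of_const 3 (fun b _ => ?_) (fun b _ => ?_) (fun b _ => ⟨?_, ?_⟩)
  · have := key x b
    rcases Nat.eq_zero_or_pos (d (x, b)) with h' | h'
    · simp only [h']
      have := mul_nonneg (h0 x) (show (0 : ℝ) ≤ 2 ^ b.length by positivity)
      simpa using this
    · push_cast [Nat.cast_sub h']
      linarith
  · push_cast; linarith [key x b]
  · have : (d (x, b) : ℝ) - 1 ≤ ((d (x, b) - 1 : ℕ) : ℝ) := by
      rw [sub_le_iff_le_add]
      exact_mod_cast (by omega : d (x, b) ≤ d (x, b) - 1 + 1)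
    linarith [key x b]
  · push_cast; linarith [key x b]

/-- With `n` answers, take the best of the bounds coming from the first `n` approximants. Every one
of them is valid, and any fixed approximant is eventually among them, so no rate of convergence for
`t` is needed. -/
theorem of_squeeze {f t : ℕ → α → ℝ} (hf : Approx V fun p : ℕ × α => f p.1 p.2)
    (ht : Approx V fun p : ℕ × α => t p.1 p.2) (h1 : ∀ n x, f n x ≤ g x)
    (h2 : ∀ n x, g x ≤ f n x + t n x) (h3 : ∀ x, Tendsto (fun n => t n x) atTop (𝓝 0)) :
    Approx V g := by
  have ⟨lo, _, hlo, _, hB⟩ := hf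
  have ⟨_, hi, _, hhi, hB'⟩ := hf.add ht
  refine ⟨fun p => maxBelow (fun m => lo ((m, p.1), p.2)) p.2.length,
    fun p => minBelow (hi ((0, p.1), p.2)) (fun m => hi ((m, p.1), p.2)) p.2.length,
    by fun_prop, by fun_prop, fun x => ?_⟩
  have h0 : 0 ≤ g x := (hf.nonneg (0, x)).trans (h1 0 x)
  refine Brackets.of_eps (fun b hb => ?_) (fun b hb => ?_) (fun ε hε => ?_)
  · refine maxBelow_le (by positivity) fun i _ => ((hB (i, x)).lower b hb).trans ?_
    gcongr
    exact h1 i x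
  · refine le_minBelow ?_ fun i _ => le_trans ?_ ((hB' (i, x)).upper b hb)
    · refine le_trans ?_ ((hB' (0, x)).upper b hb)
      gcongr
      exact h2 0 x
    · gcongr
      exact h2 i x
  · obtain ⟨m, hm⟩ := ((tendsto_order.1 (h3 x)).2 (ε / 2) (by positivity)).exists
    filter_upwards [(hB (m, x)).eventually_eps (half_pos hε),
      (hB' (m, x)).eventually_eps (half_pos hε), eventually_length (m + 1)] with b e1 e2 e3
    have hp : (0 : ℝ) < 2 ^ b.length := by positivity
    constructor
    · have : (lo ((m, x), b) : ℝ) ≤ (maxBelow (fun m => lo ((m, x), b)) b.length : ℕ) := by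
        exact_mod_cast le_maxBelow (g := fun m => lo ((m, x), b)) (by omega : m < b.length)
      exact (mul_le_mul_of_nonneg_right (by linarith [h2 m x]) hp.le).trans (e1.1.trans this)
    · have : ((minBelow (hi ((0, x), b)) (fun m => hi ((m, x), b)) b.length : ℕ) : ℝ) ≤
          hi ((m, x), b) := by
        exact_mod_cast minBelow_le (g := fun m => hi ((m, x), b)) (by omega : m < b.length)
      exact (this.trans e2.2).trans (mul_le_mul_of_nonneg_right (by linarith [h1 m x]) hp.le)

theorem getD_map_idxOf [BEq ι] [LawfulBEq ι] (φ : ι → ℕ) {l : List ι} {i : ι} (hi : i ∈ l) :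
    (l.map φ).getD (l.idxOf i) 0 = φ i := by
  have h := List.idxOf_lt_length_iff.2 hi
  rw [List.getD_eq_getElem _ _ (by simpa using h)]
  simp

/-- Approximations can be computed by recursion along a finitely branching tree. -/
theorem treeRec [Fintype κ] [Fintype ι] {f : ℕ → α → ℝ} {f₀ : α → ℝ} {u w : κ → ι → α → ℝ}
    {child : κ → ι → α → α} (h₀ : Approx V f₀) (hu : ∀ a e, Approx V (u a e))
    (hw : ∀ a e, Approx V (w a e)) (hchild : ∀ a e, Computable (child a e))
    (hf0 : ∀ x, f 0 x = f₀ x) (hfs : ∀ n x, f (n + 1) x = Finset.univ.fold max 0 fun a =>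
      ∑ e, (u a e x + w a e x * f n (child a e x))) :
    Approx V fun p : ℕ × α => f p.1 p.2 := by
  classical
  obtain ⟨lo, hi, hlo, hhi, hB⟩ := h₀
  choose ulo uhi hulo huhi huB using hu
  choose wlo whi hwlo hwhi hwB using hw
  -- One recursion serves both bounds: `c` is the rounding correction of each product, `0` below and
  -- `1` above.
  let F (c : ℕ) (F₀ : α × List Bool → ℕ) (U W : κ → ι → α × List Bool → ℕ) (n : ℕ) :
      α × List Bool → ℕ :=
    Nat.rec F₀ (fun _ Y p => Finset.univ.fold max 0 fun a =>
      ∑ e, (U a e p + (W a e p * Y (child a e p.1, p.2) / 2 ^ p.2.length + c))) n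
  have hF : ∀ (c : ℕ) (F₀ : α × List Bool → ℕ) (U W : κ → ι → α × List Bool → ℕ),
      Computable F₀ → (∀ a e, Computable (U a e)) → (∀ a e, Computable (W a e)) →
      Computable fun p : ℕ × (α × List Bool) => F c F₀ U W p.1 p.2 := by
    intro c F₀ U W h1 h2 h3
    let l := (Finset.univ : Finset (κ × ι)).toList
    refine computable_treeRec (F₀ := F₀) (child := fun p i => (child i.1 i.2 p.1, p.2))
      (G := fun p vs => Finset.univ.fold max 0 fun a => ∑ e, (U a e p +
        (W a e p * vs.getD (l.idxOf (a, e)) 0 / 2 ^ p.2.length + c))) l h1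
        (fun i => by have := hchild i.1 i.2; fun_prop) (by fun_prop) (fun x => rfl) ?_
    intro n p
    show Finset.univ.fold max 0 (fun a => ∑ e, (U a e p +
      (W a e p * F c F₀ U W n (child a e p.1, p.2) / 2 ^ p.2.length + c))) = _
    congr 1
    funext a
    refine Finset.sum_congr rfl fun e _ => ?_
    rw [getD_map_idxOf _ (by simp [l])]
  refine ⟨fun p => F 0 lo ulo wlo p.1.1 (p.1.2, p.2), fun p => F 1 hi uhi whi p.1.1 (p.1.2, p.2),
    ?_, ?_, ?_⟩
  · have := hF 0 lo ulo wlo hlo hulo hwlo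
    exact this.comp (g := fun p : (ℕ × α) × List Bool => (p.1.1, (p.1.2, p.2))) (by fun_prop)
  · have := hF 1 hi uhi whi hhi huhi hwhi
    exact this.comp (g := fun p : (ℕ × α) × List Bool => (p.1.1, (p.1.2, p.2))) (by fun_prop)
  · rintro ⟨n, x⟩
    induction n generalizing x with
    | zero =>
      simp only [hf0]
      exact hB x
    | succ n ih =>
      simp only [hfs]
      exact Brackets.foldMax fun a => Brackets.sum fun e =>
        (huB a e x).add ((hwB a e x).mul (ih (child a e x)))

theorem sum_range {f : ℕ → α → ℝ} (hf : Approx V fun p : ℕ × α => f p.1 p.2) :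
    Approx V fun p : ℕ × α => ∑ i ∈ Finset.range p.1, f i p.2 := by
  -- A partial sum is a tree with a single branch; the state carries the index of the next summand.
  have h := treeRec (V := V) (κ := Unit) (ι := Unit) (α := ℕ × α)
    (f := fun n p => ∑ i ∈ Finset.range n, f (p.1 + i) p.2) (f₀ := fun _ => 0)
    (u := fun _ _ p => f p.1 p.2) (w := fun _ _ _ => 1) (child := fun _ _ p => (p.1 + 1, p.2))
    zero (fun _ _ => hf) (fun _ _ => one) (fun _ _ => by fun_prop) (fun x => by simp)
    (fun n p => by
      have : 0 ≤ f p.1 p.2 + ∑ i ∈ Finset.range n, f (p.1 + 1 + i) p.2 :=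
        add_nonneg (hf.nonneg p) (Finset.sum_nonneg fun i _ => hf.nonneg (_, p.2))
      simp only [Finset.univ_unique, Finset.fold_singleton, Finset.sum_singleton, one_mul,
        max_eq_left this]
      rw [Finset.sum_range_succ', add_comm]
      simp only [add_zero]
      congr 1
      exact Finset.sum_congr rfl fun i _ => by rw [add_assoc, add_comm 1 i])
  simpa using h.comp (k := fun p : ℕ × α => (p.1, (0, p.2))) (by fun_prop)

/-- Queries that compare `f x` with the rationals `u / (v + 1)`, up to an error `1 / (v + 1)`,
determine `f`. -/
theorem of_threshold (hf : ∀ x, 0 ≤ f x ∧ f x ≤ 1) {q : α × ℕ × ℕ → ℕ} (hq : Computable q)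
    (h1 : ∀ x u v, V (q (x, u, v)) true → (u : ℝ) ≤ f x * (v + 1) + 1)
    (h0 : ∀ x u v, V (q (x, u, v)) false → f x * (v + 1) ≤ u + 1) : Approx V f := by
  -- The index `k` codes a pair `(u, v)`. A `true` answer gives the lower bound `(u - 1) / (v + 1)`
  -- and a `false` answer the upper bound `(u + 1) / (v + 1)`; otherwise the trivial bounds `0` and
  -- `1` are used.
  let L : α × List Bool → ℕ → ℕ := fun p k =>
    if p.2[q (p.1, Nat.unpair k)]? = some true then
      2 ^ p.2.length * ((Nat.unpair k).1 - 1) / ((Nat.unpair k).2 + 1) else 0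
  let H : α × List Bool → ℕ → ℕ := fun p k =>
    if p.2[q (p.1, Nat.unpair k)]? = some false then
      2 ^ p.2.length * ((Nat.unpair k).1 + 1) / ((Nat.unpair k).2 + 1) + 1 else 2 ^ p.2.length
  have hq' : Computable fun p : (α × List Bool) × ℕ => p.1.2[q (p.1.1, Nat.unpair p.2)]? := by
    fun_prop
  have hL : Computable fun p : (α × List Bool) × ℕ => L p.1 p.2 :=
    computable_ite (computable_eq hq' (Computable.const _)) (by fun_prop) (by fun_prop)
  have hH : Computable fun p : (α × List Bool) × ℕ => H p.1 p.2 :=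
    computable_ite (computable_eq hq' (Computable.const _)) (by fun_prop) (by fun_prop)
  refine ⟨fun p => maxBelow (L p) p.2.length, fun p => minBelow (2 ^ p.2.length) (H p) p.2.length,
    by fun_prop, by fun_prop, fun x => ?_⟩
  have hfx := hf x
  refine Brackets.of_eps (fun b hb => ?_) (fun b hb => ?_) (fun ε hε => ?_)
  · have hp : (0 : ℝ) < 2 ^ b.length := by positivity
    refine maxBelow_le (mul_nonneg hfx.1 hp.le) fun k _ => ?_
    simp only [L]
    split_ifs with hk
    · have e1 := h1 x (Nat.unpair k).1 (Nat.unpair k).2 (hb _ _ hk)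
      set u := (Nat.unpair k).1
      set v := (Nat.unpair k).2
      refine (Brackets.natDiv_bounds _ _ (by positivity)).1.trans ?_
      push_cast
      rw [div_le_iff₀ (by positivity)]
      have e2 : ((u - 1 : ℕ) : ℝ) ≤ f x * (v + 1) := by
        rcases Nat.eq_zero_or_pos u with hu | hu
        · simp only [hu]
          have := mul_nonneg hfx.1 (show (0 : ℝ) ≤ v + 1 by positivity)
          simpa using this
        · push_cast [Nat.cast_sub hu]
          linarith
      nlinarith
    · push_cast
      exact mul_nonneg hfx.1 hp.le
  · have hp : (0 : ℝ) < 2 ^ b.length := by positivity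
    have hle : f x * 2 ^ b.length ≤ 2 ^ b.length := by nlinarith
    refine le_minBelow (by push_cast; exact hle) fun k _ => ?_
    simp only [H]
    split_ifs with hk
    · have e1 := h0 x (Nat.unpair k).1 (Nat.unpair k).2 (hb _ _ hk)
      set u := (Nat.unpair k).1
      set v := (Nat.unpair k).2
      have e3 := (Brackets.natDiv_bounds (2 ^ b.length * (u + 1)) (v + 1) (by positivity)).2
      push_cast at e3 ⊢
      refine le_trans ?_ e3
      rw [le_div_iff₀ (by positivity)]
      nlinarith
    · push_cast
      exact hle
  · obtain ⟨v, hv⟩ := exists_nat_gt (4 / ε)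
    have hv1 : 4 < ε * (v + 1) := by
      have := (div_lt_iff₀ hε).1 hv
      nlinarith
    have hlen : ∀ u : ℕ, ∀ᶠ b in ansFilter V,
        Nat.pair u v < b.length ∧ q (x, u, v) < b.length := fun u => by
      filter_upwards [eventually_length (Nat.pair u v + 1), eventually_length (q (x, u, v) + 1)]
        with b e1 e2
      exact ⟨e1, e2⟩
    have hall : ∀ᶠ b in ansFilter V, ∀ u ∈ Finset.range (v + 4),
        Nat.pair u v < b.length ∧ q (x, u, v) < b.length :=
      (Filter.eventually_all_finset _).2 fun u _ => hlen u
    filter_upwards [hall, eventually_consistent,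
      (tendsto_order.1 (tendsto_const_div_two_pow (V := V) 4)).2 ε hε] with b hb hc hd
    have hp : (0 : ℝ) < 2 ^ b.length := by positivity
    have hd' : 4 < ε * 2 ^ b.length := (div_lt_iff₀ hp).1 hd
    have hv0 : (0 : ℝ) < (v : ℝ) + 1 := by positivity
    have hans : ∀ u < v + 4, b[q (x, u, v)]? = some true ∨ b[q (x, u, v)]? = some false := by
      intro u hu
      rw [List.getElem?_eq_getElem (hb u (Finset.mem_range.2 hu)).2]
      cases b[q (x, u, v)]'(hb u (Finset.mem_range.2 hu)).2 <;> simp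
    -- A `true` answer at `u = v + 3` would force `v + 3 ≤ f x * (v + 1) + 1 ≤ v + 2`. So some
    -- answer is `false`, and the first such `u` locates `f x * (v + 1)` between `u - 2` and `u +
    -- 1`, using the `true` answer at `u - 1`.
    have hlast : b[q (x, v + 3, v)]? = some false := by
      rcases hans (v + 3) (by omega) with h | h
      · exfalso
        have := h1 x _ _ (hc _ _ h)
        push_cast at this
        nlinarith
      · exact h
    have hex : ∃ u, u < v + 4 ∧ b[q (x, u, v)]? = some false := ⟨v + 3, by omega, hlast⟩
    obtain ⟨hu1, hu2⟩ := Nat.find_spec hex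
    set u := Nat.find hex with hu
    have hfu : f x * (v + 1) ≤ u + 1 := h0 x _ _ (hc _ _ hu2)
    have hupper : ((minBelow (2 ^ b.length) (H (x, b)) b.length : ℕ) : ℝ) ≤
        2 ^ b.length * (u + 1) / (v + 1) + 1 := by
      have e1 := minBelow_le (c := 2 ^ b.length) (g := H (x, b))
        (hb u (Finset.mem_range.2 hu1)).1
      have e2 : H (x, b) (Nat.pair u v) = 2 ^ b.length * (u + 1) / (v + 1) + 1 := by
        simp only [H, Nat.unpair_pair, hu2, if_true]
      rw [e2] at e1
      have e3 := (Brackets.natDiv_bounds (2 ^ b.length * (u + 1)) (v + 1) (by positivity)).1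
      have e4 : ((minBelow (2 ^ b.length) (H (x, b)) b.length : ℕ) : ℝ) ≤
        ((2 ^ b.length * (u + 1) / (v + 1) + 1 : ℕ) : ℝ) := by exact_mod_cast e1
      push_cast at e3 e4
      linarith
    have hlower : 2 ^ b.length * ((u : ℝ) - 2) / (v + 1) - 1 ≤
        (maxBelow (L (x, b)) b.length : ℕ) := by
      by_cases h2 : u ≤ 1
      · have : (u : ℝ) ≤ 1 := by exact_mod_cast h2
        have : 2 ^ b.length * ((u : ℝ) - 2) / (v + 1) ≤ 0 :=
          div_nonpos_of_nonpos_of_nonneg (by nlinarith) hv0.le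
        have := Nat.cast_nonneg (α := ℝ) (maxBelow (L (x, b)) b.length)
        linarith
      · have hlt : u - 1 < u := by omega
        have h3 : b[q (x, u - 1, v)]? = some true := by
          rcases hans (u - 1) (by omega) with h | h
          · exact h
          · exact absurd ⟨by omega, h⟩ (Nat.find_min hex hlt)
        have e1 := le_maxBelow (g := L (x, b)) (hb (u - 1) (Finset.mem_range.2 (by omega))).1
        have e2 : L (x, b) (Nat.pair (u - 1) v) = 2 ^ b.length * (u - 1 - 1) / (v + 1) := by
          simp only [L, Nat.unpair_pair, h3, if_true]
        rw [e2] at e1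
        have e3 := (Brackets.natDiv_bounds (2 ^ b.length * (u - 1 - 1)) (v + 1) (by positivity)).2
        have e4 : ((2 ^ b.length * (u - 1 - 1) / (v + 1) : ℕ) : ℝ) ≤
          (maxBelow (L (x, b)) b.length : ℕ) := by exact_mod_cast e1
        have e5 : ((u - 1 - 1 : ℕ) : ℝ) = (u : ℝ) - 2 := by
          rw [Nat.sub_sub, Nat.cast_sub (by omega)]; norm_num
        push_cast [e5] at e3 e4
        linarith
    have hfl : (u : ℝ) - 2 ≤ f x * (v + 1) := by
      by_cases h2 : u = 0
      · rw [h2]; push_cast; nlinarith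
      · have hlt : u - 1 < u := by omega
        have h3 : b[q (x, u - 1, v)]? = some true := by
          rcases hans (u - 1) (by omega) with h | h
          · exact h
          · exact absurd ⟨by omega, h⟩ (Nat.find_min hex hlt)
        have := h1 x _ _ (hc _ _ h3)
        rw [Nat.cast_sub (by omega)] at this
        push_cast at this
        linarith
    constructor
    · refine le_trans ?_ hlower
      have e6 : f x - 3 / (v + 1) ≤ ((u : ℝ) - 2) / (v + 1) := by
        rw [sub_le_iff_le_add, ← add_div, le_div_iff₀ hv0]; linarith
      have e7 : 3 / ((v : ℝ) + 1) < ε * (3 / 4) := by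
        rw [div_lt_iff₀ hv0]; nlinarith
      have e8 := mul_le_mul_of_nonneg_left e6 hp.le
      have e9 := mul_lt_mul_of_pos_left e7 hp
      rw [mul_div_assoc]
      nlinarith
    · refine hupper.trans ?_
      have e6 : ((u : ℝ) + 1) / (v + 1) ≤ f x + 3 / (v + 1) := by
        rw [div_le_iff₀ hv0, add_mul, div_mul_cancel₀ _ hv0.ne']; linarith
      have e7 : 3 / ((v : ℝ) + 1) < ε * (3 / 4) := by
        rw [div_lt_iff₀ hv0]; nlinarith
      have e8 := mul_le_mul_of_nonneg_left e6 hp.le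
      have e9 := mul_lt_mul_of_pos_left e7 hp
      rw [mul_div_assoc]
      nlinarith

end Approx

end Approximation

/-! ### Machines -/

section Programs

variable {S : Type*} [Primcodable S] {O : Oracle S} {T : Machine} {n : ℕ} {Y Z : Set ℕ}

theorem runProb_mem_Icc (k : ℕ) (b : List Bool) : runProb O T n Y k b ∈ Set.Icc (0 : ℝ) 1 := by
  induction k generalizing b with
  | zero => simp [runProb]
  | succ k ih =>
    rw [runProb]
    split
    · simp
    · split_ifs <;> simp
    · have h1 := ih (b ++ [true])
      have h2 := ih (b ++ [false])
      constructor <;> linarith [h1.1, h1.2, h2.1, h2.2]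
    · rename_i T' x c s _
      have h1 := ih (b ++ [true])
      have h2 := ih (b ++ [false])
      have h3 := (O T' x ((c.1 : ℚ) / ((c.2 : ℚ) + 1)) s).2
      constructor <;> nlinarith [h1.1, h1.2, h2.1, h2.2, h3.1, h3.2]

theorem runProb_mono_set (hYZ : Y ⊆ Z) (k : ℕ) (b : List Bool) :
    runProb O T n Y k b ≤ runProb O T n Z k b := by
  induction k generalizing b with
  | zero => simp [runProb]
  | succ k ih =>
    rw [runProb, runProb]
    split
    · exact le_rfl
    · split_ifs with h1 h2
      · exact le_rfl
      · exact absurd (hYZ h1) h2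
      · exact zero_le_one
      · exact le_rfl
    · linarith [ih (b ++ [true]), ih (b ++ [false])]
    · rename_i T' x c s _
      have h3 := (O T' x ((c.1 : ℚ) / ((c.2 : ℚ) + 1)) s).2
      exact add_le_add (mul_le_mul_of_nonneg_left (ih _) h3.1)
        (mul_le_mul_of_nonneg_left (ih _) (by linarith [h3.2]))

theorem runProb_le_outProb (k : ℕ) : runProb O T n Y k [] ≤ outProb O T n Y :=
  le_ciSup (f := fun k => runProb O T n Y k [])
    ⟨1, by rintro _ ⟨k, rfl⟩; exact (runProb_mem_Icc k []).2⟩ k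

theorem outProb_nonneg : 0 ≤ outProb O T n Y :=
  (runProb_mem_Icc 0 []).1.trans (runProb_le_outProb 0)

theorem outProb_mono_set (hYZ : Y ⊆ Z) : outProb O T n Y ≤ outProb O T n Z :=
  ciSup_le fun k => (runProb_mono_set hYZ k []).trans (runProb_le_outProb k)

theorem outProb_le_one : outProb O T n Y ≤ 1 :=
  ciSup_le fun k => (runProb_mem_Icc k []).2

theorem nextInstr_of_eval_some' {b : List Bool} {r : ℕ}
    (h : T.eval (Encodable.encode (n, b)) = Part.some r) :
    nextInstr T n b = (Encodable.decode r : Option (Instr S)) := by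
  rw [nextInstr, h, Part.some_toOption, Option.bind_some]

theorem nextInstr_of_eval_some {b : List Bool} {i : Instr S}
    (h : T.eval (Encodable.encode (n, b)) = Part.some (Encodable.encode i)) :
    nextInstr T n b = some i := by
  rw [nextInstr_of_eval_some' h, Encodable.encodek]

theorem nextInstr_of_eval_none {b : List Bool}
    (h : T.eval (Encodable.encode (n, b)) = Part.none) :
    (nextInstr T n b : Option (Instr S)) = none := by
  rw [nextInstr, h]
  simp [Part.toOption]

/-- A computable family of instruction functions is realized by a computable family of
machines. -/
theorem exists_machine {γ : Type*} [Primcodable γ]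
    {instr : γ × ℕ × List Bool →. Instr S} (h : Partrec instr) :
    ∃ M : γ → Machine, Computable M ∧
      (∀ c n b i, instr (c, n, b) = Part.some i → nextInstr (M c) n b = some i) ∧
      ∀ c n b, instr (c, n, b) = Part.none → (nextInstr (M c) n b : Option (Instr S)) = none := by
  let g : ℕ →. ℕ := fun k =>
    Part.bind (Part.ofOption (Encodable.decode (α := γ × ℕ × List Bool) k)) fun p =>
      (instr p).map Encodable.encode
  have hg : Nat.Partrec g := by
    have : Partrec g := by
      refine Partrec.bind (Computable.ofOption Computable.decode)
        (g := fun _ p => (instr p).map Encodable.encode) ?_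
      refine Partrec.map (h.comp Computable.snd) (g := fun _ i => Encodable.encode i) ?_
      exact Computable.encode.comp Computable.snd
    exact Partrec.nat_iff.1 this
  obtain ⟨T, hT⟩ := Nat.Partrec.Code.exists_code.1 hg
  have e : ∀ c n b, (T.curry (Encodable.encode c)).eval (Encodable.encode (n, b)) =
      (instr (c, n, b)).map Encodable.encode := by
    intro c n b
    rw [Nat.Partrec.Code.eval_curry, ← Encodable.encode_prod_val, hT]
    simp only [g, Encodable.encodek, Part.ofOption, Part.bind_some]
  refine ⟨fun c => T.curry (Encodable.encode c), by fun_prop, fun c n b i hi => ?_,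
    fun c n b hi => ?_⟩
  · exact nextInstr_of_eval_some (by rw [e, hi, Part.map_some])
  · exact nextInstr_of_eval_none (by rw [e, hi, Part.map_none])

end Programs

/-! ### Reading a reflective oracle -/

section Reading

variable {A E : Type*} [Fintype A] [Fintype E] [Primcodable A] [Primcodable E]
  {O : Oracle (A ⊕ E)} (hO : IsReflective O)

theorem compl_spec (T : Machine) (x : List (A ⊕ E)) : IsCompletion O T x (compl hO T x) :=
  Classical.choose_spec (hO T x)

theorem lam_nonneg {S : Type*} [Primcodable S] (O : Oracle S) (T : Machine) (x : List S) (s : S) :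
    0 ≤ lam O T x s := outProb_nonneg

theorem compl_nonneg (T : Machine) (x : List (A ⊕ E)) (s : A ⊕ E) : 0 ≤ compl hO T x s :=
  (lam_nonneg O T x s).trans ((compl_spec hO T x).lower s)

theorem compl_le_one (T : Machine) (x : List (A ⊕ E)) (s : A ⊕ E) : compl hO T x s ≤ 1 := by
  have h := compl_spec hO T x
  rcases s with a | e
  · exact (h.upper_action a).trans
      (sub_le_self _ (Finset.sum_nonneg fun _ _ => lam_nonneg O T x _))
  · exact (h.upper_percept e).trans
      (sub_le_self _ (Finset.sum_nonneg fun _ _ => lam_nonneg O T x _))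

/-- The answer `a` to the query with code `j` is correct for the completed probabilities. -/
def Allowed (j : ℕ) (a : Bool) : Prop :=
  ∀ (T : Machine) (x : List (A ⊕ E)) (c : ℕ × ℕ) (s : A ⊕ E),
    Encodable.decode j = some (T, x, c, s) →
      (a = true → (c.1 : ℝ) / (c.2 + 1) ≤ compl hO T x s) ∧
      (a = false → compl hO T x s ≤ (c.1 : ℝ) / (c.2 + 1))

/-- This and its counterpart for `false` reduce the randomness of the oracle to consistency: an
answer that is not allowed has probability zero. -/
theorem allowed_of_pos {j : ℕ} {T : Machine} {x : List (A ⊕ E)} {c : ℕ × ℕ} {s : A ⊕ E}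
    (hj : Encodable.decode j = some (T, x, c, s))
    (h : 0 < (O T x ((c.1 : ℚ) / ((c.2 : ℚ) + 1)) s : ℝ)) : Allowed hO j true := by
  intro T' x' c' s' hj'
  rw [hj] at hj'
  obtain ⟨rfl, rfl, rfl, rfl⟩ : T = T' ∧ x = x' ∧ c = c' ∧ s = s' := by simpa using hj'
  refine ⟨fun _ => ?_, fun h => by simp at h⟩
  by_contra hlt
  have := (compl_spec hO T x).answer_zero s ((c.1 : ℚ) / ((c.2 : ℚ) + 1))
    (by push_cast; exact not_le.1 hlt)
  linarith

theorem allowed_of_lt_one {j : ℕ} {T : Machine} {x : List (A ⊕ E)} {c : ℕ × ℕ} {s : A ⊕ E}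
    (hj : Encodable.decode j = some (T, x, c, s))
    (h : (O T x ((c.1 : ℚ) / ((c.2 : ℚ) + 1)) s : ℝ) < 1) : Allowed hO j false := by
  intro T' x' c' s' hj'
  rw [hj] at hj'
  obtain ⟨rfl, rfl, rfl, rfl⟩ : T = T' ∧ x = x' ∧ c = c' ∧ s = s' := by simpa using hj'
  refine ⟨fun h => by simp at h, fun _ => ?_⟩
  by_contra hlt
  have := (compl_spec hO T x).answer_one s ((c.1 : ℚ) / ((c.2 : ℚ) + 1))
    (by push_cast; exact not_le.1 hlt)
  linarith

/-- The oracle itself compares `compl` with rationals; a random answer at equality does no harm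
because both non-strict inequalities then hold. -/
theorem approx_compl : Approx (Allowed hO) fun i : Machine × List (A ⊕ E) × (A ⊕ E) =>
    compl hO i.1 i.2.1 i.2.2 := by
  refine Approx.of_threshold (fun i => ⟨compl_nonneg hO _ _ _, compl_le_one hO _ _ _⟩)
    (q := fun p => Encodable.encode ((p.1.1, p.1.2.1, p.2, p.1.2.2) :
      Machine × List (A ⊕ E) × (ℕ × ℕ) × (A ⊕ E))) (by fun_prop) ?_ ?_
  · intro i u v h
    have := (h _ _ _ _ (Encodable.encodek _)).1 rfl
    rw [div_le_iff₀ (by positivity)] at this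
    linarith
  · intro i u v h
    have := (h _ _ _ _ (Encodable.encodek _)).2 rfl
    rw [le_div_iff₀ (by positivity)] at this
    linarith

/-- The rational coded by `m` exceeds `u / (v + 1)`. -/
def exceeds (u v m : ℕ) : Bool :=
  ((Encodable.decode m : Option (ℕ × ℕ × ℕ)).map fun c =>
    decide (u * (c.2.2 + 1) + c.2.1 * (v + 1) < c.1 * (v + 1))).getD false

theorem computable_exceeds : Computable fun p : (ℕ × ℕ) × ℕ => exceeds p.1.1 p.1.2 p.2 := by
  refine Computable.option_getD (Computable.option_map (Computable.decode.comp Computable.snd)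
    (g := fun (p : (ℕ × ℕ) × ℕ) (c : ℕ × ℕ × ℕ) =>
      decide (p.1.1 * (c.2.2 + 1) + c.2.1 * (p.1.2 + 1) < c.1 * (p.1.2 + 1))) ?_)
    (Computable.const false)
  show Computable fun p : ((ℕ × ℕ) × ℕ) × (ℕ × ℕ × ℕ) => decide
    (p.1.1.1 * (p.2.2.2 + 1) + p.2.2.1 * (p.1.1.2 + 1) < p.2.1 * (p.1.1.2 + 1))
  exact computable_lt (by fun_prop) (by fun_prop)

theorem exceeds_iff {u v m : ℕ} {c : ℕ × ℕ × ℕ} (h : Encodable.decode m = some c) :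
    exceeds u v m = true ↔ (u : ℝ) < ratOf c * (v + 1) := by
  have hc : (0 : ℝ) < (c.2.2 : ℝ) + 1 := by positivity
  simp only [exceeds, h, Option.map_some, Option.getD_some, decide_eq_true_eq]
  have e : ((ratOf c : ℚ) : ℝ) * (v + 1) =
      (((c.1 : ℝ) - c.2.1) * (v + 1)) / (c.2.2 + 1) := by
    simp [ratOf]; ring
  rw [e, lt_div_iff₀ hc, ← Nat.cast_lt (α := ℝ)]
  push_cast
  constructor <;> intro h <;> linarith

/-- A machine that runs `T` and outputs one of two symbols, according to whether the output of `T`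
exceeds a threshold. -/
theorem exists_threshold_machine {α : Type*} [Primcodable α] (O : Oracle (A ⊕ E)) (T : Machine)
    {s₁ s₂ : A ⊕ E} (hs : s₁ ≠ s₂) :
    ∃ M : α × ℕ × ℕ → Machine, Computable M ∧ ∀ x u v,
      lam O (M (x, u, v)) [] s₁ =
        outProb O T (Encodable.encode (x, v + 1)) {m | exceeds u v m = true} ∧
      lam O (M (x, u, v)) [] s₂ =
        outProb O T (Encodable.encode (x, v + 1)) {m | exceeds u v m = false} := by
  classical
  let post : α × ℕ × ℕ → Instr (A ⊕ E) → Instr (A ⊕ E) := fun c i =>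
    Sum.casesOn i (fun m => Sum.inl (bif exceeds c.2.1 c.2.2 m then Encodable.encode s₁
      else Encodable.encode s₂)) (fun q => Sum.inr q)
  have hpost : Computable fun p : (α × ℕ × ℕ) × Instr (A ⊕ E) => post p.1 p.2 := by
    refine Computable.sumCasesOn Computable.snd
      (g := fun (p : (α × ℕ × ℕ) × Instr (A ⊕ E)) (m : ℕ) =>
        (Sum.inl (bif exceeds p.1.2.1 p.1.2.2 m then Encodable.encode s₁
          else Encodable.encode s₂) : Instr (A ⊕ E)))
      (h := fun (p : (α × ℕ × ℕ) × Instr (A ⊕ E)) q => (Sum.inr q : Instr (A ⊕ E))) ?_ ?_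
    · have h : Computable fun p : ((α × ℕ × ℕ) × Instr (A ⊕ E)) × ℕ =>
          exceeds p.1.1.2.1 p.1.1.2.2 p.2 :=
        computable_exceeds.comp (g := fun p : ((α × ℕ × ℕ) × Instr (A ⊕ E)) × ℕ =>
          ((p.1.1.2.1, p.1.1.2.2), p.2)) (by fun_prop)
      exact Computable.sumInl.comp
        (Computable.cond h (Computable.const _) (Computable.const _))
    · exact Computable.sumInr.comp Computable.snd
  let instr : (α × ℕ × ℕ) × ℕ × List Bool →. Instr (A ⊕ E) := fun p =>
    (T.eval (Encodable.encode (Encodable.encode (p.1.1, p.1.2.2 + 1), p.2.2))).bind fun r =>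
      Part.ofOption ((Encodable.decode r : Option (Instr (A ⊕ E))).map (post p.1))
  have hinstr : Partrec instr := by
    refine Partrec.bind (f := fun p : (α × ℕ × ℕ) × ℕ × List Bool => T.eval
      (Encodable.encode (Encodable.encode (p.1.1, p.1.2.2 + 1), p.2.2)))
      (g := fun p r => Part.ofOption
        ((Encodable.decode r : Option (Instr (A ⊕ E))).map (post p.1))) ?_ ?_
    · exact Nat.Partrec.Code.eval_part.comp (Computable.const T) (by fun_prop)
    · refine Computable.ofOption (Computable.option_map (Computable.decode.comp Computable.snd)
        (g := fun (p : ((α × ℕ × ℕ) × ℕ × List Bool) × ℕ) i => post p.1.1 i) ?_)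
      show Computable fun p : (((α × ℕ × ℕ) × ℕ × List Bool) × ℕ) × Instr (A ⊕ E) =>
        post p.1.1.1 p.2
      exact hpost.comp (g := fun p : (((α × ℕ × ℕ) × ℕ × List Bool) × ℕ) × Instr (A ⊕ E) =>
        (p.1.1.1, p.2)) (by fun_prop)
  obtain ⟨M, hM, hsome, hnone⟩ := exists_machine hinstr
  have hstep : ∀ x u v n b, nextInstr (M (x, u, v)) n b =
      (nextInstr T (Encodable.encode (x, v + 1)) b).map (post (x, u, v)) := by
    intro x u v n b
    rcases Part.eq_none_or_eq_some
        (T.eval (Encodable.encode (Encodable.encode (x, v + 1), b))) with h | ⟨r, h⟩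
    · rw [nextInstr_of_eval_none h, hnone _ _ _ (by simp only [instr, h, Part.bind_none]),
        Option.map_none]
    · have hi : instr ((x, u, v), n, b) = Part.ofOption
          ((Encodable.decode r : Option (Instr (A ⊕ E))).map (post (x, u, v))) := by
        simp only [instr, h, Part.bind_some]
      rw [nextInstr_of_eval_some' h]
      rcases hr : (Encodable.decode r : Option (Instr (A ⊕ E))) with _ | i
      · exact hnone _ _ _ (by rw [hi, hr]; rfl)
      · exact hsome _ _ _ _ (by rw [hi, hr]; rfl)
  have hrun : ∀ (s : A ⊕ E) (t : Bool) x u v, (∀ m, (bif exceeds u v m then Encodable.encode s₁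
      else Encodable.encode s₂) = Encodable.encode s ↔ exceeds u v m = t) →
      lam O (M (x, u, v)) [] s =
        outProb O T (Encodable.encode (x, v + 1)) {m | exceeds u v m = t} := by
    intro s t x u v hst
    -- `post` changes only halting instructions, so both machines request the same coin flips and
    -- make the same oracle calls.
    have key : ∀ k b, runProb O (M (x, u, v)) (Encodable.encode ([] : List (A ⊕ E)))
        {Encodable.encode s} k b =
        runProb O T (Encodable.encode (x, v + 1)) {m | exceeds u v m = t} k b := by
      intro k
      induction k with
      | zero => intro b; rfl
      | succ k ih =>
        intro b
        rw [runProb, runProb, hstep]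
        rcases nextInstr T (Encodable.encode (x, v + 1)) b with
          _ | m | _ | ⟨T', y, c, s'⟩
        · rfl
        · simp only [Option.map_some, post, Set.mem_singleton_iff, Set.mem_ofPred_eq, hst]
          split_ifs <;> rfl
        · simp only [Option.map_some, post, ih]
        · simp only [Option.map_some, post, ih]
    simp only [lam, outProb, key]
  have hne : Encodable.encode s₁ ≠ Encodable.encode s₂ := fun h => hs (Encodable.encode_injective h)
  refine ⟨M, hM, fun x u v => ⟨hrun s₁ true x u v fun m => ?_, hrun s₂ false x u v fun m => ?_⟩⟩
  · cases exceeds u v m <;> simp [hne.symm]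
  · cases exceeds u v m <;> simp [hne]

/-- An estimating machine may return different rationals on different runs, so it is not run
directly. The oracle is asked instead about a machine that reports whether the estimate exceeds a
threshold: away from the threshold the report is almost surely constant, and near it either answer
is acceptable. The hypothesis `hcompl` makes `s₁` and `s₂` exclude each other in the completion, as
two distinct symbols of one type do. -/
theorem approx_of_isOEstimable {α : Type*} [Primcodable α] {f : α → ℝ} (hf : IsOEstimable O f)
    (h01 : ∀ x, 0 ≤ f x ∧ f x ≤ 1) {s₁ s₂ : A ⊕ E} (hs : s₁ ≠ s₂)
    (hcompl : ∀ T x, lam O T x s₂ = 1 → compl hO T x s₁ = 0) : Approx (Allowed hO) f := by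
  obtain ⟨T, hT⟩ := hf
  obtain ⟨M, hM, hMlam⟩ := exists_threshold_machine (α := α) O T hs
  have hfull : ∀ x v (Y : Set ℕ), {m | ∃ c : ℕ × ℕ × ℕ, Encodable.decode m = some c ∧
      |f x - (ratOf c : ℝ)| < 1 / ((v + 1 : ℕ) : ℝ)} ⊆ Y →
      outProb O T (Encodable.encode (x, v + 1)) Y = 1 := fun x v Y hY =>
    le_antisymm outProb_le_one ((hT x (v + 1) (by omega)).ge.trans (outProb_mono_set hY))
  have hrat : ∀ x (v : ℕ) c, |f x - (ratOf c : ℝ)| < 1 / ((v + 1 : ℕ) : ℝ) →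
      (ratOf c : ℝ) * (v + 1) < f x * (v + 1) + 1 ∧
      f x * (v + 1) < (ratOf c : ℝ) * (v + 1) + 1 := by
    intro x v c h
    have hv : (0 : ℝ) < (v : ℝ) + 1 := by positivity
    push_cast at h
    rw [abs_lt] at h
    have h1 := mul_lt_mul_of_pos_right h.1 hv
    have h2 := mul_lt_mul_of_pos_right h.2 hv
    rw [neg_mul, one_div_mul_cancel hv.ne'] at h1
    rw [one_div_mul_cancel hv.ne'] at h2
    constructor <;> linarith
  -- The pair `(1, 1)` codes the rational `1 / 2`: a completed probability of `s₁` equal to `0` or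
  -- `1` is told apart by comparison with one half.
  refine Approx.of_threshold h01 (q := fun p => Encodable.encode ((M p, [], (1, 1), s₁) :
      Machine × List (A ⊕ E) × (ℕ × ℕ) × (A ⊕ E))) (by fun_prop) ?_ ?_
  · intro x u v h
    have h1 := (h _ _ _ _ (Encodable.encodek _)).1 rfl
    by_contra hlt
    rw [not_le] at hlt
    have h2 : lam O (M (x, u, v)) [] s₂ = 1 := by
      rw [(hMlam x u v).2]
      refine hfull x v _ ?_
      rintro m ⟨c, hc, hc'⟩
      rw [Set.mem_ofPred_eq, Bool.eq_false_iff]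
      intro hex
      rw [exceeds_iff hc] at hex
      have h3 := hrat x v c hc'
      linarith [h3.1]
    rw [hcompl _ _ h2] at h1
    norm_num at h1
  · intro x u v h
    have h1 := (h _ _ _ _ (Encodable.encodek _)).2 rfl
    by_contra hlt
    rw [not_le] at hlt
    have h2 : lam O (M (x, u, v)) [] s₁ = 1 := by
      rw [(hMlam x u v).1]
      refine hfull x v _ ?_
      rintro m ⟨c, hc, hc'⟩
      rw [Set.mem_ofPred_eq, exceeds_iff hc]
      have h3 := hrat x v c hc'
      linarith [h3.2]
    have := (compl_spec hO (M (x, u, v)) []).lower s₁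
    rw [h2] at this
    norm_num at h1
    linarith

end Reading

/-! ### Exact sampling -/

section Intervals

variable {B : Type*} [Fintype B] [Primcodable B]

/-- The symbols that precede `s`. -/
def before (s : B) : Finset B :=
  Finset.univ.filter fun s' => Encodable.encode s' < Encodable.encode s

/-- All points of `[u / 2 ^ n, (u + 1) / 2 ^ n]` belong to the interval of the symbol `s`, if the
weights of the symbols are only known to be between `lo` and `hi`. -/
def certified (lo hi : B → ℕ) (n u : ℕ) (s : B) : Bool :=
  decide (2 ^ n * ∑ s' ∈ before s, hi s' ≤ u * ∑ s', lo s' ∧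
    (u + 1) * ∑ s', hi s' ≤ 2 ^ n * (∑ s' ∈ before s, lo s' + lo s))

theorem certified_sound {lo hi : B → ℕ} {y : B → ℝ} {n u : ℕ} {s : B}
    (hlo : ∀ s, (lo s : ℝ) ≤ y s * 2 ^ n) (hhi : ∀ s, y s * 2 ^ n ≤ hi s)
    (h : certified lo hi n u s = true) :
    2 ^ n * ∑ s' ∈ before s, y s' ≤ u * ∑ s', y s' ∧
      (u + 1) * ∑ s', y s' ≤ 2 ^ n * (∑ s' ∈ before s, y s' + y s) := by
  have hp : (0 : ℝ) < 2 ^ n := by positivity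
  have sumlo : ∀ F : Finset B, (∑ s ∈ F, (lo s : ℝ)) ≤ (∑ s ∈ F, y s) * 2 ^ n := fun F => by
    rw [Finset.sum_mul]; exact Finset.sum_le_sum fun s _ => hlo s
  have sumhi : ∀ F : Finset B, (∑ s ∈ F, y s) * 2 ^ n ≤ ∑ s ∈ F, (hi s : ℝ) := fun F => by
    rw [Finset.sum_mul]; exact Finset.sum_le_sum fun s _ => hhi s
  rw [certified, decide_eq_true_eq] at h
  have h1 : (2 : ℝ) ^ n * ∑ s' ∈ before s, (hi s' : ℝ) ≤ u * ∑ s', (lo s' : ℝ) := by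
    exact_mod_cast h.1
  have h2 : ((u : ℝ) + 1) * ∑ s', (hi s' : ℝ) ≤
      2 ^ n * (∑ s' ∈ before s, (lo s' : ℝ) + lo s) := by
    exact_mod_cast h.2
  constructor
  · refine le_of_mul_le_mul_right ?_ hp
    calc 2 ^ n * (∑ s' ∈ before s, y s') * 2 ^ n = 2 ^ n * ((∑ s' ∈ before s, y s') * 2 ^ n) := by
          ring
      _ ≤ 2 ^ n * ∑ s' ∈ before s, (hi s' : ℝ) := by gcongr; exact sumhi _
      _ ≤ u * ∑ s', (lo s' : ℝ) := h1
      _ ≤ u * ((∑ s', y s') * 2 ^ n) := by gcongr; exact sumlo _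
      _ = _ := by ring
  · refine le_of_mul_le_mul_right ?_ hp
    calc ((u : ℝ) + 1) * (∑ s', y s') * 2 ^ n = (u + 1) * ((∑ s', y s') * 2 ^ n) := by ring
      _ ≤ (u + 1) * ∑ s', (hi s' : ℝ) := by gcongr; exact sumhi _
      _ ≤ 2 ^ n * (∑ s' ∈ before s, (lo s' : ℝ) + lo s) := h2
      _ ≤ 2 ^ n * ((∑ s' ∈ before s, y s') * 2 ^ n + y s * 2 ^ n) := by
          gcongr
          · exact sumlo _
          · exact hlo s
      _ = _ := by ring

theorem sum_before_add_le {y : B → ℝ} (hy : ∀ s, 0 ≤ y s) {s s' : B}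
    (h : Encodable.encode s < Encodable.encode s') :
    ∑ t ∈ before s, y t + y s ≤ ∑ t ∈ before s', y t := by
  classical
  rw [add_comm, ← Finset.sum_insert (by simp [before])]
  refine Finset.sum_le_sum_of_subset_of_nonneg ?_ fun t _ _ => hy t
  intro t ht
  simp only [before, Finset.mem_insert, Finset.mem_filter, Finset.mem_univ, true_and] at ht ⊢
  rcases ht with rfl | ht <;> omega

theorem sum_before_add_le_sum {y : B → ℝ} (hy : ∀ s, 0 ≤ y s) (s : B) :
    ∑ t ∈ before s, y t + y s ≤ ∑ t, y t := by
  classical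
  rw [add_comm, ← Finset.sum_insert (by simp [before])]
  exact Finset.sum_le_sum_of_subset_of_nonneg (Finset.subset_univ _) fun t _ _ => hy t

/-- In the limit both certification inequalities hold with slack `δ` times the total weight for a
dyadic interval that stays `δ` inside the interval of `s`. The slack does not depend on `u`, so one
length of answers works for all `u`. -/
theorem certified_complete {V : ℕ → Bool → Prop} {lo hi : B → List Bool → ℕ} {y : B → ℝ}
    (h : ∀ s, Brackets V (y s) (lo s) (hi s)) (hZ : 0 < ∑ s, y s) (s : B) {δ : ℝ} (hδ : 0 < δ) :
    ∀ᶠ l in ansFilter V, ∀ u : ℕ,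
      ((∑ s' ∈ before s, y s') / (∑ s', y s') + δ) * 2 ^ l.length ≤ u →
      (u + 1 : ℝ) ≤ ((∑ s' ∈ before s, y s' + y s) / (∑ s', y s') - δ) * 2 ^ l.length →
      certified (fun s => lo s l) (fun s => hi s l) l.length u s = true := by
  set Z := ∑ s', y s' with hZdef
  set P := ∑ s' ∈ before s, y s'
  have hbef : Brackets V P (fun l => ∑ s' ∈ before s, lo s' l)
    (fun l => ∑ s' ∈ before s, hi s' l) := Brackets.sum h
  have hall : Brackets V Z (fun l => ∑ s', lo s' l) (fun l => ∑ s', hi s' l) := Brackets.sum h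
  have hadd := hbef.add (h s)
  have t1 := hbef.tendsto_upper.sub (hall.tendsto_lower.const_mul (P / Z + δ))
  have t2 := hadd.tendsto_lower.sub (hall.tendsto_upper.const_mul ((P + y s) / Z - δ))
  have e1 : P - (P / Z + δ) * Z < 0 := by
    have : P - (P / Z + δ) * Z = -(δ * Z) := by field_simp; ring
    rw [this]; nlinarith [mul_pos hδ hZ]
  have e2 : 0 < P + y s - ((P + y s) / Z - δ) * Z := by
    have : P + y s - ((P + y s) / Z - δ) * Z = δ * Z := by field_simp; ring
    rw [this]; exact mul_pos hδ hZ
  filter_upwards [(tendsto_order.1 t1).2 _ e1, (tendsto_order.1 t2).1 _ e2] with l h1 h2 u hu1 hu2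
  have hp : (0 : ℝ) < 2 ^ l.length := by positivity
  rw [← mul_div_assoc, ← sub_div, div_lt_iff₀ hp, zero_mul] at h1
  rw [← mul_div_assoc, ← sub_div, lt_div_iff₀ hp, zero_mul] at h2
  rw [certified, decide_eq_true_eq]
  constructor
  · rw [← Nat.cast_le (α := ℝ), Nat.cast_mul, Nat.cast_mul]
    calc ((2 ^ l.length : ℕ) : ℝ) * ((∑ s' ∈ before s, hi s' l : ℕ) : ℝ)
        ≤ ((2 ^ l.length : ℕ) : ℝ) * ((P / Z + δ) * ((∑ s', lo s' l : ℕ) : ℝ)) := by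
          gcongr; linarith
      _ = ((P / Z + δ) * 2 ^ l.length) * ((∑ s', lo s' l : ℕ) : ℝ) := by push_cast; ring
      _ ≤ u * ((∑ s', lo s' l : ℕ) : ℝ) := by gcongr
  · rw [← Nat.cast_le (α := ℝ), Nat.cast_mul, Nat.cast_mul]
    calc ((u + 1 : ℕ) : ℝ) * ((∑ s', hi s' l : ℕ) : ℝ)
        ≤ (((P + y s) / Z - δ) * 2 ^ l.length) * ((∑ s', hi s' l : ℕ) : ℝ) := by
          push_cast at hu2 ⊢
          gcongr
      _ = ((2 ^ l.length : ℕ) : ℝ) * (((P + y s) / Z - δ) * ((∑ s', hi s' l : ℕ) : ℝ)) := by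
          push_cast; ring
      _ ≤ ((2 ^ l.length : ℕ) : ℝ) * ((∑ s' ∈ before s, lo s' l + lo s l : ℕ) : ℝ) := by
          gcongr; linarith

end Intervals

/-! ### Dyadic intervals and their overlap with a target interval -/

section Dyadic

/-- The part of the dyadic interval `[u / 2 ^ m, (u + 1) / 2 ^ m]` that lies in `[α, β]`. -/
noncomputable def dyadicShare (α β : ℝ) (m u : ℕ) : ℝ :=
  2 ^ m * (max α (min β ((u + 1) / 2 ^ m)) - max α (min β (u / 2 ^ m)))

/-- The share is a martingale under coin flips: the share of an interval is the mean of the shares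
of its halves. By the clamping, the share is zero when `β < α`, so that case needs no separate
treatment. -/
theorem dyadicShare_halve (α β : ℝ) (m u : ℕ) : dyadicShare α β m u =
    1 / 2 * dyadicShare α β (m + 1) (2 * u + 1) + 1 / 2 * dyadicShare α β (m + 1) (2 * u) := by
  have e1 : ((2 * u + 1 : ℕ) + 1 : ℝ) / 2 ^ (m + 1) = (u + 1) / 2 ^ m := by
    push_cast; rw [pow_succ]; field_simp; ring
  have e2 : ((2 * u : ℕ) : ℝ) / 2 ^ (m + 1) = u / 2 ^ m := by
    push_cast; rw [pow_succ]; field_simp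
  have e3 : ((2 * u + 1 : ℕ) : ℝ) = (2 * u : ℕ) + 1 := by push_cast; ring
  rw [dyadicShare, dyadicShare, dyadicShare, e1, e2, e3, pow_succ]
  ring

theorem dyadicShare_le_one (α β : ℝ) (m u : ℕ) : dyadicShare α β m u ≤ 1 := by
  have hp : (0 : ℝ) < 2 ^ m := by positivity
  have h : ∀ a b : ℝ, a ≤ b → max α (min β b) - max α (min β a) ≤ b - a := by
    intro a b hab
    rcases le_total β b with h1 | h1 <;> rcases le_total β a with h2 | h2 <;>
      simp only [h1, h2, min_eq_left, min_eq_right] <;>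
      first
      | (rcases le_total α β with h3 | h3 <;> rcases le_total α a with h4 | h4 <;>
          rcases le_total α b with h5 | h5 <;> simp only [h3, h4, h5, max_eq_left, max_eq_right] <;>
          linarith)
  have h1 := h (u / 2 ^ m) ((u + 1) / 2 ^ m) (by gcongr; linarith)
  rw [← sub_div, add_sub_cancel_left] at h1
  calc dyadicShare α β m u ≤ 2 ^ m * (1 / 2 ^ m) := by rw [dyadicShare]; gcongr
    _ = 1 := by field_simp

theorem dyadicShare_pos {α β : ℝ} {m u : ℕ} (h : 0 < dyadicShare α β m u) :
    α * 2 ^ m < u + 1 ∧ u < β * 2 ^ m := by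
  have hp : (0 : ℝ) < 2 ^ m := by positivity
  have h' := sub_pos.1 (pos_of_mul_pos_right h hp.le)
  constructor
  · rw [← lt_div_iff₀ hp]
    by_contra hle
    rw [not_lt] at hle
    rw [max_eq_left ((min_le_right _ _).trans hle)] at h'
    exact absurd h' (not_lt.2 (le_max_left _ _))
  · rw [← div_lt_iff₀ hp]
    by_contra hle
    rw [not_lt] at hle
    rw [min_eq_left hle] at h'
    exact absurd h' (not_lt.2 (max_le_max le_rfl (min_le_left _ _)))

theorem le_dyadicShare_zero {α β : ℝ} (hα : 0 ≤ α) (hβ : β ≤ 1) :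
    β - α ≤ dyadicShare α β 0 0 := by
  have h1 : β ≤ max α (min β 1) := le_max_of_le_right (le_min le_rfl hβ)
  have h2 : max α (min β 0) ≤ α := max_le le_rfl ((min_le_right _ _).trans hα)
  simp only [dyadicShare, pow_zero, Nat.cast_zero, zero_add, div_one, one_mul]
  linarith

end Dyadic

/-- Alternate between coin flips, collected as the binary digits of a number, and oracle
answers, collected in a list. -/
def splitStep (p : Bool × ℕ × List Bool) (a : Bool) : Bool × ℕ × List Bool :=
  bif p.1 then (false, p.2.1, p.2.2 ++ [a]) else (true, 2 * p.2.1 + (bif a then 1 else 0), p.2.2)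

def splitBits (b : List Bool) : Bool × ℕ × List Bool := b.foldl splitStep (false, 0, [])

theorem splitBits_concat (b : List Bool) (a : Bool) :
    splitBits (b ++ [a]) = splitStep (splitBits b) a := by
  simp [splitBits]

theorem computable_splitBits : Computable splitBits := by
  refine (Primrec.list_foldl Primrec.id (Primrec.const _)
    (h := fun _ (q : (Bool × ℕ × List Bool) × Bool) => splitStep q.1 q.2) ?_).to_comp
  refine Primrec.cond (Primrec.fst.comp (Primrec.fst.comp Primrec.snd)) ?_ ?_
  · refine Primrec.pair (Primrec.const false) (Primrec.pair
      (Primrec.fst.comp (Primrec.snd.comp (Primrec.fst.comp Primrec.snd))) ?_)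
    exact Primrec.list_concat.comp (Primrec.snd.comp (Primrec.snd.comp
      (Primrec.fst.comp Primrec.snd))) (Primrec.snd.comp Primrec.snd)
  · refine Primrec.pair (Primrec.const true) (Primrec.pair ?_
      (Primrec.snd.comp (Primrec.snd.comp (Primrec.fst.comp Primrec.snd))))
    exact Primrec.nat_add.comp (Primrec.nat_mul.comp (Primrec.const 2)
      (Primrec.fst.comp (Primrec.snd.comp (Primrec.fst.comp Primrec.snd))))
      (Primrec.cond (Primrec.snd.comp Primrec.snd) (Primrec.const 1) (Primrec.const 0))

/-! ### The sampling machine and its output distribution -/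

section Sampler

variable {A E : Type*} [Fintype A] [Fintype E] [Primcodable A] [Primcodable E]
  {O : Oracle (A ⊕ E)} (hO : IsReflective O)
  {γ B : Type*} [Primcodable γ] [Fintype B] [Primcodable B]

/-- The instruction of the sampling machine, given the decision whether to stop. -/
def samplerInstr {S : Type*} [Primcodable S] (b : List Bool) (d : Option S) : Instr S :=
  bif (splitBits b).1 then
    ((Encodable.decode (splitBits b).2.2.length :
      Option (Machine × List S × (ℕ × ℕ) × S)).map fun q => Sum.inr (some q)).getD (Sum.inr none)
  else (d.map fun s => Sum.inl (Encodable.encode s)).getD (Sum.inr none)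

/-- If a sampling machine never stops wrongly, and has stopped with output `s` whenever the `m`
coin flips select a dyadic interval that meets `[α, β]`, then it outputs `s` with probability at
least `β - α`. -/
theorem le_runProb_sampler {T : Machine} {x : List (A ⊕ E)} {s : A ⊕ E}
    {d : ℕ → List Bool → Option (A ⊕ E)} (hT : ∀ b, nextInstr T (Encodable.encode x) b =
      some (samplerInstr b (d (splitBits b).2.1 (splitBits b).2.2)))
    {α β : ℝ} {m : ℕ}
    (hsound : ∀ u l, Consistent (Allowed hO) l → 0 < dyadicShare α β l.length u →
      ∀ s', d u l = some s' → s' = s)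
    (hdec : ∀ u l, Consistent (Allowed hO) l → l.length = m → 0 < dyadicShare α β m u →
      d u l = some s) (k : ℕ) :
    ∀ b u l, splitBits b = (false, u, l) → l.length + k = m → Consistent (Allowed hO) l →
      dyadicShare α β l.length u ≤
        runProb O T (Encodable.encode x) {Encodable.encode s} (2 * k + 1) b := by
  induction k with
  | zero =>
    intro b u l hb hl hc
    rcases le_or_gt (dyadicShare α β l.length u) 0 with h0 | h0
    · exact h0.trans (runProb_mem_Icc _ _).1
    · rw [runProb, hT, hb]
      simp only [samplerInstr, hb, cond_false, hdec u l hc (by omega) (by rwa [← show l.length = m by omega]),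
        Option.map_some, Option.getD_some, Set.mem_singleton_iff, if_true]
      exact dyadicShare_le_one _ _ _ _
  | succ k ih =>
    intro b u l hb hl hc
    -- Each new binary digit costs two interactions, a coin flip and an oracle call, and halting
    -- costs one more; hence the bound `2 * k + 1`. This is the state between the flip and the call.
    have hodd : ∀ a u', splitBits (b ++ [a]) = (true, u', l) →
        dyadicShare α β (l.length + 1) u' ≤
          runProb O T (Encodable.encode x) {Encodable.encode s} (2 * k + 2) (b ++ [a]) := by
      intro a u' ha
      have hnext : ∀ a', Allowed hO l.length a' → dyadicShare α β (l.length + 1) u' ≤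
          runProb O T (Encodable.encode x) {Encodable.encode s} (2 * k + 1) (b ++ [a] ++ [a']) := by
        intro a' ha'
        have h1 : splitBits (b ++ [a] ++ [a']) = (false, u', l ++ [a']) := by
          rw [splitBits_concat, ha]; rfl
        have h2 := ih (b ++ [a] ++ [a']) u' (l ++ [a']) h1 (by simp; omega) (hc.concat ha')
        simpa using h2
      rw [runProb, hT, ha]
      simp only [samplerInstr, ha, cond_true]
      rcases hq : (Encodable.decode l.length :
        Option (Machine × List (A ⊕ E) × (ℕ × ℕ) × (A ⊕ E))) with _ | ⟨T', y, c, s'⟩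
      -- The number of answers received serves as the code of the next query. If it codes no query,
      -- a coin flip stands in for the answer, and any value is allowed vacuously.
      · have hall : ∀ a', Allowed hO l.length a' := fun a' T' y c s' h => by
          rw [hq] at h; simp at h
        simp only [Option.map_none, Option.getD_none]
        linarith [hnext true (hall _), hnext false (hall _)]
      · simp only [Option.map_some, Option.getD_some]
        set p : unitInterval := O T' y ((c.1 : ℚ) / ((c.2 : ℚ) + 1)) s' with hp
        have hp01 := p.2
        -- An answer of probability zero contributes nothing; any other answer is allowed, so the
        -- induction hypothesis applies to it.
        have h1 : (p : ℝ) * dyadicShare α β (l.length + 1) u' ≤ (p : ℝ) *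
            runProb O T (Encodable.encode x) {Encodable.encode s} (2 * k + 1)
              (b ++ [a] ++ [true]) := by
          rcases hp01.1.eq_or_lt with h | h
          · rw [← h]; simp
          · exact mul_le_mul_of_nonneg_left (hnext true (allowed_of_pos hO hq h)) h.le
        have h2 : (1 - (p : ℝ)) * dyadicShare α β (l.length + 1) u' ≤ (1 - (p : ℝ)) *
            runProb O T (Encodable.encode x) {Encodable.encode s} (2 * k + 1)
              (b ++ [a] ++ [false]) := by
          rcases hp01.2.eq_or_lt with h | h
          · rw [h]; simp
          · exact mul_le_mul_of_nonneg_left (hnext false (allowed_of_lt_one hO hq h))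
              (sub_nonneg.2 h.le)
        linarith
    rcases le_or_gt (dyadicShare α β l.length u) 0 with h0 | h0
    · exact h0.trans (runProb_mem_Icc _ _).1
    · rw [show 2 * (k + 1) + 1 = 2 * k + 2 + 1 by ring, runProb, hT, hb]
      simp only [samplerInstr, hb, cond_false]
      rcases hd : d u l with _ | s'
      · simp only [Option.map_none, Option.getD_none]
        have h1 := hodd true (2 * u + 1) (by rw [splitBits_concat, hb]; rfl)
        have h2 := hodd false (2 * u) (by rw [splitBits_concat, hb]; rfl)
        rw [dyadicShare_halve]
        linarith
      · simp only [Option.map_some, Option.getD_some, hsound u l hc h0 s' hd,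
          Set.mem_singleton_iff, if_true]
        exact dyadicShare_le_one _ _ _ _

theorem exists_sampler_machine {dec : (γ × List (A ⊕ E)) × ℕ × List Bool → Option (A ⊕ E)}
    (hdec : Computable dec) : ∃ M : γ → Machine, Computable M ∧ ∀ c x b,
      nextInstr (M c) (Encodable.encode x) b =
        some (samplerInstr b (dec ((c, x), (splitBits b).2.1, (splitBits b).2.2))) := by
  have hsplit := computable_splitBits
  have hquery : Computable fun n : ℕ => ((Encodable.decode n :
      Option (Machine × List (A ⊕ E) × (ℕ × ℕ) × (A ⊕ E))).map fun q =>
        (Sum.inr (some q) : Instr (A ⊕ E))).getD (Sum.inr none) :=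
    Computable.option_getD (Computable.option_map Computable.decode
      (Computable.sumInr.comp (Computable.option_some.comp Computable.snd))) (Computable.const _)
  have hhalt : Computable fun d : Option (A ⊕ E) => (d.map fun s =>
      (Sum.inl (Encodable.encode s) : Instr (A ⊕ E))).getD (Sum.inr none) :=
    Computable.option_getD (Computable.option_map Computable.id
      (Computable.sumInl.comp (Computable.encode.comp Computable.snd))) (Computable.const _)
  have hinstr : Computable fun p : (γ × List (A ⊕ E)) × List Bool =>
      samplerInstr p.2 (dec (p.1, (splitBits p.2).2.1, (splitBits p.2).2.2)) := by
    refine Computable.cond (by fun_prop) ?_ ?_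
    · exact hquery.comp (g := fun p : (γ × List (A ⊕ E)) × List Bool =>
        (splitBits p.2).2.2.length) (by fun_prop)
    · exact hhalt.comp (g := fun p : (γ × List (A ⊕ E)) × List Bool =>
        dec (p.1, (splitBits p.2).2.1, (splitBits p.2).2.2)) (by fun_prop)
  let instr : γ × ℕ × List Bool →. Instr (A ⊕ E) := fun p =>
    Part.some (((Encodable.decode p.2.1 : Option (List (A ⊕ E))).map fun x =>
      samplerInstr p.2.2 (dec ((p.1, x), (splitBits p.2.2).2.1, (splitBits p.2.2).2.2))).getD
        (Sum.inr none))
  have hpart : Partrec instr := by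
    refine Computable.option_getD (f := fun p : γ × ℕ × List Bool =>
      (Encodable.decode p.2.1 : Option (List (A ⊕ E))).map fun x =>
      samplerInstr p.2.2 (dec ((p.1, x), (splitBits p.2.2).2.1, (splitBits p.2.2).2.2)))
      (Computable.option_map (Computable.decode.comp (by fun_prop))
        (hinstr.comp (g := fun q : (γ × ℕ × List Bool) × List (A ⊕ E) => ((q.1.1, q.2), q.1.2.2))
          (by fun_prop))) (Computable.const _)
  obtain ⟨M, hM, hsome, -⟩ := exists_machine hpart
  refine ⟨M, hM, fun c x b => hsome _ _ _ _ ?_⟩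
  simp only [instr, Encodable.encodek, Option.map_some, Option.getD_some]

/-- Nonnegative functions that can be approximated from oracle answers can be normalized and
sampled exactly. -/
theorem exists_sampler {ι : B → A ⊕ E}
    (hsum : ∀ T x, ∑ s, compl hO T x (ι s) = 1) {N : B → γ × List (A ⊕ E) → ℝ}
    (hN : ∀ s, Approx (Allowed hO) (N s)) :
    ∃ M : γ → Machine, Computable M ∧ ∀ c x, 0 < ∑ s, N s (c, x) → ∀ s,
      lam O (M c) x (ι s) = N s (c, x) / ∑ s, N s (c, x) ∧
      compl hO (M c) x (ι s) = N s (c, x) / ∑ s, N s (c, x) := by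
  choose lo hi hlo hhi hB using hN
  have hιc : Computable ι := computable_of_finite ι
  let cert : (γ × List (A ⊕ E)) × ℕ × List Bool → B → Bool := fun p s =>
    certified (fun s => lo s (p.1, p.2.2)) (fun s => hi s (p.1, p.2.2)) p.2.2.length p.2.1 s
  have hcert : ∀ s, Computable fun p => cert p s := fun s => by
    have hlo' : ∀ s, Computable fun p : (γ × List (A ⊕ E)) × ℕ × List Bool =>
        lo s (p.1, p.2.2) := fun s => (hlo s).comp (by fun_prop)
    have hhi' : ∀ s, Computable fun p : (γ × List (A ⊕ E)) × ℕ × List Bool =>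
        hi s (p.1, p.2.2) := fun s => (hhi s).comp (by fun_prop)
    exact computable_and (computable_le (by fun_prop) (by fun_prop))
      (computable_le (by fun_prop) (by fun_prop))
  let find : (γ × List (A ⊕ E)) × ℕ × List Bool → Option B := fun p =>
    Finset.univ.toList.find? (cert p)
  have hfind : Computable find := computable_find? hcert
  have hdec : Computable fun p => (find p).map ι :=
    Computable.option_map hfind (hιc.comp Computable.snd)
  obtain ⟨M, hM, hnext⟩ := exists_sampler_machine hdec
  refine ⟨M, hM, fun c x hZ => ?_⟩
  set y : B → ℝ := fun s => N s (c, x) with hy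
  have hy0 : ∀ s, 0 ≤ y s := fun s => (hB s (c, x)).nonneg
  change 0 < ∑ s, y s at hZ
  set Z := ∑ s, y s with hZdef
  -- Lower bounds suffice. Since `lam ≤ compl` and both `y s / Z` and `compl` sum to one, all three
  -- then coincide.
  have hle : ∀ s, y s / Z ≤ lam O (M c) x (ι s) := by
    intro s
    refine le_of_forall_pos_le_add fun ε hε => ?_
    set P := ∑ s' ∈ before s, y s' with hP
    -- The target interval is shrunk by `2 * δ` at each end, which costs `ε` in total. A dyadic
    -- interval narrower than `δ` that meets the shrunken interval stays at distance `δ` from the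
    -- ends, as `certified_complete` requires.
    set δ := ε / 4 with hδdef
    have hδ : 0 < δ := by positivity
    obtain ⟨n, hn⟩ := eventually_ansFilter.1
      ((certified_complete (fun s => hB s (c, x)) hZ s hδ).and
        ((tendsto_order.1 (tendsto_const_div_two_pow (V := Allowed hO) 1)).2 δ hδ))
    -- A dyadic interval certified for `s'` lies in the interval of `s'`, and the intervals of
    -- different symbols overlap at most in endpoints.
    have hunique : ∀ u l, Consistent (Allowed hO) l →
        0 < dyadicShare (P / Z + 2 * δ) ((P + y s) / Z - 2 * δ) l.length u →
        ∀ s', cert ((c, x), u, l) s' = true → s' = s := by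
      intro u l hl hpos s' hs'
      have hp : (0 : ℝ) < 2 ^ l.length := by positivity
      obtain ⟨h1, h2⟩ := certified_sound (fun s => (hB s (c, x)).lower l hl)
        (fun s => (hB s (c, x)).upper l hl) hs'
      change 2 ^ l.length * (∑ t ∈ before s', y t) ≤ u * Z at h1
      change ((u : ℝ) + 1) * Z ≤ 2 ^ l.length * ((∑ t ∈ before s', y t) + y s') at h2
      obtain ⟨h3, h4⟩ := dyadicShare_pos hpos
      have h5 : P * 2 ^ l.length < (u + 1) * Z := by
        have : P / Z * 2 ^ l.length < u + 1 := by nlinarith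
        calc P * 2 ^ l.length = P / Z * 2 ^ l.length * Z := by field_simp
          _ < (u + 1) * Z := by gcongr
      have h6 : u * Z < (P + y s) * 2 ^ l.length := by
        have : (u : ℝ) < (P + y s) / Z * 2 ^ l.length := by nlinarith
        calc u * Z < ((P + y s) / Z * 2 ^ l.length) * Z := by gcongr
          _ = (P + y s) * 2 ^ l.length := by field_simp
      rcases lt_trichotomy (Encodable.encode s') (Encodable.encode s) with h | h | h
      · have := sum_before_add_le hy0 h
        nlinarith
      · exact Encodable.encode_injective h
      · have := sum_before_add_le hy0 h
        nlinarith
    have hsub : ∀ u l s', find ((c, x), u, l) = some s' → cert ((c, x), u, l) s' = true :=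
      fun u l s' h => List.find?_some h
    have hrun := le_runProb_sampler hO (T := M c) (x := x) (s := ι s)
      (d := fun u l => (find ((c, x), u, l)).map ι) (hnext c x)
      (α := P / Z + 2 * δ) (β := (P + y s) / Z - 2 * δ) (m := n)
      (by
        intro u l hl hpos s' hs'
        obtain ⟨s'', h1, rfl⟩ := Option.map_eq_some_iff.1 hs'
        rw [hunique u l hl hpos s'' (hsub u l s'' h1)])
      (by
        intro u l hl hlen hpos
        have hp : (0 : ℝ) < 2 ^ l.length := by positivity
        rw [← hlen] at hpos
        obtain ⟨h1, h2⟩ := hn l hlen.ge hl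
        rw [div_lt_iff₀ hp] at h2
        obtain ⟨h3, h4⟩ := dyadicShare_pos hpos
        have hc : cert ((c, x), u, l) s = true := by
          refine h1 u ?_ ?_
          · change (P / Z + δ) * 2 ^ l.length ≤ u
            nlinarith
          · change (u + 1 : ℝ) ≤ ((P + y s) / Z - δ) * 2 ^ l.length
            nlinarith
        rcases hf : find ((c, x), u, l) with _ | s'
        · exact absurd hc (by simpa using List.find?_eq_none.1 hf s (by simp))
        · rw [hunique u l hl hpos s' (hsub u l s' hf)]
          rfl)
      n [] 0 [] rfl (by simp) consistent_nil
    have h1 : (P + y s) / Z ≤ 1 := (div_le_one hZ).2 (sum_before_add_le_sum hy0 s)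
    have h2 : 0 ≤ P / Z := div_nonneg (Finset.sum_nonneg fun t _ => hy0 t) hZ.le
    have h3 := le_dyadicShare_zero (α := P / Z + 2 * δ) (β := (P + y s) / Z - 2 * δ)
      (by linarith) (by linarith)
    have h4 := hrun.trans (runProb_le_outProb _)
    simp only [List.length_nil] at h4
    change _ ≤ lam O (M c) x (ι s) at h4
    rw [add_div] at h3
    rw [add_div] at h4
    linarith
  have hlc : ∀ s, lam O (M c) x (ι s) ≤ compl hO (M c) x (ι s) := fun s =>
    (compl_spec hO (M c) x).lower _
  have hone : ∑ s, y s / Z = 1 := by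
    rw [← Finset.sum_div, div_self hZ.ne']
  have heq := (Finset.sum_eq_sum_iff_of_le (s := Finset.univ)
    (fun s _ => (hle s).trans (hlc s))).1 (by rw [hone, hsum])
  intro s
  have h := heq s (Finset.mem_univ s)
  exact ⟨le_antisymm ((hlc s).trans h.ge) (hle s), h.symm⟩

end Sampler

/-! ### Values and greedy policies -/

section Discount

variable {γ : ℕ → ℝ}

theorem discNorm_nonneg (hγ : ∀ t, 0 ≤ γ t) (t : ℕ) : 0 ≤ discNorm γ t :=
  tsum_nonneg fun _ => hγ _

theorem discNorm_eq_add (hs : Summable γ) (t : ℕ) : discNorm γ t = γ t + discNorm γ (t + 1) := by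
  have h : Summable fun k => γ (t + k) := by
    simpa only [add_comm] using (summable_nat_add_iff t).2 hs
  rw [discNorm, h.tsum_eq_zero_add, discNorm]
  simp only [add_zero]
  congr 1
  exact tsum_congr fun k => by rw [add_assoc, add_comm 1 k]

theorem discNorm_antitone (hγ : ∀ t, 0 ≤ γ t) (hs : Summable γ) : Antitone (discNorm γ) :=
  antitone_nat_of_succ_le fun t => by rw [discNorm_eq_add hs t]; linarith [hγ t]

theorem tendsto_discNorm (γ : ℕ → ℝ) (t : ℕ) :
    Tendsto (fun m => discNorm γ (t + m)) atTop (𝓝 0) := by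
  have h := tendsto_sum_nat_add γ
  have e : (fun i => ∑' k, γ (k + i)) = discNorm γ := by
    funext i
    exact tsum_congr fun k => by rw [add_comm]
  rw [e] at h
  simpa only [add_comm] using (tendsto_add_atTop_iff_nat t).2 h

end Discount

/-! ### Finite-horizon values, their limits and the Bellman recursion -/

section Values

variable {A E : Type*} [Fintype A] [Fintype E] {r : E → ℝ} {γ : ℕ → ℝ} {ρ : Env A E}

/-- Environments: the percept probabilities are nonnegative and sum to one. -/
def IsEnv (ρ : Env A E) : Prop := ∀ h a, (∀ e, 0 ≤ ρ h a e) ∧ ∑ e, ρ h a e = 1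

/-- The optimal undiscounted value over the next `m` steps. -/
noncomputable def optVal (r : E → ℝ) (γ : ℕ → ℝ) (ρ : Env A E) : ℕ → List (A × E) → ℝ
  | 0, _ => 0
  | m + 1, h => Finset.univ.fold max 0 fun a => ∑ e,
      (ρ h a e * (γ h.length * r e) + ρ h a e * optVal r γ ρ m (h ++ [(a, e)]))

/-- The optimal unnormalized value. -/
noncomputable def optLim (r : E → ℝ) (γ : ℕ → ℝ) (ρ : Env A E) (h : List (A × E)) : ℝ :=
  ⨆ m, optVal r γ ρ m h

/-- The optimal unnormalized value of an action. -/
noncomputable def actVal (r : E → ℝ) (γ : ℕ → ℝ) (ρ : Env A E) (h : List (A × E)) (a : A) : ℝ :=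
  ∑ e, (ρ h a e * (γ h.length * r e) + ρ h a e * optLim r γ ρ (h ++ [(a, e)]))

/-- The unnormalized value of a policy over the next `m` steps. -/
noncomputable def polVal (r : E → ℝ) (γ : ℕ → ℝ) (ρ : Env A E) (π : Policy A E) :
    ℕ → List (A × E) → ℝ
  | 0, _ => 0
  | m + 1, h => ∑ a, π h a * ∑ e,
      (ρ h a e * (γ h.length * r e) + ρ h a e * polVal r γ ρ π m (h ++ [(a, e)]))

theorem IsEnv.step_mono (hρ : IsEnv ρ) {h : List (A × E)} {a : A} {f g : E → ℝ}
    (hfg : ∀ e, f e ≤ g e) : ∑ e, (ρ h a e * (γ h.length * r e) + ρ h a e * f e) ≤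
      ∑ e, (ρ h a e * (γ h.length * r e) + ρ h a e * g e) :=
  Finset.sum_le_sum fun e _ => by linarith [mul_le_mul_of_nonneg_left (hfg e) ((hρ h a).1 e)]

theorem IsEnv.step_add (hρ : IsEnv ρ) {h : List (A × E)} {a : A} {f : E → ℝ} {c : ℝ} :
    ∑ e, (ρ h a e * (γ h.length * r e) + ρ h a e * (f e + c)) =
      ∑ e, (ρ h a e * (γ h.length * r e) + ρ h a e * f e) + c := by
  have : ∑ e, (ρ h a e * (γ h.length * r e) + ρ h a e * (f e + c)) =
      ∑ e, (ρ h a e * (γ h.length * r e) + ρ h a e * f e) + ∑ e, ρ h a e * c := by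
    rw [← Finset.sum_add_distrib]
    exact Finset.sum_congr rfl fun e _ => by ring
  rw [this, ← Finset.sum_mul, (hρ h a).2, one_mul]

variable (hr : ∀ e, 0 ≤ r e ∧ r e ≤ 1) (hγ : ∀ t, 0 ≤ γ t) (hs : Summable γ) (hρ : IsEnv ρ)

include hr hγ hρ in
theorem step_nonneg {h : List (A × E)} {a : A} {f : E → ℝ} (hf : ∀ e, 0 ≤ f e) :
    0 ≤ ∑ e, (ρ h a e * (γ h.length * r e) + ρ h a e * f e) :=
  Finset.sum_nonneg fun e _ => add_nonneg
    (mul_nonneg ((hρ h a).1 e) (mul_nonneg (hγ _) (hr e).1)) (mul_nonneg ((hρ h a).1 e) (hf e))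

include hr hγ hs hρ in
theorem step_le {h : List (A × E)} {a : A} {f : E → ℝ}
    (hf : ∀ e, f e ≤ discNorm γ (h.length + 1)) :
    ∑ e, (ρ h a e * (γ h.length * r e) + ρ h a e * f e) ≤ discNorm γ h.length := by
  calc ∑ e, (ρ h a e * (γ h.length * r e) + ρ h a e * f e)
      ≤ ∑ e, ρ h a e * discNorm γ h.length := Finset.sum_le_sum fun e _ => by
        rw [← mul_add, discNorm_eq_add hs]
        refine mul_le_mul_of_nonneg_left (add_le_add ?_ (hf e)) ((hρ h a).1 e)
        nlinarith [hγ h.length, hr e]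
    _ = _ := by rw [← Finset.sum_mul, (hρ h a).2, one_mul]

theorem optVal_nonneg (m : ℕ) (h : List (A × E)) : 0 ≤ optVal r γ ρ m h := by
  cases m with
  | zero => exact le_rfl
  | succ m => exact (Finset.le_fold_max _).2 (Or.inl le_rfl)

include hr hγ hs hρ in
theorem optVal_le_discNorm (m : ℕ) (h : List (A × E)) : optVal r γ ρ m h ≤ discNorm γ h.length := by
  induction m generalizing h with
  | zero => exact discNorm_nonneg hγ _
  | succ m ih =>
    refine (Finset.fold_max_le _).2 ⟨discNorm_nonneg hγ _, fun a _ => ?_⟩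
    exact step_le hr hγ hs hρ fun e => by simpa using ih (h ++ [(a, e)])

include hr hγ hs hρ in
-- Rewards are at most one, so everything after the first `m` steps is worth at most the tail of the
-- discount.
theorem optVal_add_le (m k : ℕ) (h : List (A × E)) :
    optVal r γ ρ (m + k) h ≤ optVal r γ ρ m h + discNorm γ (h.length + m) := by
  induction m generalizing h with
  | zero => simpa [optVal] using optVal_le_discNorm hr hγ hs hρ k h
  | succ m ih =>
    rw [Nat.add_right_comm]
    have h0 := discNorm_nonneg hγ (h.length + (m + 1))
    refine (Finset.fold_max_le _).2 ⟨add_nonneg (optVal_nonneg _ _) h0, fun a _ => ?_⟩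
    have h1 : ∑ e, (ρ h a e * (γ h.length * r e) + ρ h a e * optVal r γ ρ m (h ++ [(a, e)])) ≤
        optVal r γ ρ (m + 1) h :=
      (Finset.le_fold_max _).2 (Or.inr ⟨a, Finset.mem_univ a, le_rfl⟩)
    refine le_trans ?_ (add_le_add_left h1 _)
    rw [← hρ.step_add]
    refine hρ.step_mono fun e => ?_
    have := ih (h ++ [(a, e)])
    rwa [List.length_append, List.length_singleton, add_assoc, add_comm 1 m] at this

include hr hγ hs hρ in
theorem optVal_le_optLim (m : ℕ) (h : List (A × E)) : optVal r γ ρ m h ≤ optLim r γ ρ h :=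
  le_ciSup (f := fun m => optVal r γ ρ m h)
    ⟨discNorm γ h.length, by rintro _ ⟨m, rfl⟩; exact optVal_le_discNorm hr hγ hs hρ m h⟩ m

include hr hγ hs hρ in
theorem optLim_nonneg (h : List (A × E)) : 0 ≤ optLim r γ ρ h :=
  (optVal_nonneg 0 h).trans (optVal_le_optLim hr hγ hs hρ 0 h)

theorem optVal_mono (hρ : IsEnv ρ) (h : List (A × E)) (m : ℕ) : optVal r γ ρ m h ≤ optVal r γ ρ (m + 1) h := by
  induction m generalizing h with
  | zero => exact optVal_nonneg _ _
  | succ m ih =>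
    refine (Finset.fold_max_le _).2 ⟨optVal_nonneg _ _, fun a _ => ?_⟩
    exact (hρ.step_mono fun e => ih _).trans
      ((Finset.le_fold_max _).2 (Or.inr ⟨a, Finset.mem_univ a, le_rfl⟩))

include hr hγ hs hρ in
-- Together with `optVal_le_optLim` this is an approximable error bound: it lets `Approx.of_squeeze`
-- pass to the infinite horizon.
theorem optLim_le (m : ℕ) (h : List (A × E)) :
    optLim r γ ρ h ≤ optVal r γ ρ m h + discNorm γ (h.length + m) :=
  ciSup_le fun k => (monotone_nat_of_le_succ (optVal_mono hρ h)
    (Nat.le_add_left k m)).trans (optVal_add_le hr hγ hs hρ m k h)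

theorem polVal_le_optVal {π : Policy A E} (hρ : IsEnv ρ) (hπ : IsPolicy π) (m : ℕ)
    (h : List (A × E)) : polVal r γ ρ π m h ≤ optVal r γ ρ m h := by
  induction m generalizing h with
  | zero => exact le_rfl
  | succ m ih =>
    calc polVal r γ ρ π (m + 1) h ≤ ∑ a, π h a * optVal r γ ρ (m + 1) h :=
          Finset.sum_le_sum fun a _ => mul_le_mul_of_nonneg_left
            ((hρ.step_mono fun e => ih _).trans
              ((Finset.le_fold_max _).2 (Or.inr ⟨a, Finset.mem_univ a, le_rfl⟩))) ((hπ h).1 a)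
      _ = _ := by rw [← Finset.sum_mul, (hπ h).2, one_mul]

include hr hγ hρ in
theorem polVal_nonneg {π : Policy A E} (hπ : IsPolicy π) (m : ℕ) (h : List (A × E)) :
    0 ≤ polVal r γ ρ π m h := by
  induction m generalizing h with
  | zero => exact le_rfl
  | succ m ih =>
    exact Finset.sum_nonneg fun a _ => mul_nonneg ((hπ h).1 a)
      (step_nonneg hr hγ hρ fun e => ih _)

include hr hγ hρ in
theorem polVal_mono {π : Policy A E} (hπ : IsPolicy π) (h : List (A × E)) (m : ℕ) :
    polVal r γ ρ π m h ≤ polVal r γ ρ π (m + 1) h := by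
  induction m generalizing h with
  | zero => exact polVal_nonneg hr hγ hρ hπ _ _
  | succ m ih =>
    exact Finset.sum_le_sum fun a _ => mul_le_mul_of_nonneg_left
      (hρ.step_mono fun e => ih _) ((hπ h).1 a)

theorem sum_ofFn_succ {α : Type*} [Fintype α] (f : List α → ℝ) (m : ℕ) :
    ∑ s : Fin (m + 1) → α, f (List.ofFn s) = ∑ x, ∑ s : Fin m → α, f (x :: List.ofFn s) := by
  rw [← (Fin.consEquiv fun _ : Fin (m + 1) => α).sum_comp, Fintype.sum_prod_type]
  refine Finset.sum_congr rfl fun x _ => Finset.sum_congr rfl fun s _ => ?_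
  change f (List.ofFn (Fin.cons x s)) = _
  rw [List.ofFn_cons]

theorem sum_polProb_mul_envProb {π : Policy A E} (hρ : IsEnv ρ) (hπ : IsPolicy π) (m : ℕ)
    (h : List (A × E)) : ∑ s : Fin m → A × E,
      polProb π h (List.ofFn s) * envProb ρ h (List.ofFn s) = 1 := by
  induction m generalizing h with
  | zero => simp [polProb, envProb]
  | succ m ih =>
    rw [sum_ofFn_succ (fun s => polProb π h s * envProb ρ h s), Fintype.sum_prod_type]
    calc _ = ∑ a, ∑ e, π h a * ρ h a e * ∑ s : Fin m → A × E,
          polProb π (h ++ [(a, e)]) (List.ofFn s) * envProb ρ (h ++ [(a, e)]) (List.ofFn s) := by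
          refine Finset.sum_congr rfl fun a _ => Finset.sum_congr rfl fun e _ => ?_
          rw [Finset.mul_sum]
          refine Finset.sum_congr rfl fun s _ => ?_
          simp only [polProb, envProb]
          ring
      _ = ∑ a, π h a * ∑ e, ρ h a e := by
          simp only [ih, mul_one, Finset.mul_sum]
      _ = 1 := by simp only [(hρ h _).2, mul_one, (hπ h).2]

/-- Splitting off the first step turns the path sum in `value` into the recursion of `polVal`; the
first reward factors out because continuations have total probability one. -/
theorem sum_discReward {π : Policy A E} (hρ : IsEnv ρ) (hπ : IsPolicy π) (m : ℕ)
    (h : List (A × E)) : ∑ s : Fin m → A × E, discReward r γ h.length (List.ofFn s) *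
      (polProb π h (List.ofFn s) * envProb ρ h (List.ofFn s)) = polVal r γ ρ π m h := by
  induction m generalizing h with
  | zero => simp [discReward, polVal]
  | succ m ih =>
    rw [sum_ofFn_succ (fun s => discReward r γ h.length s * (polProb π h s * envProb ρ h s)),
      Fintype.sum_prod_type, polVal]
    refine Finset.sum_congr rfl fun a _ => ?_
    rw [Finset.mul_sum]
    refine Finset.sum_congr rfl fun e _ => ?_
    have h1 := ih (h ++ [(a, e)])
    have h2 := sum_polProb_mul_envProb hρ hπ m (h ++ [(a, e)])
    rw [List.length_append, List.length_singleton] at h1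
    rw [← h1]
    calc _ = ∑ s : Fin m → A × E, (π h a * ρ h a e * (γ h.length * r e) *
            (polProb π (h ++ [(a, e)]) (List.ofFn s) * envProb ρ (h ++ [(a, e)]) (List.ofFn s)) +
          π h a * ρ h a e * (discReward r γ (h.length + 1) (List.ofFn s) *
            (polProb π (h ++ [(a, e)]) (List.ofFn s) *
              envProb ρ (h ++ [(a, e)]) (List.ofFn s)))) := by
          refine Finset.sum_congr rfl fun s _ => ?_
          simp only [polProb, envProb, discReward]
          ring
      _ = _ := by
          rw [Finset.sum_add_distrib, ← Finset.mul_sum, ← Finset.mul_sum, h2]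
          ring

include hr hγ hs hρ in
theorem tendsto_polVal {π : Policy A E} (hπ : IsPolicy π) (h : List (A × E)) :
    Tendsto (fun m => polVal r γ ρ π m h) atTop (𝓝 (⨆ m, polVal r γ ρ π m h)) :=
  tendsto_atTop_ciSup (monotone_nat_of_le_succ (polVal_mono hr hγ hρ hπ h))
    ⟨discNorm γ h.length, by
      rintro _ ⟨m, rfl⟩
      exact (polVal_le_optVal hρ hπ m h).trans (optVal_le_discNorm hr hγ hs hρ m h)⟩

include hr hγ hs hρ in
theorem value_eq {π : Policy A E} (hπ : IsPolicy π) (h : List (A × E)) :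
    value r γ ρ π h = 1 / discNorm γ h.length * ⨆ m, polVal r γ ρ π m h := by
  rw [value]
  congr 1
  simp only [sum_discReward hρ hπ]
  exact (tendsto_polVal hr hγ hs hρ hπ h).limUnder_eq

include hr hγ hs hρ in
-- A greedy step loses no optimal value, so over `m` steps the only loss is what could still be
-- gained afterwards, which tends to zero.
theorem optLim_le_polVal {π : Policy A E} (hπ : IsPolicy π)
    (hg : ∀ h a, 0 < π h a → ∀ b, actVal r γ ρ h b ≤ actVal r γ ρ h a) (m : ℕ)
    (h : List (A × E)) :
    optLim r γ ρ h ≤ polVal r γ ρ π m h + discNorm γ (h.length + m) := by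
  induction m generalizing h with
  | zero => simpa [polVal, optVal] using optLim_le hr hγ hs hρ 0 h
  | succ m ih =>
    have hact : ∀ a, 0 < π h a → optLim r γ ρ h ≤ actVal r γ ρ h a := by
      intro a ha
      refine ciSup_le fun k => ?_
      have h0 : 0 ≤ actVal r γ ρ h a :=
        step_nonneg hr hγ hρ fun e => optLim_nonneg hr hγ hs hρ _
      cases k with
      | zero => exact h0
      | succ k =>
        refine (Finset.fold_max_le _).2 ⟨h0, fun b _ => le_trans ?_ (hg h a ha b)⟩
        exact hρ.step_mono fun e => optVal_le_optLim hr hγ hs hρ _ _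
    calc optLim r γ ρ h = ∑ a, π h a * optLim r γ ρ h := by
          rw [← Finset.sum_mul, (hπ h).2, one_mul]
      _ ≤ ∑ a, π h a * (∑ e, (ρ h a e * (γ h.length * r e) +
            ρ h a e * polVal r γ ρ π m (h ++ [(a, e)])) + discNorm γ (h.length + (m + 1))) := by
          refine Finset.sum_le_sum fun a _ => ?_
          rcases ((hπ h).1 a).eq_or_lt with h0 | h0
          · rw [← h0]; simp
          · refine mul_le_mul_of_nonneg_left ((hact a h0).trans ?_) h0.le
            rw [← hρ.step_add]
            refine hρ.step_mono fun e => ?_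
            have := ih (h ++ [(a, e)])
            rwa [List.length_append, List.length_singleton, add_assoc, add_comm 1 m] at this
      _ = _ := by
          simp only [mul_add, Finset.sum_add_distrib]
          rw [← Finset.sum_mul, (hπ h).2, one_mul]
          simp only [polVal, mul_add, Finset.sum_add_distrib]

include hr hγ hs hρ in
/-- A policy that only takes actions of maximal value is optimal. -/
theorem isOptimal_of_greedy {π : Policy A E} (hπ : IsPolicy π)
    (hg : ∀ h a, 0 < π h a → ∀ b, actVal r γ ρ h b ≤ actVal r γ ρ h a) :
    IsOptimal r γ ρ π := by
  refine ⟨hπ, fun π' hπ' h => ?_⟩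
  rw [value_eq hr hγ hs hρ hπ', value_eq hr hγ hs hρ hπ]
  refine mul_le_mul_of_nonneg_left ?_ (div_nonneg zero_le_one (discNorm_nonneg hγ _))
  have h1 : (⨆ m, polVal r γ ρ π' m h) ≤ optLim r γ ρ h :=
    ciSup_le fun m => (polVal_le_optVal hρ hπ' m h).trans (optVal_le_optLim hr hγ hs hρ m h)
  refine h1.trans ?_
  have h2 := (tendsto_polVal hr hγ hs hρ hπ h).add (tendsto_discNorm γ h.length)
  rw [add_zero] at h2
  exact ge_of_tendsto' h2 fun m => optLim_le_polVal hr hγ hs hρ hπ hg m h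

end Values

/-! ### Path sums and optimal policies -/

section PathSum

variable {δ X Y : Type*} [Primcodable δ] [Fintype X] [Primcodable X] [Fintype Y] [Primcodable Y]

/-- The sum of the weights of all paths compatible with a list of observations. -/
noncomputable def pathSum (W : X → Y → δ × List X → ℝ) (c : δ) : List X → List Y → ℝ
  | _, [] => 1
  | H, y :: s => ∑ x, W x y (c, H) * pathSum W c (H ++ [x]) s

theorem approx_pathSum {V : ℕ → Bool → Prop} {W : X → Y → δ × List X → ℝ}
    (hW : ∀ x y, Approx V (W x y)) :
    Approx V fun p : δ × List X × List Y => pathSum W p.1 p.2.1 p.2.2 := by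
  classical
  -- The recursion branches over the hidden step `x`, while the remaining observations are part of
  -- the state and consumed one at a time.
  let w : X → δ × List X × List Y → ℝ := fun x p =>
    ∑ y, if p.2.2.head? = some y then W x y (p.1, p.2.1) else 0
  let f : ℕ → δ × List X × List Y → ℝ := fun n => Nat.rec (fun _ => 1)
    (fun _ g p => ∑ x, w x p * g (p.1, p.2.1 ++ [x], p.2.2.tail)) n
  have hw : ∀ x, Approx V (w x) := fun x => Approx.sum fun y =>
    Approx.ite (computable_eq (by fun_prop) (Computable.const _))
      ((hW x y).comp (k := fun p : δ × List X × List Y => (p.1, p.2.1)) (by fun_prop)) Approx.zero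
  have hf0 : ∀ n p, 0 ≤ f n p := by
    intro n
    induction n with
    | zero => intro p; exact zero_le_one
    | succ n ih => intro p; exact Finset.sum_nonneg fun x _ => mul_nonneg ((hw x).nonneg p) (ih _)
  have hf := Approx.treeRec (V := V) (κ := Unit) (ι := X) (f := f) (f₀ := fun _ => 1)
    (u := fun _ _ _ => 0) (w := fun _ x => w x)
    (child := fun _ x p => (p.1, p.2.1 ++ [x], p.2.2.tail)) Approx.one
    (fun _ _ => Approx.zero) (fun _ x => hw x) (fun _ x => by fun_prop) (fun _ => rfl) (by
      intro n p
      have h0 : 0 ≤ ∑ x, w x p * f n (p.1, p.2.1 ++ [x], p.2.2.tail) := hf0 (n + 1) p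
      simp only [Finset.univ_unique, Finset.fold_singleton, zero_add, max_eq_left h0]
      rfl)
  have key : ∀ (c : δ) (s : List Y) (H : List X), f s.length (c, H, s) = pathSum W c H s := by
    intro c s
    induction s with
    | nil => intro H; rfl
    | cons y s ih =>
      intro H
      show ∑ x, w x (c, H, y :: s) * f s.length (c, H ++ [x], s) = _
      rw [pathSum]
      refine Finset.sum_congr rfl fun x _ => ?_
      rw [ih]
      congr 1
      simp [w]
  have h := hf.comp (k := fun p : δ × List X × List Y => (p.2.2.length, p)) (by fun_prop)
  simpa only [key] using h

variable {A E : Type*} [Fintype A] [Fintype E] [Primcodable A] [Primcodable E]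

theorem approx_polProb {V : ℕ → Bool → Prop} {π : δ → Policy A E}
    (hπ : ∀ a, Approx V fun p : δ × List (A × E) => π p.1 p.2 a) :
    Approx V fun p : δ × List (A × E) × List (A × E) => polProb (π p.1) p.2.1 p.2.2 := by
  classical
  -- A product along a history is a path sum in which each observation determines its step.
  have h := approx_pathSum (V := V) (δ := δ)
    (W := fun (x y : A × E) p => if x = y then π p.1 p.2 x.1 else 0) (fun x y => by
      by_cases hxy : x = y
      · simpa only [hxy, if_true] using hπ y.1
      · simpa only [hxy, if_false] using Approx.zero)
  have key : ∀ (c : δ) (s H : List (A × E)),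
      pathSum (fun (x y : A × E) p => if x = y then π p.1 p.2 x.1 else 0) c H s =
        polProb (π c) H s := by
    intro c s
    induction s with
    | nil => intro H; rfl
    | cons y s ih => intro H; simp [pathSum, polProb, ih]
  simpa only [key] using h

theorem approx_envProb {V : ℕ → Bool → Prop} {ρ : δ → Env A E}
    (hρ : ∀ a e, Approx V fun p : δ × List (A × E) => ρ p.1 p.2 a e) :
    Approx V fun p : δ × List (A × E) × List (A × E) => envProb (ρ p.1) p.2.1 p.2.2 := by
  classical
  have h := approx_pathSum (V := V) (δ := δ)
    (W := fun (x y : A × E) p => if x = y then ρ p.1 p.2 x.1 x.2 else 0) (fun x y => by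
      by_cases hxy : x = y
      · simpa only [hxy, if_true] using hρ y.1 y.2
      · simpa only [hxy, if_false] using Approx.zero)
  have key : ∀ (c : δ) (s H : List (A × E)),
      pathSum (fun (x y : A × E) p => if x = y then ρ p.1 p.2 x.1 x.2 else 0) c H s =
        envProb (ρ c) H s := by
    intro c s
    induction s with
    | nil => intro H; rfl
    | cons y s ih => intro H; simp [pathSum, envProb, ih]
  simpa only [key] using h

end PathSum

/-! ### Recovering histories from strings of symbols -/

section Parsing

variable {A E : Type*} [Primcodable A] [Primcodable E]

/-- Read a string as a history, possibly followed by an action. -/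
def parseStep (p : Option A × List (A × E)) (s : A ⊕ E) : Option A × List (A × E) :=
  Sum.casesOn s (fun a => (some a, p.2)) fun e =>
    Option.casesOn p.1 (none, p.2) fun a => (none, p.2 ++ [(a, e)])

def parse (x : List (A ⊕ E)) : Option A × List (A × E) := x.foldl parseStep (none, [])

theorem parse_concat (x : List (A ⊕ E)) (s : A ⊕ E) : parse (x ++ [s]) = parseStep (parse x) s := by
  simp [parse]

theorem histStr_concat (h : List (A × E)) (a : A) (e : E) :
    histStr (h ++ [(a, e)]) = histStr h ++ [Sum.inl a] ++ [Sum.inr e] := by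
  simp [histStr]

theorem parse_histStr (h : List (A × E)) : parse (histStr h) = (none, h) := by
  induction h using List.reverseRecOn with
  | nil => rfl
  | append_singleton h z ih =>
    obtain ⟨a, e⟩ := z
    rw [histStr_concat, parse_concat, parse_concat, ih]
    rfl

theorem parse_histStr_action (h : List (A × E)) (a : A) :
    parse (histStr h ++ [Sum.inl a]) = (some a, h) := by
  rw [parse_concat, parse_histStr]
  rfl

theorem computable_parse : Computable (parse : List (A ⊕ E) → Option A × List (A × E)) := by
  refine (Primrec.list_foldl Primrec.id (Primrec.const _)
    (h := fun _ (q : (Option A × List (A × E)) × (A ⊕ E)) => parseStep q.1 q.2) ?_).to_comp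
  refine Primrec.sumCasesOn (Primrec.snd.comp Primrec.snd) ?_ ?_
  · exact Primrec.pair (Primrec.option_some.comp Primrec.snd)
      (Primrec.snd.comp (Primrec.fst.comp (Primrec.snd.comp Primrec.fst)))
  · refine Primrec.option_casesOn
      (Primrec.fst.comp (Primrec.fst.comp (Primrec.snd.comp Primrec.fst))) ?_ ?_
    · exact Primrec.pair (Primrec.const none)
        (Primrec.snd.comp (Primrec.fst.comp (Primrec.snd.comp Primrec.fst)))
    · refine Primrec.pair (Primrec.const none) (Primrec.list_concat.comp
        (Primrec.snd.comp (Primrec.fst.comp (Primrec.snd.comp (Primrec.fst.comp Primrec.fst))))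
        (Primrec.pair Primrec.snd (Primrec.snd.comp Primrec.fst)))

theorem computable_histStr : Computable (histStr : List (A × E) → List (A ⊕ E)) := by
  refine (Primrec.list_flatMap Primrec.id
    (g := fun _ (z : A × E) => [Sum.inl z.1, Sum.inr z.2]) ?_).to_comp
  exact Primrec.list_cons.comp (Primrec.sumInl.comp (Primrec.fst.comp Primrec.snd))
    (Primrec.list_cons.comp (Primrec.sumInr.comp (Primrec.snd.comp Primrec.snd))
      (Primrec.const []))

end Parsing

/-! ### Selecting a maximizer by pairwise comparisons -/

section Scan

variable {A : Type*} [Fintype A]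

open Classical in
/-- Go through a list of actions, moving the probability mass to each action that is preferred
to the present one. -/
noncomputable def scan (g : A → A → ℝ) (a₀ : A) : List A → A → ℝ
  | [], a => if a = a₀ then 1 else 0
  | c :: l, a => scan g a₀ l a * (1 - g c a) + if a = c then ∑ b, scan g a₀ l b * g c b else 0

variable {g : A → A → ℝ} {a₀ : A}

theorem scan_nonneg (hg : ∀ a b, 0 ≤ g a b ∧ g a b ≤ 1) (l : List A) (a : A) :
    0 ≤ scan g a₀ l a := by
  induction l generalizing a with
  | nil => rw [scan]; split_ifs <;> norm_num
  | cons c l ih =>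
    rw [scan]
    refine add_nonneg (mul_nonneg (ih a) (sub_nonneg.2 (hg c a).2)) ?_
    split_ifs
    · exact Finset.sum_nonneg fun b _ => mul_nonneg (ih b) (hg c b).1
    · exact le_rfl

theorem sum_scan (l : List A) : ∑ a, scan g a₀ l a = 1 := by
  classical
  induction l with
  | nil =>
    rw [Finset.sum_eq_single a₀ (fun b _ hb => by rw [scan, if_neg hb]) (by simp), scan, if_pos rfl]
  | cons c l ih =>
    have h : ∀ a, scan g a₀ (c :: l) a = scan g a₀ l a - scan g a₀ l a * g c a +
        if a = c then ∑ b, scan g a₀ l b * g c b else 0 := fun a => by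
      by_cases hac : a = c
      · rw [scan, if_pos hac, mul_sub, mul_one]
      · rw [scan, if_neg hac, mul_sub, mul_one]
    simp only [h, Finset.sum_add_distrib, Finset.sum_sub_distrib, ih, Finset.sum_ite_eq',
      Finset.mem_univ, if_true, sub_add_cancel]

/-- When `c` is strictly better than the present action all mass moves to `c`, and when it is
strictly worse none does. So mass stays on actions at least as good as all those scanned, whatever
happens at ties. -/
theorem scan_pos (hg : ∀ a b, 0 ≤ g a b ∧ g a b ≤ 1) {val : A → ℝ}
    (h1 : ∀ a b, val b < val a → g a b = 1) (h0 : ∀ a b, val a < val b → g a b = 0)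
    (l : List A) {a : A} (ha : 0 < scan g a₀ l a) : ∀ c ∈ l, val c ≤ val a := by
  induction l generalizing a with
  | nil => simp
  | cons c l ih =>
    rw [scan] at ha
    rcases (mul_nonneg (scan_nonneg hg l a) (sub_nonneg.2 (hg c a).2)).lt_or_eq with h | h
    · have hs : 0 < scan g a₀ l a := pos_of_mul_pos_left h (sub_nonneg.2 (hg c a).2)
      have hc : val c ≤ val a := by
        by_contra hlt
        rw [h1 c a (not_le.1 hlt)] at h
        simp at h
      intro c' hc'
      rcases List.mem_cons.1 hc' with rfl | hc'
      · exact hc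
      · exact ih hs c' hc'
    · rw [← h, zero_add] at ha
      split_ifs at ha with hac
      · obtain ⟨b, -, hb⟩ := Finset.exists_ne_zero_of_sum_ne_zero ha.ne'
        have hsb : 0 < scan g a₀ l b :=
          (scan_nonneg hg l b).lt_of_ne' (left_ne_zero_of_mul hb)
        have hcb : val b ≤ val c := by
          by_contra hlt
          exact right_ne_zero_of_mul hb (h0 c b (not_le.1 hlt))
        subst hac
        intro c' hc'
        rcases List.mem_cons.1 hc' with rfl | hc'
        · exact le_rfl
        · exact (ih hsb c' hc').trans hcb
      · exact absurd ha (lt_irrefl _)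

end Scan

/-! ### Oracle-approximable optimal policies -/

section OptimalPolicies

variable {A E : Type*} [Fintype A] [Fintype E] [Primcodable A] [Primcodable E]
  {O : Oracle (A ⊕ E)} (hO : IsReflective O) {r : E → ℝ} {γ : ℕ → ℝ}

theorem isEnv_envOf (T : Machine) : IsEnv (envOf hO T) := fun _ _ =>
  ⟨fun _ => compl_nonneg hO _ _ _, (compl_spec hO T _).sum_percepts⟩

theorem approx_envOf (a : A) (e : E) : Approx (Allowed hO)
    fun p : Machine × List (A × E) => envOf hO p.1 p.2 a e := by
  have h := computable_histStr (A := A) (E := E)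
  exact (approx_compl hO).comp (k := fun p : Machine × List (A × E) =>
    (p.1, histStr p.2 ++ [Sum.inl a], (Sum.inr e : A ⊕ E))) (by fun_prop)

variable (hr : ∀ e, 0 ≤ r e ∧ r e ≤ 1) (hr_est : IsEstimable r) (hγ : ∀ t, 0 ≤ γ t)
  (hs : Summable γ) (hΓ : IsEstimable (discNorm γ))

include hr hr_est hγ hs hΓ

theorem approx_optVal : Approx (Allowed hO)
    fun p : ℕ × Machine × List (A × E) => optVal r γ (envOf hO p.2.1) p.1 p.2.2 := by
  have hΓ' : Approx (Allowed hO) (discNorm γ) := .of_isEstimable hΓ (discNorm_nonneg hγ)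
  -- Only the normalization is assumed estimable; the discount is recovered as the difference of
  -- consecutive values.
  have hγ' : Approx (Allowed hO) γ := by
    have h := hΓ'.sub (hΓ'.comp (k := fun t => t + 1) (by fun_prop))
      (fun t => discNorm_antitone hγ hs (Nat.le_succ t))
    have e : (fun t => discNorm γ t - discNorm γ (t + 1)) = γ := by
      funext t; rw [discNorm_eq_add hs t]; ring
    rwa [e] at h
  have hr' : Approx (Allowed hO) r := .of_isEstimable hr_est fun e => (hr e).1
  exact Approx.treeRec (f := fun m (p : Machine × List (A × E)) =>
      optVal r γ (envOf hO p.1) m p.2) (f₀ := fun _ => 0)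
    (u := fun a e p => envOf hO p.1 p.2 a e * (γ p.2.length * r e))
    (w := fun a e p => envOf hO p.1 p.2 a e) (child := fun a e p => (p.1, p.2 ++ [(a, e)]))
    Approx.zero
    (fun a e => (approx_envOf hO a e).mul ((hγ'.comp (by fun_prop)).mul
      (hr'.comp (Computable.const e))))
    (fun a e => approx_envOf hO a e) (fun a e => by fun_prop) (fun _ => rfl) (fun _ _ => rfl)

theorem approx_actVal (a : A) : Approx (Allowed hO)
    fun p : Machine × List (A × E) => actVal r γ (envOf hO p.1) p.2 a := by
  have hΓ' : Approx (Allowed hO) (discNorm γ) := .of_isEstimable hΓ (discNorm_nonneg hγ)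
  have hγ' : Approx (Allowed hO) γ := by
    have h := hΓ'.sub (hΓ'.comp (k := fun t => t + 1) (by fun_prop))
      (fun t => discNorm_antitone hγ hs (Nat.le_succ t))
    have e : (fun t => discNorm γ t - discNorm γ (t + 1)) = γ := by
      funext t; rw [discNorm_eq_add hs t]; ring
    rwa [e] at h
  have hr' : Approx (Allowed hO) r := .of_isEstimable hr_est fun e => (hr e).1
  have hlim : Approx (Allowed hO) fun p : Machine × List (A × E) =>
      optLim r γ (envOf hO p.1) p.2 :=
    Approx.of_squeeze (approx_optVal hO hr hr_est hγ hs hΓ)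
      (t := fun m p => discNorm γ (p.2.length + m))
      (hΓ'.comp (k := fun q : ℕ × Machine × List (A × E) => q.2.2.length + q.1) (by fun_prop))
      (fun m p => optVal_le_optLim hr hγ hs (isEnv_envOf hO _) m p.2)
      (fun m p => optLim_le hr hγ hs (isEnv_envOf hO _) m p.2)
      (fun p => tendsto_discNorm γ p.2.length)
  exact Approx.sum fun e => ((approx_envOf hO a e).mul ((hγ'.comp (by fun_prop)).mul
    (hr'.comp (Computable.const e)))).add ((approx_envOf hO a e).mul
      (hlim.comp (k := fun p : Machine × List (A × E) => (p.1, p.2 ++ [(a, e)])) (by fun_prop)))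

/-- Comparing two actions with the help of the oracle; ties are broken arbitrarily. -/
theorem exists_comparator (a b : A) : ∃ M : Machine → Machine, Computable M ∧ ∀ T h,
    (actVal r γ (envOf hO T) h b < actVal r γ (envOf hO T) h a →
      compl hO (M T) (histStr h) (Sum.inl a) = 1) ∧
    (actVal r γ (envOf hO T) h a < actVal r γ (envOf hO T) h b →
      compl hO (M T) (histStr h) (Sum.inl a) = 0) := by
  classical
  by_cases hab : a = b
  · subst hab
    exact ⟨id, Computable.id, fun T h => ⟨fun h => absurd h (lt_irrefl _),
      fun h => absurd h (lt_irrefl _)⟩⟩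
  have hparse := computable_parse (A := A) (E := E)
  have hv : ∀ a, Approx (Allowed hO) fun p : Machine × List (A ⊕ E) =>
      actVal r γ (envOf hO p.1) (parse p.2).2 a := fun a =>
    (approx_actVal hO hr hr_est hγ hs hΓ a).comp
      (k := fun p : Machine × List (A ⊕ E) => (p.1, (parse p.2).2)) (by fun_prop)
  -- At most one of the two positive parts is nonzero, so unless the values tie, the normalized
  -- weight is one for the better action. At a tie the total weight is zero and nothing is claimed
  -- about the completion.
  obtain ⟨M, hM, hspec⟩ := exists_sampler hO (γ := Machine) (B := A) (ι := Sum.inl)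
    (fun T x => (compl_spec hO T x).sum_actions)
    (N := fun s p => if s = a then
        max (actVal r γ (envOf hO p.1) (parse p.2).2 a -
          actVal r γ (envOf hO p.1) (parse p.2).2 b) 0
      else if s = b then
        max (actVal r γ (envOf hO p.1) (parse p.2).2 b -
          actVal r γ (envOf hO p.1) (parse p.2).2 a) 0
      else 0)
    (fun s => by
      by_cases h1 : s = a
      · simpa only [h1, if_true] using (hv a).tsub (hv b)
      · by_cases h2 : s = b
        · simpa only [h1, h2, if_true, if_false, Ne.symm hab] using (hv b).tsub (hv a)
        · simpa only [h1, h2, if_false] using Approx.zero)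
  refine ⟨M, hM, fun T h => ?_⟩
  have hsp := hspec T (histStr h)
  simp only [parse_histStr] at hsp
  set va := actVal r γ (envOf hO T) h a
  set vb := actVal r γ (envOf hO T) h b
  have hsum : (∑ s, if s = a then max (va - vb) 0 else if s = b then max (vb - va) 0 else 0) =
      max (va - vb) 0 + max (vb - va) 0 := by
    rw [← Finset.add_sum_erase _ _ (Finset.mem_univ a), if_pos rfl]
    congr 1
    rw [← Finset.add_sum_erase _ _ (Finset.mem_erase.2 ⟨Ne.symm hab, Finset.mem_univ b⟩),
      if_neg (Ne.symm hab), if_pos rfl, Finset.sum_eq_zero, add_zero]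
    intro s hs
    simp only [Finset.mem_erase] at hs
    rw [if_neg hs.2.1, if_neg hs.1]
  rw [hsum] at hsp
  constructor
  · intro hlt
    have e1 : max (va - vb) 0 = va - vb := max_eq_left (by linarith)
    have e2 : max (vb - va) 0 = 0 := max_eq_right (by linarith)
    rw [e1, e2, add_zero] at hsp
    rw [(hsp (by linarith) a).2, if_pos rfl, div_self (by linarith)]
  · intro hlt
    have e1 : max (vb - va) 0 = vb - va := max_eq_left (by linarith)
    have e2 : max (va - vb) 0 = 0 := max_eq_right (by linarith)
    rw [e1, e2, zero_add] at hsp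
    rw [(hsp (by linarith) a).2, if_pos rfl, zero_div]

/-- Greedy policies for all environments `ν_T` can be chosen so that their action probabilities
can be approximated from oracle answers, uniformly in `T`. -/
theorem exists_greedy_policy : ∃ opt : Machine → Policy A E, (∀ T, IsPolicy (opt T)) ∧
    (∀ T h a, 0 < opt T h a → ∀ b,
      actVal r γ (envOf hO T) h b ≤ actVal r γ (envOf hO T) h a) ∧
    ∀ a, Approx (Allowed hO) fun p : Machine × List (A × E) => opt p.1 p.2 a := by
  classical
  choose M hM hspec using exists_comparator hO hr hr_est hγ hs hΓ
  have hne : Nonempty A := by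
    by_contra hemp
    rw [not_nonempty_iff] at hemp
    have := (compl_spec hO Nat.Partrec.Code.zero []).sum_actions
    simp at this
  obtain ⟨a₀⟩ := hne
  -- The preference is the completed probability and not a halting probability: it is defined and
  -- approximable even at ties, where the comparing machine may run forever.
  let g : Machine × List (A × E) → A → A → ℝ := fun p c a =>
    compl hO (M c a p.1) (histStr p.2) (Sum.inl c)
  have hg : ∀ p a b, 0 ≤ g p a b ∧ g p a b ≤ 1 := fun p a b =>
    ⟨compl_nonneg hO _ _ _, compl_le_one hO _ _ _⟩
  have hgA : ∀ c a, Approx (Allowed hO) fun p => g p c a := fun c a => by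
    have h1 := computable_histStr (A := A) (E := E)
    have h2 := hM c a
    exact (approx_compl hO).comp (k := fun p : Machine × List (A × E) =>
      (M c a p.1, histStr p.2, (Sum.inl c : A ⊕ E))) (by fun_prop)
  have hscan : ∀ (l : List A) a, Approx (Allowed hO) fun p => scan (g p) a₀ l a := by
    intro l
    induction l with
    | nil =>
      intro a
      by_cases h : a = a₀
      · simpa only [scan, h, if_true] using Approx.one
      · simpa only [scan, h, if_false] using Approx.zero
    | cons c l ih =>
      intro a
      have h1 := (ih a).mul (Approx.one.sub (hgA c a) fun p => (hg p c a).2)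
      by_cases h : a = c
      · simp only [scan, h, if_true]
        subst h
        exact h1.add (Approx.sum fun b => (ih b).mul (hgA a b))
      · simpa only [scan, h, if_false] using h1.add Approx.zero
  refine ⟨fun T h a => scan (g (T, h)) a₀ Finset.univ.toList a, fun T h =>
    ⟨fun a => scan_nonneg (hg _) _ a, sum_scan _⟩, fun T h a ha b => ?_, hscan _⟩
  exact scan_pos (hg (T, h)) (val := actVal r γ (envOf hO T) h)
    (fun a b hab => (hspec a b T h).1 hab) (fun a b hab => (hspec a b T h).2 hab) _ ha b (by simp)

end OptimalPolicies

/-! ### Resampling times -/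

section Resampling

variable (γ ε : ℕ → ℝ)

theorem strictMono_resampleTime : StrictMono (resampleTime γ ε) :=
  strictMono_nat_of_lt_succ fun i => by
    rw [resampleTime]
    exact Nat.lt_add_of_pos_right (lt_of_lt_of_le Nat.one_pos (le_max_left _ _))

theorem lastResample_spec (t : ℕ) : lastResample γ ε t ≤ t ∧
    (∃ i, resampleTime γ ε i = lastResample γ ε t) ∧
    ∀ i, resampleTime γ ε i ≤ t → resampleTime γ ε i ≤ lastResample γ ε t := by
  have hb : BddAbove {s : ℕ | s ≤ t ∧ ∃ i, resampleTime γ ε i = s} := ⟨t, fun s hs => hs.1⟩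
  have hmem := Nat.sSup_mem (s := {s : ℕ | s ≤ t ∧ ∃ i, resampleTime γ ε i = s})
    ⟨0, Nat.zero_le t, 0, rfl⟩ hb
  exact ⟨hmem.1, hmem.2, fun i hi => le_csSup hb ⟨hi, i, rfl⟩⟩

theorem lastResample_eq {i t : ℕ} (h1 : resampleTime γ ε i ≤ t)
    (h2 : t < resampleTime γ ε (i + 1)) : lastResample γ ε t = resampleTime γ ε i := by
  obtain ⟨hle, ⟨j, hj⟩, hmax⟩ := lastResample_spec γ ε t
  refine le_antisymm ?_ (hmax i h1)
  rw [← hj] at hle ⊢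
  refine (strictMono_resampleTime γ ε).monotone (Nat.lt_succ_iff.1 ?_)
  exact (strictMono_resampleTime γ ε).lt_iff_lt.1 (hle.trans_lt h2)

theorem exists_resampleTime (t : ℕ) : ∃ i, lastResample γ ε t = resampleTime γ ε i ∧
    resampleTime γ ε i ≤ t ∧ t < resampleTime γ ε (i + 1) := by
  obtain ⟨hle, ⟨j, hj⟩, hmax⟩ := lastResample_spec γ ε t
  refine ⟨j, hj.symm, hj ▸ hle, ?_⟩
  by_contra h
  have h1 := hmax (j + 1) (not_lt.1 h)
  rw [← hj] at h1
  exact absurd h1 (not_le.2 (strictMono_resampleTime γ ε j.lt_succ_self))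

theorem lastResample_eq_of_le {t u : ℕ} (h1 : lastResample γ ε t ≤ u) (h2 : u ≤ t) :
    lastResample γ ε u = lastResample γ ε t := by
  obtain ⟨i, hi, -, hlt⟩ := exists_resampleTime γ ε t
  rw [hi] at h1 ⊢
  exact lastResample_eq γ ε h1 (h2.trans_lt hlt)

/-- This recursion in `t` makes the last resampling time computable from the horizons: it moves
exactly when the block that started there has run its length. -/
theorem lastResample_succ (t : ℕ) : lastResample γ ε (t + 1) =
    if lastResample γ ε t + max 1 (horizon γ (lastResample γ ε t) (ε (lastResample γ ε t))) = t + 1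
    then t + 1 else lastResample γ ε t := by
  obtain ⟨i, hi, hle, hlt⟩ := exists_resampleTime γ ε t
  have hnext : resampleTime γ ε (i + 1) = resampleTime γ ε i +
      max 1 (horizon γ (resampleTime γ ε i) (ε (resampleTime γ ε i))) := rfl
  rw [hi, ← hnext]
  split_ifs with h
  · rw [← h]
    exact lastResample_eq γ ε le_rfl (strictMono_resampleTime γ ε (i + 1).lt_succ_self)
  · exact lastResample_eq γ ε (hle.trans t.le_succ) (by omega)

theorem lastResample_zero : lastResample γ ε 0 = 0 := Nat.le_zero.1 (lastResample_spec γ ε 0).1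

variable {γ ε}

theorem computable_lastResample (h : Computable fun t => horizon γ t (ε t)) :
    Computable (lastResample γ ε) := by
  have hmax : Computable fun l : ℕ => max 1 (horizon γ l (ε l)) :=
    (Primrec.nat_max.to_comp.comp (Computable.const 1) h : _)
  have hmax' : Computable fun q : ℕ × ℕ × ℕ => max 1 (horizon γ q.2.2 (ε q.2.2)) :=
    hmax.comp (by fun_prop)
  have hg : Computable fun q : ℕ × ℕ × ℕ =>
      if q.2.2 + max 1 (horizon γ q.2.2 (ε q.2.2)) = q.2.1 + 1 then q.2.1 + 1 else q.2.2 :=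
    computable_ite (computable_eq (computable_add (by fun_prop) hmax') (by fun_prop))
      (by fun_prop) (by fun_prop)
  have hr := Computable.nat_rec (f := fun t : ℕ => t) (g := fun _ => 0)
    (h := fun _ (q : ℕ × ℕ) =>
      if q.2 + max 1 (horizon γ q.2 (ε q.2)) = q.1 + 1 then q.1 + 1 else q.2)
    Computable.id (Computable.const 0) hg
  refine hr.of_eq fun t => ?_
  induction t with
  | zero => exact (lastResample_zero γ ε).symm
  | succ t ih =>
    rw [lastResample_succ, ← ih]

end Resampling

/-! ### Mixtures of policies -/

section Histories

variable {A E : Type*}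

theorem polProb_concat (π : Policy A E) (h s : List (A × E)) (z : A × E) :
    polProb π h (s ++ [z]) = polProb π h s * π (h ++ s) z.1 := by
  induction s generalizing h with
  | nil => simp [polProb]
  | cons y s ih => simp [polProb, ih, mul_assoc]

theorem envProb_mem_Icc [Fintype E] {ρ : Env A E} (hρ : IsEnv ρ) (h s : List (A × E)) :
    0 ≤ envProb ρ h s ∧ envProb ρ h s ≤ 1 := by
  induction s generalizing h with
  | nil => exact ⟨zero_le_one, le_rfl⟩
  | cons y s ih =>
    have h1 : ρ h y.1 y.2 ≤ 1 := (hρ h y.1).2 ▸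
      Finset.single_le_sum (fun a _ => (hρ h y.1).1 a) (Finset.mem_univ y.2)
    exact ⟨mul_nonneg ((hρ h _).1 _) (ih _).1, mul_le_one₀ h1 (ih _).1 (ih _).2⟩

variable [Fintype A]

theorem polProb_mem_Icc {π : Policy A E} (hπ : IsPolicy π) (h s : List (A × E)) :
    0 ≤ polProb π h s ∧ polProb π h s ≤ 1 := by
  induction s generalizing h with
  | nil => exact ⟨zero_le_one, le_rfl⟩
  | cons y s ih =>
    have h1 : π h y.1 ≤ 1 := (hπ h).2 ▸
      Finset.single_le_sum (fun a _ => (hπ h).1 a) (Finset.mem_univ y.1)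
    exact ⟨mul_nonneg ((hπ h).1 _) (ih _).1, mul_le_one₀ h1 (ih _).1 (ih _).2⟩

/-- Mixing policies with weights `c` along the continuations of a history. -/
noncomputable def mixProb {ι : Type*} (c : ι → ℝ) (p : ι → Policy A E)
    (h s : List (A × E)) : ℝ := ∑' i, c i * polProb (p i) h s

theorem summable_mixProb {ι : Type*} {c : ι → ℝ} {p : ι → Policy A E} (hc : ∀ i, 0 ≤ c i)
    (hs : Summable c) (hp : ∀ i, IsPolicy (p i)) (h s : List (A × E)) :
    Summable fun i => c i * polProb (p i) h s :=
  hs.of_nonneg_of_le (fun i => mul_nonneg (hc i) (polProb_mem_Icc (hp i) h s).1)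
    fun i => mul_le_of_le_one_right (hc i) (polProb_mem_Icc (hp i) h s).2

/-- The mixture policy has the mixture of the action probabilities. -/
theorem polProb_mul_mixProb {ι : Type*} {c : ι → ℝ} {p : ι → Policy A E} (hc : ∀ i, 0 ≤ c i)
    (hs : Summable c) (hp : ∀ i, IsPolicy (p i)) {π : Policy A E} {h s : List (A × E)}
    (hπ : ∀ u, u <+: s → 0 < mixProb c p h u → ∀ a,
      π (h ++ u) a * mixProb c p h u = ∑' i, c i * polProb (p i) h u * p i (h ++ u) a) :
    polProb π h s * mixProb c p h [] = mixProb c p h s := by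
  induction s using List.reverseRecOn with
  | nil => exact one_mul _
  | append_singleton u z ih =>
    have ih := ih fun u' hu' => hπ u' (hu'.trans (List.prefix_append u [z]))
    have hz : ∀ i, c i * polProb (p i) h (u ++ [z]) =
        c i * polProb (p i) h u * p i (h ++ u) z.1 := fun i => by
      rw [polProb_concat]; ring
    have h0 : ∀ i, 0 ≤ c i * polProb (p i) h u := fun i =>
      mul_nonneg (hc i) (polProb_mem_Icc (hp i) h u).1
    rw [polProb_concat, mul_right_comm, ih, mul_comm]
    -- Nothing is assumed about `π` where the mixture has mass zero; there all terms vanish, also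
    -- for the longer continuation, and both sides are zero.
    rcases (tsum_nonneg h0 : 0 ≤ mixProb c p h u).lt_or_eq with hpos | hzero
    · rw [hπ u (List.prefix_append u [z]) hpos]
      exact tsum_congr fun i => (hz i).symm
    · have hall := (hasSum_zero_iff_of_nonneg h0).1
        (by rw [hzero]; exact (summable_mixProb hc hs hp h u).hasSum)
      rw [show mixProb c p h u = 0 from hzero.symm, mul_zero]
      have hall' : ∀ i, c i * polProb (p i) h (u ++ [z]) = 0 := fun i => by
        rw [hz, congrFun hall i, Pi.zero_apply, zero_mul]
      simp only [mixProb, hall', tsum_zero]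

end Histories

/-- The tail of the series is at most the tail of `v`, and since `v` has the known total `1` that
tail is one minus a finite sum. This is where normalization of the prior is used. -/
theorem Approx.tsum {V : ℕ → Bool → Prop} {α ι : Type*} [Primcodable α] [Denumerable ι]
    {g : ι → α → ℝ} {v : ι → ℝ} (hg : Approx V fun p : ι × α => g p.1 p.2) (hv : Approx V v)
    (hsum : HasSum v 1) (hle : ∀ i x, g i x ≤ v i) : Approx V fun x => ∑' i, g i x := by
  have hg0 : ∀ i x, 0 ≤ g i x := fun i x => hg.nonneg (i, x)
  have hdec : Computable (Denumerable.ofNat ι) := Computable.ofNat ι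
  let e := (Denumerable.eqv ι).symm
  have hv1 : HasSum (fun n => v (e n)) 1 := e.hasSum_iff.2 hsum
  have hgs : ∀ x, Summable fun n => g (e n) x := fun x =>
    hv1.summable.of_nonneg_of_le (fun n => hg0 _ x) fun n => hle _ x
  have ht : ∀ x, ∑' i, g i x = ∑' n, g (e n) x := fun x => (e.tsum_eq fun i => g i x).symm
  have hsv : ∀ n, ∑ i ∈ Finset.range n, v (e i) ≤ 1 := fun n =>
    hv1.tsum_eq ▸ hv1.summable.sum_le_tsum _ fun i _ => hv.nonneg _
  have hf : Approx V fun p : ℕ × α => ∑ i ∈ Finset.range p.1, g (e i) p.2 :=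
    Approx.sum_range (f := fun i x => g (e i) x)
      (hg.comp (k := fun p : ℕ × α => (Denumerable.ofNat ι p.1, p.2)) (by fun_prop))
  have hv' : Approx V fun p : ℕ × α => ∑ i ∈ Finset.range p.1, v (e i) :=
    Approx.sum_range (f := fun i _ => v (e i))
      (hv.comp (k := fun p : ℕ × α => Denumerable.ofNat ι p.1) (by fun_prop))
  refine Approx.of_squeeze (f := fun n x => ∑ i ∈ Finset.range n, g (e i) x)
    (t := fun n _ => 1 - ∑ i ∈ Finset.range n, v (e i)) hf
    (Approx.one.sub hv' fun p => hsv p.1) (fun n x => ?_) (fun n x => ?_) (fun x => ?_)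
  · rw [ht]
    exact (hgs x).sum_le_tsum _ fun i _ => hg0 _ x
  · rw [ht, ← hv1.tsum_eq, ← (hgs x).sum_add_tsum_nat_add n,
      ← hv1.summable.sum_add_tsum_nat_add n, add_sub_cancel_left]
    refine add_le_add_right ?_ _
    exact ((summable_nat_add_iff n).2 (hgs x)).tsum_le_tsum (fun i => hle _ x)
      ((summable_nat_add_iff n).2 hv1.summable)
  · simpa using hv1.tendsto_sum_nat.const_sub 1

/-! ### Mixtures within one resampling block -/

section Blocks

variable {A E : Type*} [Fintype A] {ι : Type*} (γ ε : ℕ → ℝ)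

/-- The part of a history before the last resampling time. -/
noncomputable def pastOf (h : List (A × E)) : List (A × E) := h.take (lastResample γ ε h.length)

/-- The part of a history from the last resampling time on. -/
noncomputable def blockOf (h : List (A × E)) : List (A × E) := h.drop (lastResample γ ε h.length)

/-- Shortening a history within its block does not move the last resampling time, so the mixture
weights stay fixed along the block and the chain rule `polProb_mul_mixProb` applies. -/
theorem pastOf_blockOf_prefix {h u : List (A × E)} (hu : u <+: blockOf γ ε h) :
    pastOf γ ε (pastOf γ ε h ++ u) = pastOf γ ε h ∧ blockOf γ ε (pastOf γ ε h ++ u) = u := by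
  have hle := (lastResample_spec γ ε h.length).1
  have hp : (pastOf γ ε h).length = lastResample γ ε h.length := by simp [pastOf, hle]
  have hu' := hu.length_le
  have hl : lastResample γ ε (pastOf γ ε h ++ u).length = (pastOf γ ε h).length := by
    rw [List.length_append, hp]
    refine lastResample_eq_of_le γ ε (Nat.le_add_right _ _) ?_
    rw [blockOf, List.length_drop] at hu'
    omega
  rw [pastOf, hl, List.take_left, blockOf, hl, List.drop_left]
  exact ⟨rfl, rfl⟩

/-- The weighted mixture of action probabilities within the present block. -/
noncomputable def mixAct (c : ι → ℝ) (p : ι → Policy A E) (h : List (A × E)) (a : A) : ℝ :=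
  ∑' i, c i * polProb (p i) (pastOf γ ε h) (blockOf γ ε h) * p i h a

variable {c : ι → ℝ} {p : ι → Policy A E} (hc : ∀ i, 0 ≤ c i) (hs : Summable c)
  (hp : ∀ i, IsPolicy (p i))

include hc hs hp

theorem summable_mixAct (h : List (A × E)) (a : A) : Summable fun i =>
    c i * polProb (p i) (pastOf γ ε h) (blockOf γ ε h) * p i h a :=
  (summable_mixProb hc hs hp _ _).of_nonneg_of_le
    (fun i => mul_nonneg (mul_nonneg (hc i) (polProb_mem_Icc (hp i) _ _).1) ((hp i h).1 a))
    fun i => mul_le_of_le_one_right (mul_nonneg (hc i) (polProb_mem_Icc (hp i) _ _).1)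
      ((hp i h).2 ▸ Finset.single_le_sum (fun a _ => (hp i h).1 a) (Finset.mem_univ a))

theorem mixAct_nonneg (h : List (A × E)) (a : A) : 0 ≤ mixAct γ ε c p h a := tsum_nonneg fun i =>
  mul_nonneg (mul_nonneg (hc i) (polProb_mem_Icc (hp i) _ _).1) ((hp i h).1 a)

theorem sum_mixAct (h : List (A × E)) :
    ∑ a, mixAct γ ε c p h a = mixProb c p (pastOf γ ε h) (blockOf γ ε h) := by
  simp only [mixAct]
  rw [← Summable.tsum_finsetSum fun a _ => summable_mixAct γ ε hc hs hp h a]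
  exact tsum_congr fun i => by rw [← Finset.mul_sum, (hp i h).2, mul_one]

theorem polProb_blockOf_mul {π : Policy A E} (h : List (A × E))
    (hπ : ∀ h', pastOf γ ε h' = pastOf γ ε h →
      0 < mixProb c p (pastOf γ ε h') (blockOf γ ε h') → ∀ a,
      π h' a * mixProb c p (pastOf γ ε h') (blockOf γ ε h') = mixAct γ ε c p h' a) :
    polProb π (pastOf γ ε h) (blockOf γ ε h) * mixProb c p (pastOf γ ε h) [] =
      mixProb c p (pastOf γ ε h) (blockOf γ ε h) := by
  refine polProb_mul_mixProb hc hs hp fun u hu hpos a => ?_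
  obtain ⟨h1, h2⟩ := pastOf_blockOf_prefix γ ε hu
  have h3 := hπ (pastOf γ ε h ++ u) h1
  rw [h1, h2] at h3
  have h4 := h3 hpos a
  rwa [mixAct, h1, h2] at h4

end Blocks

/-! ### Grouping machines by environment -/

section Fibers

variable {A E : Type*} [Fintype A] [Fintype E] [Primcodable A] [Primcodable E]
  {O : Oracle (A ⊕ E)} (hO : IsReflective O)

/-- Machines are partitioned according to the environments they describe. -/
noncomputable def fiberEquiv : (Σ ρ : MRefl hO, {T : Machine // envOf hO T = ρ.1}) ≃ Machine where
  toFun x := x.2.1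
  invFun T := ⟨⟨envOf hO T, T, rfl⟩, T, rfl⟩
  left_inv := by
    rintro ⟨⟨ρ, _⟩, T, hT⟩
    change envOf hO T = ρ at hT
    subst hT
    rfl
  right_inv _ := rfl

theorem tsum_fibers {F : Machine → ℝ} (hF : Summable F) :
    ∑' ρ : MRefl hO, ∑' T : {T : Machine // envOf hO T = ρ.1}, F T.1 = ∑' T, F T := by
  rw [← (fiberEquiv hO).tsum_eq F]
  exact (Summable.tsum_sigma ((fiberEquiv hO).summable_iff.2 hF)).symm

theorem hasSum_of_fibers {v : Machine → ℝ} {w : MRefl hO → ℝ} (h0 : ∀ T, 0 ≤ v T)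
    (hv : ∀ ρ : MRefl hO, HasSum (fun T : {T : Machine // envOf hO T = ρ.1} => v T.1) (w ρ))
    (hw : HasSum w 1) : HasSum v 1 := by
  have hs : Summable fun x => v (fiberEquiv hO x) :=
    (summable_sigma_of_nonneg fun x => h0 _).2 ⟨fun ρ => (hv ρ).summable, by
      refine hw.summable.congr fun ρ => ?_
      exact (hv ρ).tsum_eq.symm⟩
  have h := (HasSum.sigma (f := fun x => v (fiberEquiv hO x)) hs.hasSum hv).unique hw
  exact h ▸ (fiberEquiv hO).hasSum_iff.1 hs.hasSum

end Fibers

/-! ### Thompson sampling policies -/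

section Thompson

variable {A E : Type*} [Fintype A] [Fintype E] [Primcodable A] [Primcodable E]
  {O : Oracle (A ⊕ E)} (hO : IsReflective O) {r : E → ℝ} {γ ε : ℕ → ℝ}

theorem mixAct_eq_zero {ι : Type*} {c : ι → ℝ} {p : ι → Policy A E} (hc : ∀ i, 0 ≤ c i)
    (hs : Summable c) (hp : ∀ i, IsPolicy (p i)) {h : List (A × E)}
    (h0 : ¬ 0 < mixProb c p (pastOf γ ε h) (blockOf γ ε h)) (a : A) :
    mixAct γ ε c p h a = 0 := by
  refine le_antisymm ?_ (mixAct_nonneg γ ε hc hs hp h a)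
  exact (Finset.single_le_sum (fun b _ => mixAct_nonneg γ ε hc hs hp h b)
    (Finset.mem_univ a)).trans ((sum_mixAct γ ε hc hs hp h).trans_le (not_lt.1 h0))

/-- The policy that mixes `p` with weights `c`, and follows `p i₀` if the mixture is undefined. -/
noncomputable def mixPolicy (γ ε : ℕ → ℝ) {ι : Type*} (c : ι → ℝ) (p : ι → Policy A E) (i₀ : ι) :
    Policy A E := fun h a =>
  open Classical in
  if 0 < mixProb c p (pastOf γ ε h) (blockOf γ ε h) then
    mixAct γ ε c p h a / mixProb c p (pastOf γ ε h) (blockOf γ ε h)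
  else p i₀ h a

section Mix

variable {ι : Type*} {c : ι → ℝ} {p : ι → Policy A E} (hc : ∀ i, 0 ≤ c i) (hs : Summable c)
  (hp : ∀ i, IsPolicy (p i)) (i₀ : ι)

include hc hs hp

theorem isPolicy_mixPolicy : IsPolicy (mixPolicy γ ε c p i₀) := by
  intro h
  by_cases hpos : 0 < mixProb c p (pastOf γ ε h) (blockOf γ ε h)
  · simp only [mixPolicy, if_pos hpos]
    refine ⟨fun a => div_nonneg (mixAct_nonneg γ ε hc hs hp h a) hpos.le, ?_⟩
    rw [← Finset.sum_div, sum_mixAct γ ε hc hs hp, div_self hpos.ne']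
  · simp only [mixPolicy, if_neg hpos]
    exact hp i₀ h

/-- Greediness concerns only the support of a policy, and mixing adds nothing to the supports; this
is why a mixture of greedy policies is greedy. -/
theorem exists_of_mixPolicy_pos {h : List (A × E)} {a : A}
    (ha : 0 < mixPolicy γ ε c p i₀ h a) : ∃ i, 0 < p i h a := by
  by_contra! hall
  have h0 : ∀ i, p i h a = 0 := fun i => le_antisymm (hall i) ((hp i h).1 a)
  simp [mixPolicy, mixAct, h0] at ha

/-- Clearing denominators gives an identity that survives where the mixture has mass zero and the
fallback is followed. -/
theorem mixPolicy_mul (h : List (A × E)) (a : A) :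
    (polProb (mixPolicy γ ε c p i₀) (pastOf γ ε h) (blockOf γ ε h) * ∑' i, c i) *
      mixPolicy γ ε c p i₀ h a = mixAct γ ε c p h a := by
  have hmix := polProb_blockOf_mul γ ε hc hs hp (π := mixPolicy γ ε c p i₀) h
    fun h' _ hpos a => by rw [mixPolicy, if_pos hpos, div_mul_cancel₀ _ hpos.ne']
  have h1 : mixProb c p (pastOf γ ε h) [] = ∑' i, c i := by simp [mixProb, polProb]
  rw [← h1, hmix]
  by_cases hpos : 0 < mixProb c p (pastOf γ ε h) (blockOf γ ε h)
  · rw [mixPolicy, if_pos hpos, mul_div_cancel₀ _ hpos.ne']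
  · have h2 : mixProb c p (pastOf γ ε h) (blockOf γ ε h) = 0 := le_antisymm (not_lt.1 hpos)
      (tsum_nonneg fun i => mul_nonneg (hc i) (polProb_mem_Icc (hp i) _ _).1)
    rw [h2, zero_mul, mixAct_eq_zero hc hs hp hpos]

end Mix

/-- The weight given to `ν_T` at the last resampling time before the end of `h`. -/
noncomputable def sampleWeight (v : Machine → ℝ) (past : List (A × E)) (T : Machine) : ℝ :=
  v T * envProb (envOf hO T) [] past

variable {w : MRefl hO → ℝ} {v : Machine → ℝ} (hv0 : ∀ T, 0 ≤ v T) (hv1 : HasSum v 1)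
  {opt : Machine → Policy A E} (hopt : ∀ T, IsPolicy (opt T))

include hv0 in
theorem sampleWeight_nonneg (past : List (A × E)) (T : Machine) : 0 ≤ sampleWeight hO v past T :=
  mul_nonneg (hv0 T) (envProb_mem_Icc (isEnv_envOf hO T) _ _).1

include hv0 in
theorem sampleWeight_le (past : List (A × E)) (T : Machine) : sampleWeight hO v past T ≤ v T :=
  mul_le_of_le_one_right (hv0 T) (envProb_mem_Icc (isEnv_envOf hO T) _ _).2

include hv0 hv1 in
theorem summable_sampleWeight (past : List (A × E)) : Summable (sampleWeight hO v past) :=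
  hv1.summable.of_nonneg_of_le (sampleWeight_nonneg hO hv0 past) (sampleWeight_le hO hv0 past)

include hv0 hv1 hopt in
/-- A policy whose action probabilities are the mixture of those of greedy policies for all
`ν_T`, with posterior weights, is a Thompson sampling policy. -/
theorem isThompson_of_mixAct (hr : ∀ e, 0 ≤ r e ∧ r e ≤ 1) (hγ : ∀ t, 0 ≤ γ t) (hs : Summable γ)
    (hv : ∀ ρ : MRefl hO, HasSum (fun T : {T : Machine // envOf hO T = ρ.1} => v T.1) (w ρ))
    (hgreedy : ∀ T h a, 0 < opt T h a → ∀ b,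
      actVal r γ (envOf hO T) h b ≤ actVal r γ (envOf hO T) h a)
    {π : Policy A E} (hπp : IsPolicy π)
    (hπ : ∀ h, 0 < mixProb (sampleWeight hO v (pastOf γ ε h)) opt (pastOf γ ε h) (blockOf γ ε h) →
      ∀ a, π h a = mixAct γ ε (sampleWeight hO v (pastOf γ ε h)) opt h a /
        mixProb (sampleWeight hO v (pastOf γ ε h)) opt (pastOf γ ε h) (blockOf γ ε h)) :
    IsThompson hO r γ ε w π := by
  let i₀ : ∀ ρ : MRefl hO, {T : Machine // envOf hO T = ρ.1} := fun ρ => ⟨ρ.2.choose, ρ.2.choose_spec⟩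
  -- Machines of one environment may have different greedy policies, but a Thompson sampling policy
  -- refers to one policy per environment. Machines in a fiber share the likelihood of the past, so
  -- the weights `v T` already are the posterior weights within the fiber, up to a common factor.
  let best : MRefl hO → Policy A E := fun ρ =>
    mixPolicy γ ε (fun T : {T : Machine // envOf hO T = ρ.1} => v T.1) (fun T => opt T.1) (i₀ ρ)
  have hfib : ∀ past, mixture hO w past = ∑' T, sampleWeight hO v past T := fun past => by
    rw [← tsum_fibers hO (summable_sampleWeight hO hv0 hv1 past), mixture]
    refine tsum_congr fun ρ => ?_
    rw [← (hv ρ).tsum_eq, ← tsum_mul_right]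
    exact tsum_congr fun T => by rw [sampleWeight, T.2]
  refine ⟨hπp, best, fun ρ => ?_, ?_⟩
  · obtain ⟨T, hT⟩ := ρ.2
    refine isOptimal_of_greedy hr hγ hs (hT ▸ isEnv_envOf hO T)
      (isPolicy_mixPolicy (fun _ => hv0 _) (hv ρ).summable (fun _ => hopt _) _) fun h a ha b => ?_
    obtain ⟨i, hi⟩ := exists_of_mixPolicy_pos (fun _ => hv0 _) (hv ρ).summable
      (fun _ => hopt _) _ ha
    have := hgreedy i.1 h a hi b
    rwa [i.2] at this
  rintro h a past block hpast hblock hξ hblk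
  change past = pastOf γ ε h at hpast
  change block = blockOf γ ε h at hblock
  have hD := polProb_blockOf_mul γ ε (sampleWeight_nonneg hO hv0 past)
    (summable_sampleWeight hO hv0 hv1 past) hopt (π := π) h fun h' hp' hpos b => by
      have := hπ h'
      rw [hp', ← hpast] at this
      rw [hp', ← hpast] at hpos ⊢
      rw [this hpos b, div_mul_cancel₀ _ hpos.ne']
  have h1 : mixProb (sampleWeight hO v past) opt (pastOf γ ε h) [] = mixture hO w past := by
    rw [hfib]; simp [mixProb, polProb]
  rw [h1, ← hpast, ← hblock] at hD
  have hDpos : 0 < mixProb (sampleWeight hO v past) opt past block := hD ▸ mul_pos hblk hξ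
  have hπh := hπ h
  rw [← hpast, ← hblock] at hπh
  rw [hπh hDpos a, ← hD, mixAct,
    ← tsum_fibers hO (summable_mixAct γ ε (sampleWeight_nonneg hO hv0 past)
      (summable_sampleWeight hO hv0 hv1 past) hopt h a), ← tsum_div_const]
  refine tsum_congr fun ρ => ?_
  have h2 := mixPolicy_mul (γ := γ) (ε := ε) (fun T : {T : Machine // envOf hO T = ρ.1} => hv0 T.1)
    (hv ρ).summable (fun T => hopt T.1) (i₀ ρ) h a
  rw [(hv ρ).tsum_eq, ← hpast, ← hblock, mixAct, ← hpast, ← hblock] at h2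
  -- The common likelihood is restored here: the part of the mixture over machines that belongs to
  -- `ρ` is the term of `best ρ`.
  have h3 : ∑' T : {T : Machine // envOf hO T = ρ.1}, sampleWeight hO v past T.1 *
      polProb (opt T.1) past block * opt T.1 h a =
      envProb ρ.1 [] past * (polProb (best ρ) past block * w ρ * best ρ h a) := by
    rw [h2, ← tsum_mul_left]
    exact tsum_congr fun T => by rw [sampleWeight, T.2]; ring
  rw [← hpast, ← hblock, h3, posterior]
  field_simp

variable (hr : ∀ e, 0 ≤ r e ∧ r e ≤ 1) (hr_est : IsEstimable r) (hγ : ∀ t, 0 ≤ γ t)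
  (hs : Summable γ) (hΓ : IsEstimable (discNorm γ))

include hr hr_est hγ hs hΓ

theorem exists_thompson (hw : HasSum w 1) (hw_est : IsOEstimablePrior hO w)
    (hε : Computable fun t => horizon γ t (ε t)) : ∃ π ∈ PRefl O, IsThompson hO r γ ε w π := by
  classical
  obtain ⟨v, hv0, hvO, hv⟩ := hw_est
  have hv1 := hasSum_of_fibers hO hv0 hv hw
  obtain ⟨opt, hopt, hgreedy, hoptA⟩ := exists_greedy_policy hO hr hr_est hγ hs hΓ
  let D : List (A × E) → ℝ := fun h =>
    mixProb (sampleWeight hO v (pastOf γ ε h)) opt (pastOf γ ε h) (blockOf γ ε h)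
  let N : List (A × E) → A → ℝ := fun h a => mixAct γ ε (sampleWeight hO v (pastOf γ ε h)) opt h a
  have hND : ∀ h, ∑ a, N h a = D h := fun h => sum_mixAct γ ε (sampleWeight_nonneg hO hv0 _)
    (summable_sampleWeight hO hv0 hv1 _) hopt h
  have hcompl1 : ∀ T x, ∑ a, compl hO T x (Sum.inl a) = 1 := fun T x =>
    (compl_spec hO T x).sum_actions
  have hparse := computable_parse (A := A) (E := E)
  obtain ⟨M, hM⟩ : ∃ M : Machine, ∀ h, 0 < D h → ∀ a,
      compl hO M (histStr h) (Sum.inl a) = N h a / D h := by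
    -- Reading `v` from the oracle takes two distinct actions. With a single action every completion
    -- gives it probability one, and any machine will do.
    rcases subsingleton_or_nontrivial A with hA | ⟨a₁, a₂, hne⟩
    · refine ⟨.zero, fun h hD a => ?_⟩
      have hu : (Finset.univ : Finset A) = {a} := by
        ext b; simp [Subsingleton.elim b a]
      have e1 := hcompl1 .zero (histStr h)
      have e2 := hND h
      rw [hu, Finset.sum_singleton] at e1 e2
      rw [e1, e2, div_self hD.ne']
    have hvle : ∀ T, v T ≤ 1 := fun T => hv1.tsum_eq ▸ hv1.summable.le_tsum T fun i _ => hv0 i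
    have hvA : Approx (Allowed hO) v := approx_of_isOEstimable hO hvO (fun T => ⟨hv0 T, hvle T⟩)
      (s₁ := Sum.inl a₁) (s₂ := Sum.inl a₂) (by simpa using hne) fun T x hl => by
        have h1 := (compl_spec hO T x).upper_action a₁
        have h2 : lam O T x (Sum.inl a₂) ≤
            ∑ b ∈ Finset.univ.erase a₁, lam O T x (Sum.inl b) :=
          Finset.single_le_sum (f := fun b => lam O T x (Sum.inl b))
            (fun b _ => lam_nonneg O T x _) (by simp [hne.symm])
        exact le_antisymm (by linarith) (compl_nonneg hO _ _ _)
    have hL := computable_lastResample hε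
    have hL' : Computable fun h : List (A × E) => lastResample γ ε h.length :=
      hL.comp (by fun_prop)
    have hpast : Computable (pastOf γ ε : List (A × E) → _) := computable_take (by fun_prop) hL'
    have hblock : Computable (blockOf γ ε : List (A × E) → _) := computable_drop (by fun_prop) hL'
    have hNA : ∀ a, Approx (Allowed hO) fun h => N h a := fun a => by
      refine Approx.tsum (v := v) ?_ hvA hv1 fun T h => ?_
      · refine ((Approx.mul (hvA.comp (by fun_prop)) ((approx_envProb (approx_envOf hO)).comp
          (k := fun p : Machine × List (A × E) => (p.1, [], pastOf γ ε p.2)) (by fun_prop))).mul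
          ((approx_polProb hoptA).comp (k := fun p : Machine × List (A × E) =>
            (p.1, pastOf γ ε p.2, blockOf γ ε p.2)) (by fun_prop))).mul (hoptA a)
      · have h1 := polProb_mem_Icc (hopt T) (pastOf γ ε h) (blockOf γ ε h)
        have h2 : opt T h a ≤ 1 := (hopt T h).2 ▸
          Finset.single_le_sum (fun a _ => (hopt T h).1 a) (Finset.mem_univ a)
        have h3 := sampleWeight_nonneg hO hv0 (pastOf γ ε h) T
        exact (mul_le_of_le_one_right (mul_nonneg h3 h1.1) h2).trans
          ((mul_le_of_le_one_right h3 h1.2).trans (sampleWeight_le hO hv0 _ T))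
    obtain ⟨M, -, hM⟩ := exists_sampler hO (γ := Unit) (ι := Sum.inl) hcompl1
      (N := fun a p => N (parse p.2).2 a) fun a => (hNA a).comp
        (k := fun p : Unit × List (A ⊕ E) => (parse p.2).2) (by fun_prop)
    refine ⟨M (), fun h hD a => ?_⟩
    have h1 := hM () (histStr h)
    simp only [parse_histStr, hND] at h1
    exact (h1 hD a).2
  have hπp : IsPolicy fun (h : List (A × E)) a => compl hO M (histStr h) (Sum.inl a) := fun h =>
    ⟨fun a => compl_nonneg hO _ _ _, hcompl1 _ _⟩
  refine ⟨_, ⟨hπp, ?_⟩, isThompson_of_mixAct hO hv0 hv1 hopt hr hγ hs hv hgreedy hπp hM⟩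
  -- The machine `M` need not halt where the mixture vanishes. Its completed action probabilities
  -- always sum to one, so sampling them gives halting probabilities equal to the policy at every
  -- history.
  obtain ⟨M', -, hM'⟩ := exists_sampler hO (γ := Unit) (ι := Sum.inl) hcompl1
    (N := fun a p => compl hO M p.2 (Sum.inl a)) fun a => (approx_compl hO).comp
      (k := fun p : Unit × List (A ⊕ E) => (M, p.2, (Sum.inl a : A ⊕ E))) (by fun_prop)
  refine ⟨M' (), fun h a => ?_⟩
  have h1 := hM' () (histStr h)
  simp only [hcompl1, zero_lt_one, true_imp_iff, div_one] at h1
  exact (h1 a).1.symm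

end Thompson

/-! ### Games and subjective environments -/

section Games

variable {A E : Type*} [Fintype A] [Fintype E] [Primcodable A] [Primcodable E] {n : ℕ}

open Classical in
/-- The contribution of nature and of the other players to the probability of a joint step, if
player `i` sees `y` of it. -/
noncomputable def othersWeight (σ : Game n A E) (π : Fin n → Policy A E) (i : Fin n)
    (x : (Fin n → A) × (Fin n → E)) (y : A × E) (p : Unit × JHist n A E) : ℝ :=
  if (x.1 i, x.2 i) = y then
    (∏ j ∈ Finset.univ.erase i, π j (proj j p.2) (x.1 j)) * σ p.2 x.1 x.2
  else 0

variable {σ : Game n A E} {π : Fin n → Policy A E} {i : Fin n} {π' : Policy A E}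

theorem prod_update_policy (H : JHist n A E) (b : Fin n → A) :
    ∏ j, Function.update π i π' j (proj j H) (b j) =
      π' (proj i H) (b i) * ∏ j ∈ Finset.univ.erase i, π j (proj j H) (b j) := by
  classical
  rw [← Finset.mul_prod_erase _ _ (Finset.mem_univ i), Function.update_self]
  congr 1
  exact Finset.prod_congr rfl fun j hj => by
    rw [Function.update_of_ne (Finset.ne_of_mem_erase hj)]

open Classical in
theorem sum_step (H : JHist n A E) (y : A × E) (C : ℝ) (F : (Fin n → A) × (Fin n → E) → ℝ) :
    (∑ x : (Fin n → A) × (Fin n → E), if (x.1 i, x.2 i) = y then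
      (∏ j, Function.update π i π' j (proj j H) (x.1 j)) * σ H x.1 x.2 * (C * F x) else 0) =
      π' (proj i H) y.1 * C * ∑ x, othersWeight σ π i x y ((), H) * F x := by
  rw [Finset.mul_sum]
  refine Finset.sum_congr rfl fun x _ => ?_
  rw [othersWeight]
  split_ifs with h
  · rw [prod_update_policy, ← h]; ring
  · ring

theorem proj_append (j : Fin n) (H s : JHist n A E) : proj j (H ++ s) = proj j H ++ proj j s :=
  List.map_append

theorem proj_nil (j : Fin n) : proj j ([] : JHist n A E) = [] := rfl

theorem proj_cons (j : Fin n) (x : (Fin n → A) × (Fin n → E)) (s : JHist n A E) :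
    proj j (x :: s) = (x.1 j, x.2 j) :: proj j s := rfl

open Classical in
-- The player's own action probabilities depend only on the observed history, so they are common to
-- all compatible joint histories and factor out.
theorem sum_playProb (H : JHist n A E) (g : List (A × E)) :
    (∑ s : Fin g.length → (Fin n → A) × (Fin n → E), if proj i (List.ofFn s) = g then
      playProb σ (Function.update π i π') H (List.ofFn s) else 0) =
      polProb π' (proj i H) g * pathSum (othersWeight σ π i) () H g := by
  induction g generalizing H with
  | nil => simp [proj, playProb, polProb, pathSum]
  | cons y g ih =>
    rw [List.length_cons, sum_ofFn_succ (fun l => if proj i l = y :: g then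
      playProb σ (Function.update π i π') H l else 0), polProb, pathSum,
      ← sum_step (σ := σ) (π := π)]
    refine Finset.sum_congr rfl fun x _ => ?_
    by_cases hx : (x.1 i, x.2 i) = y
    · have h1 : proj i (H ++ [x]) = proj i H ++ [y] := by rw [proj_append, ← hx]; rfl
      have h2 := ih (H ++ [x])
      rw [h1] at h2
      rw [if_pos hx, ← h2, Finset.mul_sum]
      refine Finset.sum_congr rfl fun s _ => ?_
      simp only [proj_cons, hx, List.cons.injEq, true_and, playProb, mul_ite, mul_zero]
    · simp only [proj_cons, List.cons.injEq, hx, false_and, if_false, Finset.sum_const_zero]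

open Classical in
-- The last percept is still missing here; since the conditionals of the game sum to one, it can be
-- added and summed over. Numerator and denominator of the conditional thus contain the same factor
-- from the player's own policy.
theorem sum_playProb_act (hσ : IsGame σ) (H : JHist n A E) (g : List (A × E)) (a : A) :
    (∑ s : Fin g.length → (Fin n → A) × (Fin n → E), ∑ b : Fin n → A,
      if proj i (List.ofFn s) = g ∧ b i = a then
        playProb σ (Function.update π i π') H (List.ofFn s) *
          ∏ j, Function.update π i π' j (proj j (H ++ List.ofFn s)) (b j) else 0) =
      polProb π' (proj i H) g * π' (proj i H ++ g) a *
        ∑ e, pathSum (othersWeight σ π i) () H (g ++ [(a, e)]) := by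
  induction g generalizing H with
  | nil =>
    simp only [List.length_nil, Finset.univ_unique, Finset.sum_singleton, List.ofFn_zero,
      List.append_nil, List.nil_append, polProb, pathSum, playProb, one_mul, mul_one]
    have h1 : ∀ e, ∑ x, othersWeight σ π i x (a, e) ((), H) = ∑ b : Fin n → A, ∑ e' : Fin n → E,
        if b i = a ∧ e' i = e then
          (∏ j ∈ Finset.univ.erase i, π j (proj j H) (b j)) * σ H b e' else 0 := fun e => by
      rw [Fintype.sum_prod_type]
      simp only [othersWeight, Prod.mk.injEq]
    simp only [h1]
    rw [Finset.sum_comm, Finset.mul_sum]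
    refine Finset.sum_congr rfl fun b _ => ?_
    rw [Finset.sum_comm]
    by_cases hb : b i = a
    · simp only [proj_nil, true_and, hb, if_true, Finset.sum_ite_eq, Finset.mem_univ,
        ← Finset.mul_sum, (hσ H b).2, mul_one]
      rw [prod_update_policy, hb]
    · simp [hb]
  | cons y g ih =>
    rw [List.length_cons, sum_ofFn_succ (fun l => ∑ b : Fin n → A,
      if proj i l = y :: g ∧ b i = a then playProb σ (Function.update π i π') H l *
        ∏ j, Function.update π i π' j (proj j (H ++ l)) (b j) else 0), polProb]
    simp only [List.cons_append, pathSum]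
    rw [Finset.sum_comm (s := (Finset.univ : Finset E)), mul_assoc]
    simp only [← Finset.mul_sum]
    rw [mul_assoc, ← mul_assoc (polProb _ _ _), ← mul_assoc, ← sum_step (σ := σ) (π := π)]
    refine Finset.sum_congr rfl fun x _ => ?_
    by_cases hx : (x.1 i, x.2 i) = y
    · have h1 : proj i (H ++ [x]) = proj i H ++ [y] := by rw [proj_append, ← hx]; rfl
      have h2 := ih (H ++ [x])
      rw [h1, List.append_assoc, List.singleton_append] at h2
      rw [if_pos hx, ← h2, Finset.mul_sum]
      refine Finset.sum_congr rfl fun s _ => ?_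
      rw [Finset.mul_sum]
      refine Finset.sum_congr rfl fun b _ => ?_
      simp only [proj_cons, hx, List.cons.injEq, true_and, playProb, mul_ite, mul_zero, mul_assoc,
        List.append_assoc, List.singleton_append]
    · simp only [proj_cons, List.cons.injEq, hx, false_and, if_false, Finset.sum_const_zero]

variable {O : Oracle (A ⊕ E)} (hO : IsReflective O)

/-- Halting probabilities that sum to one over the actions leave nothing to complete. The oracle
therefore reveals the policies of the other players. -/
theorem compl_eq_of_mem_pRefl {π : Policy A E} (hπ : IsPolicy π) {T : Machine}
    (hT : ∀ h a, π h a = lam O T (histStr h) (Sum.inl a)) (h : List (A × E)) (a : A) :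
    π h a = compl hO T (histStr h) (Sum.inl a) := by
  have hc := compl_spec hO T (histStr h)
  have h1 : ∀ a ∈ Finset.univ, π h a ≤ compl hO T (histStr h) (Sum.inl a) := fun a _ =>
    hT h a ▸ hc.lower _
  exact (Finset.sum_eq_sum_iff_of_le h1).1 ((hπ h).2.trans hc.sum_actions.symm) a
    (Finset.mem_univ a)

theorem computable_proj (j : Fin n) : Computable (proj j : JHist n A E → List (A × E)) :=
  (Primrec.list_map Primrec.id ((Primrec.dom_finite
    fun z : (Fin n → A) × (Fin n → E) => (z.1 j, z.2 j)).comp₂ Primrec₂.right)).to_comp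

theorem approx_othersWeight {e₁ e₂ : E} (hne : e₁ ≠ e₂) (hσ : IsGame σ)
    (hσO : IsOEstimableGame O σ) (hπ : ∀ j, j ≠ i → π j ∈ PRefl O)
    (x : (Fin n → A) × (Fin n → E)) (y : A × E) :
    Approx (Allowed hO) (othersWeight σ π i x y) := by
  classical
  have hσA : Approx (Allowed hO)
      fun z : JHist n A E × (Fin n → A) × (Fin n → E) => σ z.1 z.2.1 z.2.2 := by
    refine approx_of_isOEstimable hO hσO (fun z => ⟨(hσ _ _).1 _, (hσ z.1 z.2.1).2 ▸
      Finset.single_le_sum (fun e _ => (hσ z.1 z.2.1).1 e) (Finset.mem_univ z.2.2)⟩)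
      (s₁ := Sum.inr e₁) (s₂ := Sum.inr e₂) (by simpa using hne) fun T x hl => ?_
    have h1 := (compl_spec hO T x).upper_percept e₁
    have h2 : lam O T x (Sum.inr e₂) ≤ ∑ b ∈ Finset.univ.erase e₁, lam O T x (Sum.inr b) :=
      Finset.single_le_sum (f := fun b => lam O T x (Sum.inr b))
        (fun b _ => lam_nonneg O T x _) (by simp [hne.symm])
    exact le_antisymm (by linarith) (compl_nonneg hO _ _ _)
  change Approx (Allowed hO) fun p => othersWeight σ π i x y p
  by_cases hxy : (x.1 i, x.2 i) = y
  · simp only [othersWeight, if_pos hxy]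
    refine (Approx.prod fun j hj => ?_).mul (hσA.comp
      (k := fun p : Unit × JHist n A E => (p.2, x.1, x.2)) (by fun_prop))
    obtain ⟨hp, T, hT⟩ := hπ j (Finset.ne_of_mem_erase hj)
    simp only [compl_eq_of_mem_pRefl hO hp hT]
    have h1 := computable_histStr (A := A) (E := E)
    have h2 := computable_proj (A := A) (E := E) j
    exact (approx_compl hO).comp (k := fun p : Unit × JHist n A E =>
      (T, histStr (proj j p.2), (Sum.inl (x.1 j) : A ⊕ E))) (by fun_prop)
  · simpa only [othersWeight, if_neg hxy] using Approx.zero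

theorem exists_subjectiveEnv (hσ : IsGame σ) (hσO : IsOEstimableGame O σ)
    (hπ : ∀ j, j ≠ i → π j ∈ PRefl O) : ∃ ρ ∈ MRefl hO, IsSubjectiveEnv σ π i ρ := by
  classical
  let N : List (A × E) → A → E → ℝ := fun h a e =>
    pathSum (othersWeight σ π i) () [] (h ++ [(a, e)])
  have hcompl1 : ∀ T x, ∑ e, compl hO T x (Sum.inr e) = 1 := fun T x =>
    (compl_spec hO T x).sum_percepts
  have hparse := computable_parse (A := A) (E := E)
  obtain ⟨M, hM⟩ : ∃ M : Machine, ∀ h a, 0 < ∑ e, N h a e → ∀ e,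
      envOf hO M h a e = N h a e / ∑ e, N h a e := by
    -- Reading the game from the oracle takes two distinct percepts; with a single percept there is
    -- nothing to predict.
    rcases subsingleton_or_nontrivial E with hE | ⟨e₁, e₂, hne⟩
    · refine ⟨.zero, fun h a hD e => ?_⟩
      have hu : (Finset.univ : Finset E) = {e} := by
        ext b; simp [Subsingleton.elim b e]
      have h1 := hcompl1 .zero (histStr h ++ [Sum.inl a])
      rw [hu, Finset.sum_singleton] at h1 hD ⊢
      rw [div_self hD.ne', envOf, h1]
    have hN : ∀ e, Approx (Allowed hO) fun p : Unit × List (A ⊕ E) =>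
        ∑ a, if (parse p.2).1 = some a then N (parse p.2).2 a e else 0 := fun e =>
      Approx.sum fun a => Approx.ite
        (computable_eq (Computable.fst.comp (hparse.comp Computable.snd)) (Computable.const _))
        ((approx_pathSum (approx_othersWeight hO hne hσ hσO hπ)).comp
          (k := fun p : Unit × List (A ⊕ E) => ((), [], (parse p.2).2 ++ [(a, e)])) (by fun_prop))
        Approx.zero
    obtain ⟨M, -, hM⟩ := exists_sampler hO (ι := Sum.inr) hcompl1 hN
    refine ⟨M (), fun h a hD e => ?_⟩
    have h1 := hM () (histStr h ++ [Sum.inl a])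
    simp only [parse_histStr_action, Option.some.injEq, Finset.sum_ite_eq, Finset.mem_univ,
      if_true] at h1
    exact (h1 hD e).2
  refine ⟨_, ⟨M, rfl⟩, fun π' hπ' h a hpos e => ?_⟩
  have h1 : margHist σ (Function.update π i π') i (h ++ [(a, e)]) =
      polProb π' [] h * π' h a * N h a e := by
    have := sum_playProb (σ := σ) (π := π) (i := i) (π' := π') [] (h ++ [(a, e)])
    rw [margHist]
    convert this using 1
    rw [proj_nil, polProb_concat, List.nil_append]
  have h2 : margHistAct σ (Function.update π i π') i h a =
      polProb π' [] h * π' h a * ∑ e, N h a e := by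
    have := sum_playProb_act (π := π) (i := i) (π' := π') hσ [] h a
    simp only [List.nil_append] at this
    rw [margHistAct]
    exact this
  rw [h2] at hpos
  have h3 : 0 ≤ polProb π' [] h * π' h a :=
    mul_nonneg (polProb_mem_Icc hπ' _ _).1 ((hπ' h).1 a)
  rw [hM h a (pos_of_mul_pos_right hpos h3) e, h1, h2,
    mul_div_mul_left _ _ (left_ne_zero_of_mul hpos.ne')]

end Games

/-! ### Unbounded search and certificates -/

section Search

theorem exists_computable_choice {α β : Type*} [Primcodable α] [Primcodable β] [Inhabited β]
    {P : α × β → Bool} (hP : Computable P) (h : ∀ x, ∃ y, P (x, y) = true) :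
    ∃ f : α → β, Computable f ∧ ∀ x, P (x, f x) = true := by
  let d : ℕ → β := fun n => (Encodable.decode n).getD default
  have hd : Computable d := Computable.option_getD Computable.decode (Computable.const default)
  have hp : Computable fun p : α × ℕ => P (p.1, d p.2) := by fun_prop
  have hdom : ∀ x, (Nat.rfind fun n => Part.some (P (x, d n))).Dom := fun x => by
    obtain ⟨y, hy⟩ := h x
    refine Nat.rfind_dom.2 ⟨Encodable.encode y, ?_, fun _ => trivial⟩
    simp only [d, Encodable.encodek, Option.getD_some, hy]
    exact Part.mem_some _
  have hf : Partrec fun x => Nat.rfind fun n => Part.some (P (x, d n)) :=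
    Partrec.rfind (p := fun x n => Part.some (P (x, d n))) hp
  have hf' : Computable fun x => (Nat.rfind fun n => Part.some (P (x, d n))).get (hdom x) :=
    Partrec.of_eq hf fun x => (Part.some_get (hdom x)).symm
  refine ⟨fun x => d _, hd.comp hf', fun x => ?_⟩
  exact (Part.mem_some_iff.1 (Nat.rfind_spec (Part.get_mem (hdom x)))).symm

/-- A strict inequality is eventually visible from the brackets: an upper bound for `f` falls below
a lower bound for `g`. Equality is never refuted, so nothing of this kind works for `≤`. -/
theorem Approx.exists_certificate {α : Type*} [Primcodable α] {V : ℕ → Bool → Prop} {f g : α → ℝ}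
    (hf : Approx V f) (hg : Approx V g) : ∃ c : α × List Bool → Bool, Computable c ∧ ∀ x,
      (∀ b, Consistent V b → c (x, b) = true → f x < g x) ∧
      (f x < g x → ∀ᶠ b in ansFilter V, c (x, b) = true) := by
  obtain ⟨_, hi, _, hhi, hB⟩ := hf
  obtain ⟨lo, _, hlo, _, hB'⟩ := hg
  refine ⟨fun p => decide (hi p < lo p), computable_lt hhi hlo, fun x => ⟨fun b hb hc => ?_,
    fun hlt => ?_⟩⟩
  · have h1 : (hi (x, b) : ℝ) < lo (x, b) := by exact_mod_cast of_decide_eq_true hc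
    have h2 := (hB x).upper b hb
    have h3 := (hB' x).lower b hb
    exact lt_of_mul_lt_mul_right (h2.trans_lt (h1.trans_le h3)) (by positivity)
  · filter_upwards [((hB x).tendsto_upper.eventually_lt (hB' x).tendsto_lower hlt)] with b hb
    have h1 := (div_lt_div_iff_of_pos_right (by positivity)).1 hb
    exact decide_eq_true (by exact_mod_cast h1)

end Search

/-! ### Schedules with computable horizon -/

section Schedule

variable {γ ε : ℕ → ℝ}

/-- The rational number `m / (n + 1)` lies between `ε t / 2` and `ε t`, and it certifies that the
effective horizon at time `t` is `k`. -/
def IsSchedule (γ ε : ℕ → ℝ) (t m n k : ℕ) : Prop :=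
  ε t * (n + 1) < 2 * m ∧ (m : ℝ) < ε t * (n + 1) ∧
    discNorm γ (t + k) * (n + 1) < m * discNorm γ t ∧
    (k = 0 ∨ m * discNorm γ t < discNorm γ (t + (k - 1)) * (n + 1))

variable (hγ : ∀ t, 0 ≤ γ t) (hs : Summable γ)

include hγ hs

theorem horizon_eq {t k : ℕ} {d : ℝ} (hpos : 0 < discNorm γ t)
    (h1 : discNorm γ (t + k) < d * discNorm γ t)
    (h2 : k = 0 ∨ d * discNorm γ t < discNorm γ (t + (k - 1))) : horizon γ t d = k := by
  have hmem : k ∈ {k : ℕ | discNorm γ (t + k) / discNorm γ t ≤ d} :=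
    (div_le_iff₀ hpos).2 h1.le
  refine le_antisymm (Nat.sInf_le hmem) ?_
  have hmin := Nat.sInf_mem ⟨k, hmem⟩
  by_contra! hlt
  have h3 := h2.resolve_left (by omega)
  have h4 := (div_le_iff₀ hpos).1 (show _ ≤ d from hmin)
  have h5 : discNorm γ (t + (k - 1)) ≤ discNorm γ (t + horizon γ t d) :=
    discNorm_antitone hγ hs (by change horizon γ t d < k at hlt; omega)
  exact absurd h4 (not_le.2 (h3.trans_le h5))

theorem exists_rat_schedule {t : ℕ} (hpos : 0 < discNorm γ t) (he : 0 < ε t) :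
    ∃ m n k : ℕ, IsSchedule γ ε t m n k := by
  obtain ⟨e, hee⟩ : ∃ e, ε t = e := ⟨_, rfl⟩
  simp only [IsSchedule, hee] at he ⊢
  -- The value `3 / 4 * e` is the middle of the permitted range. For the first `k` whose ratio falls
  -- below it, any rational slightly smaller than `3 / 4 * e` has horizon `k`, with strict
  -- inequalities on both sides.
  have hex : ∃ k, discNorm γ (t + k) < 3 / 4 * e * discNorm γ t :=
    ((tendsto_discNorm γ t).eventually_lt_const (by positivity)).exists
  classical
  have hspec := Nat.find_spec hex
  set k := Nat.find hex
  obtain ⟨d, hd1, hd2, hd3⟩ : ∃ d : ℚ, 1 / 2 * e < d ∧ (d : ℝ) < e ∧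
      discNorm γ (t + k) < d * discNorm γ t ∧
      (k = 0 ∨ d * discNorm γ t < discNorm γ (t + (k - 1))) := by
    have h1 : max (1 / 2 * e) (discNorm γ (t + k) / discNorm γ t) < 3 / 4 * e :=
      max_lt (by linarith) ((div_lt_iff₀ hpos).2 hspec)
    obtain ⟨d, hd1, hd2⟩ := exists_rat_btwn h1
    rw [max_lt_iff, div_lt_iff₀ hpos] at hd1
    refine ⟨d, hd1.1, by linarith, hd1.2, ?_⟩
    by_cases hk : k = 0
    · exact Or.inl hk
    · refine Or.inr ?_
      have := Nat.find_min hex (m := k - 1) (by omega)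
      exact (mul_lt_mul_of_pos_right hd2 hpos).trans_le (not_lt.1 this)
  have hd0 : 0 < d := by exact_mod_cast (by linarith : (0 : ℝ) < d)
  obtain ⟨n, hn⟩ : ∃ n, d.den = n + 1 := ⟨d.den - 1, by have := d.pos; omega⟩
  have hm : (d.num.toNat : ℤ) = d.num := Int.toNat_of_nonneg (Rat.num_pos.2 hd0).le
  have hd : (d : ℝ) * (n + 1) = d.num.toNat := by
    have h1 : (d : ℚ) * d.den = d.num := Rat.mul_den_eq_num d
    have h2 : (d : ℝ) * d.den = d.num := by exact_mod_cast h1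
    rw [hn] at h2
    rw [← hm] at h2
    exact_mod_cast h2
  have hn0 : (0 : ℝ) < (n : ℝ) + 1 := by positivity
  refine ⟨d.num.toNat, n, k, ?_, ?_, ?_, ?_⟩
  · rw [← hd]; nlinarith
  · rw [← hd]; exact mul_lt_mul_of_pos_right hd2 hn0
  · rw [← hd]; nlinarith [mul_lt_mul_of_pos_right hd3.1 hn0]
  · refine hd3.2.imp_right fun h => ?_
    rw [← hd]; nlinarith [mul_lt_mul_of_pos_right h hn0]

/-- By monotonicity the zeros of the normalization form a final segment, so the test is a comparison
with a fixed number, or constantly false. The number exists but is not computed from an estimate of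
the normalization. -/
theorem exists_zero_test : Computable fun t => (open Classical in decide (discNorm γ t = 0)) := by
  classical
  by_cases h : ∃ t, discNorm γ t = 0
  · refine (computable_le (Computable.const (Nat.find h)) Computable.id).of_eq fun t => ?_
    refine decide_eq_decide.2 ⟨fun ht => ?_, fun ht => Nat.find_min' h ht⟩
    exact le_antisymm ((discNorm_antitone hγ hs ht).trans (Nat.find_spec h).le)
      (discNorm_nonneg hγ t)
  · push Not at h
    exact (Computable.const false).of_eq fun t => by simp [h t]

theorem exists_schedule_certificate (hΓ : IsEstimable (discNorm γ)) (hε0 : ∀ t, 0 < ε t)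
    (hε : IsEstimable ε) : ∃ c : (ℕ × ℕ × ℕ × ℕ) × List Bool → Bool, Computable c ∧ ∀ x,
      IsSchedule γ ε x.1 x.2.1 x.2.2.1 x.2.2.2 ↔ ∃ b, c (x, b) = true := by
  -- Only estimable functions occur, so no oracle is needed: with every answer allowed, a list of
  -- answers is merely an accuracy.
  let V : ℕ → Bool → Prop := fun _ _ => True
  have hV : ∀ b, Consistent V b := fun _ _ _ _ => trivial
  have hne : (ansFilter V).NeBot := by
    refine ⟨fun hbot => ?_⟩
    obtain ⟨n, hn⟩ := eventually_ansFilter.1 (hbot ▸ eventually_bot : ∀ᶠ _ in ansFilter V, False)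
    exact hn (List.replicate n true) (by simp) (hV _)
  have hΓ' : Approx V (discNorm γ) := .of_isEstimable hΓ (discNorm_nonneg hγ)
  have hε' : Approx V ε := .of_isEstimable hε fun t => (hε0 t).le
  have hm : Approx V fun x : ℕ × ℕ × ℕ × ℕ => (x.2.1 : ℝ) := Approx.natCast (by fun_prop)
  have hn : Approx V fun x : ℕ × ℕ × ℕ × ℕ => (x.2.2.1 : ℝ) + 1 :=
    (Approx.natCast (by fun_prop)).add Approx.one
  have hεn : Approx V fun x : ℕ × ℕ × ℕ × ℕ => ε x.1 * (x.2.2.1 + 1) :=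
    (hε'.comp (by fun_prop)).mul hn
  have hmΓ : Approx V fun x : ℕ × ℕ × ℕ × ℕ => x.2.1 * discNorm γ x.1 :=
    hm.mul (hΓ'.comp (by fun_prop))
  have hk : Computable fun x : ℕ × ℕ × ℕ × ℕ => decide (x.2.2.2 = 0) :=
    computable_eq (by fun_prop) (Computable.const 0)
  obtain ⟨c₁, hc₁, h₁⟩ := hεn.exists_certificate
    ((Approx.natCast (k := fun _ => 2) (Computable.const 2)).mul hm)
  obtain ⟨c₂, hc₂, h₂⟩ := hm.exists_certificate hεn
  obtain ⟨c₃, hc₃, h₃⟩ := ((hΓ'.comp (k := fun x : ℕ × ℕ × ℕ × ℕ => x.1 + x.2.2.2)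
    (by fun_prop)).mul hn).exists_certificate hmΓ
  -- For `k = 0` no minimality has to be certified, and the comparison is replaced by `0 < 1`.
  obtain ⟨c₄, hc₄, h₄⟩ := (Approx.ite hk Approx.zero hmΓ).exists_certificate
    (Approx.ite hk Approx.one ((hΓ'.comp (k := fun x : ℕ × ℕ × ℕ × ℕ => x.1 + (x.2.2.2 - 1))
      (by fun_prop)).mul hn))
  refine ⟨fun p => c₁ p && (c₂ p && (c₃ p && c₄ p)), ?_, fun x => ⟨fun ⟨e1, e2, e3, e4⟩ => ?_, ?_⟩⟩
  · have hand := Primrec.and.to_comp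
    exact hand.comp hc₁ (hand.comp hc₂ (hand.comp hc₃ hc₄))
  · have e4' : (if x.2.2.2 = 0 then 0 else x.2.1 * discNorm γ x.1) <
        if x.2.2.2 = 0 then 1 else discNorm γ (x.1 + (x.2.2.2 - 1)) * ((x.2.2.1 : ℝ) + 1) := by
      split_ifs with hk0
      · exact zero_lt_one
      · exact e4.resolve_left hk0
    obtain ⟨b, hb1, hb2, hb3, hb4⟩ := (((h₁ x).2 (by exact_mod_cast e1)).and
      (((h₂ x).2 e2).and (((h₃ x).2 e3).and ((h₄ x).2 e4')))).exists
    exact ⟨b, by simp [hb1, hb2, hb3, hb4]⟩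
  · rintro ⟨b, hb⟩
    simp only [Bool.and_eq_true] at hb
    have e4 := (h₄ x).1 b (hV b) hb.2.2.2
    refine ⟨by exact_mod_cast (h₁ x).1 b (hV b) hb.1, (h₂ x).1 b (hV b) hb.2.1,
      (h₃ x).1 b (hV b) hb.2.2.1, ?_⟩
    by_cases hk0 : x.2.2.2 = 0
    · exact Or.inl hk0
    · simp only [hk0, if_false] at e4
      exact Or.inr e4

theorem exists_computable_horizon (hΓ : IsEstimable (discNorm γ)) (hε0 : ∀ t, 0 < ε t)
    (hε : IsEstimable ε) : ∃ ε' : ℕ → ℝ, (∀ t, ε t / 2 ≤ ε' t ∧ ε' t ≤ ε t) ∧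
      Computable fun t => horizon γ t (ε' t) := by
  classical
  obtain ⟨c, hc, hcS⟩ := exists_schedule_certificate hγ hs hΓ hε0 hε
  have hz := exists_zero_test hγ hs
  have hP : Computable fun p : ℕ × (ℕ × ℕ × ℕ) × List Bool =>
      decide (discNorm γ p.1 = 0) || c ((p.1, p.2.1), p.2.2) :=
    Primrec.or.to_comp.comp (hz.comp Computable.fst)
      (hc.comp (g := fun p : ℕ × (ℕ × ℕ × ℕ) × List Bool => ((p.1, p.2.1), p.2.2)) (by fun_prop))
  obtain ⟨s, hs', hsP⟩ := exists_computable_choice hP fun t => by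
    by_cases h0 : discNorm γ t = 0
    · exact ⟨((0, 0, 0), []), by simp [h0]⟩
    have hpos := (discNorm_nonneg hγ t).lt_of_ne' h0
    obtain ⟨m, n, k, h⟩ := exists_rat_schedule hγ hs hpos (hε0 t)
    obtain ⟨b, hb⟩ := (hcS (t, m, n, k)).1 h
    exact ⟨((m, n, k), b), by simp [hb]⟩
  have key : ∀ t, discNorm γ t ≠ 0 → IsSchedule γ ε t (s t).1.1 (s t).1.2.1 (s t).1.2.2 :=
    fun t h0 => by
      have h := hsP t
      simp only [h0, decide_false, Bool.false_or] at h
      exact (hcS (t, (s t).1)).2 ⟨_, h⟩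
  refine ⟨fun t => if discNorm γ t = 0 then ε t else (s t).1.1 / ((s t).1.2.1 + 1), fun t => ?_, ?_⟩
  · have := hε0 t
    dsimp only
    split_ifs with h0
    · constructor <;> linarith
    · obtain ⟨e1, e2, -⟩ := key t h0
      have hn0 : (0 : ℝ) < (s t).1.2.1 + 1 := by positivity
      constructor
      · rw [le_div_iff₀ hn0]; linarith
      · rw [div_le_iff₀ hn0]; exact e2.le
  · have hcomp : Computable fun t => if discNorm γ t = 0 then 0 else (s t).1.2.2 :=
      computable_ite hz (Computable.const 0)
        (Computable.snd.comp (Computable.snd.comp (Computable.fst.comp hs')))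
    refine hcomp.of_eq fun t => ?_
    dsimp only
    split_ifs with h0
    -- If the normalization is zero, the quotient is zero by convention, so already `0` meets the
    -- defining condition of the horizon.
    · refine (Nat.le_zero.1 (Nat.sInf_le ?_)).symm
      simpa [h0] using (hε0 t).le
    · obtain ⟨-, -, e3, e4⟩ := key t h0
      have hn0 : (0 : ℝ) < (s t).1.2.1 + 1 := by positivity
      refine (horizon_eq hγ hs ((discNorm_nonneg hγ t).lt_of_ne' h0) ?_ ?_).symm
      · rw [div_mul_eq_mul_div, lt_div_iff₀ hn0]; exact e3
      · refine e4.imp_right fun h => ?_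
        rw [div_mul_eq_mul_div, div_lt_iff₀ hn0]; exact h

end Schedule

end ReflOracle

theorem mainTheorem6 {A E : Type*} [Fintype A] [Fintype E] [Primcodable A] [Primcodable E]
    (O : Oracle (A ⊕ E)) (hO : IsReflective O)
    (r : E → ℝ) (hr : ∀ e, 0 ≤ r e ∧ r e ≤ 1) (hr_est : IsEstimable r)
    (γ : ℕ → ℝ) (hγ : ∀ t, 0 ≤ γ t) (hγ_sum : Summable γ) (hΓ_est : IsEstimable (discNorm γ))
    (w : MRefl hO → ℝ) (hw_norm : HasSum w 1) (hw_est : IsOEstimablePrior hO w) :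
    (∀ ε : ℕ → ℝ, (∀ t, 0 < ε t) → Computable (fun t => horizon γ t (ε t)) →
      ∃ π ∈ PRefl O, IsThompson hO r γ ε w π) ∧
    (∀ ε : ℕ → ℝ, (∀ t, 0 < ε t) → IsEstimable ε →
      ∃ ε' : ℕ → ℝ, (∀ t, ε t / 2 ≤ ε' t ∧ ε' t ≤ ε t) ∧
        Computable (fun t => horizon γ t (ε' t)) ∧
        ∃ π ∈ PRefl O, IsThompson hO r γ ε' w π) ∧
    ((∀ ρ, 0 < w ρ) → ∀ ε : ℕ → ℝ, (∀ t, 0 < ε t) →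
      Computable (fun t => horizon γ t (ε t)) → StrongGrainOfTruthTS hO r γ ε w) := by
  exact ⟨fun ε _ hε => exists_thompson hO hr hr_est hγ hγ_sum hΓ_est hw_norm hw_est hε,
    fun ε hε0 hε => by
      obtain ⟨ε', hle, hH⟩ := exists_computable_horizon hγ hγ_sum hΓ_est hε0 hε
      exact ⟨ε', hle, hH, exists_thompson hO hr hr_est hγ hγ_sum hΓ_est hw_norm hw_est hH⟩,
    fun hw ε _ hε => ⟨hw, fun n σ hσ hσO i π hπ => exists_subjectiveEnv hO hσ hσO hπ,
      exists_thompson hO hr hr_est hγ hγ_sum hΓ_est hw_norm hw_est hε⟩⟩
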